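/- \textbf{Notation.} Let $\mathbb T=\mathbb R\cup\{-\infty\}$ be the tropical numbers ($\max$ as sum, $+$ as product) and let $n\ge 0$. The standard planar network $\Pi_{\rm st}(n)$ consists of $n$ horizontal lines numbered $1,\dots,n$ from bottom to top, running from the sources (left ends) to the sinks (right ends), and of slanted edges $s_{l,i}$, $1\le i<l\le n$, going down to the right from line $l$ to line $l-1$; on line $l$ the ends of the slanted edges occur from left to right in the order: right end of $s_{l+1,1}$, left end of $s_{l,1}$, right end of $s_{l+1,2}$, left end of $s_{l,2}$, …, left end of $s_{l,l-1}$, right end of $s_{l+1,l}$ (right ends only for $l<n$). These ends cut the lines into horizontal edges; all edges are oriented from left to right. A weighting of a network assigns a number in $\mathbb T$ to every edge. For networks $\Pi_1,\dots,\Pi_k$ of rank $n$, the product $\Pi_1\circ\cdots\circ\Pi_k$ is their concatenation (sink $l$ of $\Pi_i$ is identified with source $l$ of $\Pi_{i+1}$). For $\alpha\in\mathbb Z_{\ge0}^k$ with $\sum\alpha_i\le n$, an $\alpha$-multipath is a collection of pairwise vertex-disjoint oriented paths starting at sources of $\Pi_1$, of which exactly $\alpha_i$ end at sinks of $\Pi_i$,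 for each $i$; its weight is the sum of the weights of the edges of all its paths. Let $m_\alpha(w_1,\dots,w_k)\in\mathbb T$ be the maximal weight of an $\alpha$-multipath ($-\infty$ if there is none; $m_{0}=0$). The weighted product satisfies the multi-Gelfand–Zeitlin condition if for every such $\alpha$ there is an $\alpha$-multipath of maximal weight whose set of sources is $\{n-\sum\alpha_i+1,\dots,n\}$ and whose paths ending at sinks of $\Pi_i$ have the set of sinks $\{1,\dots,\alpha_i\}$, for each $i$. Let $\Delta^3(n)=\{(i,j,k)\in\mathbb Z_{\ge0}^3: i+j+k\le n\}$, with barycentric coordinates $(n-i-j-k,i,j,k)$. A function $x:\Delta^3(n)\to\mathbb T$ satisfies the rhombus inequalities if $x_{u+2e_a}+x_{u+e_b+e_c}\le x_{u+e_a+e_b}+x_{u+e_a+e_c}$ for all distinct $a,b,c\in\{0,1,2,3\}$ and all $u\in\mathbb Z_{\ge0}^4$ of sum $n-2$ (points being written in barycentric coordinates), and the octahedron recurrence if $$x_{i,j+1,k}+x_{i+1,j,k+1}=\max\{x_{i+1,j,k}+x_{i,j+1,k+1},\;x_{i,j,k+1}+x_{i+1,j+1,k}\}$$ whenever $i,j,k\ge0$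 and $i+j+k+2\le n$. Let $C_{\mathbb T}$ be the set of all $x:\Delta^3(n)\to\mathbb T$ with $x_{0,0,0}=0$ that satisfy the rhombus inequalities and the octahedron recurrence, and $C_{\mathbb R}$ the cone of those $x\in C_{\mathbb T}$ all of whose values are real. \textbf{Theorem.} Let $\Pi_1=\Pi_2=\Pi_3=\Pi_{\rm st}(n)$, and let $\mathcal W$ be the set of triples $w=(w_1,w_2,w_3)$ of $\mathbb T$-weightings of $\Pi_1,\Pi_2,\Pi_3$ such that $\Pi_1$, $\Pi_2$, $\Pi_3$, $\Pi_1\circ\Pi_2$, $\Pi_2\circ\Pi_3$ and $\Pi_1\circ\Pi_2\circ\Pi_3$, with the corresponding weightings, all satisfy the multi-Gelfand–Zeitlin condition. Then $m=(m_{i,j,k}):\mathcal W\to\mathbb T^{\Delta^3(n)}$ takes values in $C_{\mathbb T}$, and it maps the set of $w\in\mathcal W$ with real weights onto $C_{\mathbb R}$. -/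

import Mathlib

/-!
Tropical weightings of planar networks, multipaths in concatenations of planar networks, the map
`m` to functions on the integer points of a simplex, and the octahedron recurrence cone.
Lines, sources and sinks are numbered from `0` to `n - 1` (bottom to top), networks in a `k`-tuple
from `0` to `k - 1`.
-/

namespace TropHorn

/-- The tropical numbers `ℝ ∪ {-∞}`: `⊔` is the tropical sum, `+` the tropical product. -/
abbrev Trop : Type := WithBot ℝ

/-- Vertices of a network of rank `n`: `n` sources, `n` sinks and the inner vertices. -/
inductive NetVertex (n : ℕ) (W : Type) : Type
  | source (l : Fin n) : NetVertex n W
  | inner (v : W) : NetVertex n W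
  | sink (l : Fin n) : NetVertex n W

/-- A planar network of rank `n`: a finite planar graph drawn (with straight edges) in the strip
`0 ≤ x ≤ width`, `1 ≤ y ≤ n`, without vertical edges, each edge being oriented from left to right,
with `n` sources on the left side of the strip and `n` sinks on its right side, numbered from
bottom to top. -/
structure PlanarNetwork (n : ℕ) where
  Inner : Type
  Edge : Type
  finite_inner : Finite Inner
  finite_edge : Finite Edge
  src : Edge → NetVertex n Inner
  tgt : Edge → NetVertex n Inner
  width : ℝ
  pos : NetVertex n Inner → ℝ × ℝ
  width_pos : 0 < width
  pos_source : ∀ l : Fin n, pos (.source l) = (0, (l : ℝ) + 1)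
  pos_sink : ∀ l : Fin n, pos (.sink l) = (width, (l : ℝ) + 1)
  pos_inner : ∀ v : Inner, pos (.inner v) ∈ Set.Ioo 0 width ×ˢ Set.Icc 1 (n : ℝ)
  pos_injective : Function.Injective pos
  left_to_right : ∀ e, (pos (src e)).1 < (pos (tgt e)).1
  vertex_notMem : ∀ e v, pos v ∉ openSegment ℝ (pos (src e)) (pos (tgt e))
  planar : ∀ e f, e ≠ f →
    Disjoint (openSegment ℝ (pos (src e)) (pos (tgt e))) (segment ℝ (pos (src f)) (pos (tgt f)))

/-! ### The standard network -/

/-- The slanted edges `(L, I)`, `I < L < n`, of the standard network: `(L, I)` is the `I`-th edge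
(from the left) that goes down from line `L` to line `L - 1`. -/
abbrev StdSlant (n : ℕ) : Type := (L : Fin n) × Fin (L : ℕ)

/-- Inner vertices of the standard network: each slanted edge `(L, I)` has its left end on line `L`
and its right end on line `L - 1`. -/
inductive StdInner (n : ℕ) : Type
  | left (s : StdSlant n) : StdInner n
  | right (s : StdSlant n) : StdInner n

/-- Edges of the standard network: the slanted ones, and the horizontal ones, which are named by
their left ends. -/
inductive StdEdge (n : ℕ) : Type
  | slant (s : StdSlant n) : StdEdge n
  | fromSource (l : Fin n) : StdEdge n
  | fromLeft (s : StdSlant n) : StdEdge n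
  | fromRight (s : StdSlant n) : StdEdge n

/-- The left end of an edge. -/
def stdSrc (n : ℕ) : StdEdge n → NetVertex n (StdInner n)
  | .slant s => .inner (.left s)
  | .fromSource l => .source l
  | .fromLeft s => .inner (.left s)
  | .fromRight s => .inner (.right s)

/-- The right end of an edge. From left to right, the vertices on a line `L` with `L + 1 < n` are
the source, `right (L+1, 0)`, `left (L, 0)`, `right (L+1, 1)`, `left (L, 1)`, …, `left (L, L-1)`,
`right (L+1, L)`, the sink; on the top line they are the source, `left (L, 0)`, …, `left (L, L-1)`,
the sink. -/
def stdTgt (n : ℕ) : StdEdge n → NetVertex n (StdInner n)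
  | .slant s => .inner (.right s)
  | .fromSource l =>
      if h : (l : ℕ) + 1 < n then .inner (.right ⟨⟨l + 1, h⟩, ⟨0, Nat.succ_pos _⟩⟩)
      else if h' : 0 < (l : ℕ) then .inner (.left ⟨l, ⟨0, h'⟩⟩)
      else .sink l
  | .fromLeft ⟨L, I⟩ =>
      if h : (L : ℕ) + 1 < n then
        .inner (.right ⟨⟨L + 1, h⟩, ⟨I + 1, Nat.succ_lt_succ I.isLt⟩⟩)
      else if h' : (I : ℕ) + 1 < L then .inner (.left ⟨L, ⟨I + 1, h'⟩⟩)
      else .sink L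
  | .fromRight ⟨L, I⟩ =>
      if h : (I : ℕ) < (L : ℕ) - 1 then
        .inner (.left ⟨⟨(L : ℕ) - 1, lt_of_le_of_lt (Nat.sub_le _ _) L.isLt⟩, ⟨I, h⟩⟩)
      else .sink ⟨(L : ℕ) - 1, lt_of_le_of_lt (Nat.sub_le _ _) L.isLt⟩

/-- Abscissas of the vertices in the drawing of the standard network. -/
def stdX (n : ℕ) : NetVertex n (StdInner n) → ℤ
  | .source _ => 0
  | .inner (.left s) => 3 * (s.2 : ℕ) - 2 * (s.1 : ℕ) + 2 * n
  | .inner (.right s) => 3 * (s.2 : ℕ) - 2 * (s.1 : ℕ) + 2 * n + 1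
  | .sink _ => 3 * n + 1

/-- Ordinates of the vertices in the drawing of the standard network. -/
def stdY (n : ℕ) : NetVertex n (StdInner n) → ℤ
  | .source l => (l : ℕ) + 1
  | .inner (.left s) => (s.1 : ℕ) + 1
  | .inner (.right s) => (s.1 : ℕ)
  | .sink l => (l : ℕ) + 1


theorem stdXY_injective (n : ℕ) (v v' : NetVertex n (StdInner n))
    (hx : stdX n v = stdX n v') (hy : stdY n v = stdY n v') : v = v' := by
  rcases v with l | (⟨L, I⟩ | ⟨L, I⟩) | l <;> rcases v' with l' | (⟨L', I'⟩ | ⟨L', I'⟩) | l' <;>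
    simp only [stdX, stdY] at hx hy <;> first
      | (exfalso; omega)
      | (obtain ⟨L, hL⟩ := L; obtain ⟨I, hI⟩ := I; obtain ⟨L', hL'⟩ := L'; obtain ⟨I', hI'⟩ := I'
         simp only at *
         obtain rfl : L = L' := by omega
         obtain rfl : I = I' := by omega
         rfl)
      | (obtain rfl : l = l' := by omega
         rfl)

/-- Horizontal edges are horizontal. -/
theorem stdY_tgt (n : ℕ) (e : StdEdge n) (he : ∀ s, e ≠ .slant s) :
    stdY n (stdTgt n e) = stdY n (stdSrc n e) := by
  rcases e with s | l | ⟨L, I⟩ | ⟨L, I⟩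
  · exact absurd rfl (he s)
  all_goals
    simp only [stdTgt, stdSrc]
    split_ifs <;> simp only [stdY] <;> omega

theorem stdX_lt (n : ℕ) (e : StdEdge n) : stdX n (stdSrc n e) < stdX n (stdTgt n e) := by
  rcases e with s | l | ⟨L, I⟩ | ⟨L, I⟩
  all_goals
    simp only [stdTgt, stdSrc]
    try split_ifs
  all_goals simp only [stdX]; omega

/-- No vertex lies inside a horizontal edge. -/
theorem stdX_outside (n : ℕ) (e : StdEdge n) (he : ∀ s, e ≠ .slant s)
    (v : NetVertex n (StdInner n)) (hv : stdY n v = stdY n (stdSrc n e)) :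
    stdX n v ≤ stdX n (stdSrc n e) ∨ stdX n (stdTgt n e) ≤ stdX n v := by
  rcases e with s | l | ⟨L, I⟩ | ⟨L, I⟩
  · exact absurd rfl (he s)
  all_goals
    rcases v with l' | (⟨L', I'⟩ | ⟨L', I'⟩) | l' <;> simp only [stdTgt, stdSrc] at hv ⊢ <;>
    split_ifs <;> simp only [stdX, stdY] at hv ⊢ <;> omega

theorem stdY_slant_src (n : ℕ) (s : StdSlant n) :
    stdY n (stdSrc n (.slant s)) = ((s.1 : ℕ) : ℤ) + 1 := rfl

theorem stdY_slant_tgt (n : ℕ) (s : StdSlant n) :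
    stdY n (stdTgt n (.slant s)) = ((s.1 : ℕ) : ℤ) := rfl

/-- The drawing of the standard network. -/
noncomputable def stdPos (n : ℕ) (v : NetVertex n (StdInner n)) : ℝ × ℝ := (stdX n v, stdY n v)

theorem stdSrc_injective (n : ℕ) (e f : StdEdge n) (he : ∀ s, e ≠ .slant s)
    (hf : ∀ s, f ≠ .slant s) (h : stdSrc n e = stdSrc n f) : e = f := by
  rcases e with s | l | s | s <;> rcases f with s' | l' | s' | s' <;> simp_all [stdSrc]

theorem stdVertex_notMem (n : ℕ) (e : StdEdge n) (v : NetVertex n (StdInner n)) :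
    stdPos n v ∉ openSegment ℝ (stdPos n (stdSrc n e)) (stdPos n (stdTgt n e)) := by
  rintro ⟨a, b, ha, hb, hab, h⟩
  simp only [stdPos, Prod.smul_mk, Prod.mk_add_mk, smul_eq_mul, Prod.mk.injEq] at h
  obtain ⟨hx, hy⟩ := h
  obtain rfl : a = 1 - b := by linarith
  by_cases he : ∃ s, e = .slant s
  · obtain ⟨s, rfl⟩ := he
    rw [stdY_slant_src, stdY_slant_tgt] at hy
    push_cast at hy
    have h1 : ((s.1 : ℕ) : ℝ) < (stdY n v : ℝ) := by nlinarith
    have h2 : (stdY n v : ℝ) < ((s.1 : ℕ) : ℝ) + 1 := by nlinarith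
    have h1' : ((s.1 : ℕ) : ℤ) < stdY n v := by exact_mod_cast h1
    have h2' : stdY n v < ((s.1 : ℕ) : ℤ) + 1 := by exact_mod_cast h2
    omega
  · push Not at he
    rw [stdY_tgt n e he] at hy
    have hy' : stdY n v = stdY n (stdSrc n e) := by
      have : (stdY n v : ℝ) = stdY n (stdSrc n e) := by linarith
      exact_mod_cast this
    have hlt : (stdX n (stdSrc n e) : ℝ) < stdX n (stdTgt n e) := by exact_mod_cast stdX_lt n e
    rcases stdX_outside n e he v hy' with h | h
    · have h' : (stdX n v : ℝ) ≤ stdX n (stdSrc n e) := by exact_mod_cast h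
      nlinarith
    · have h' : (stdX n (stdTgt n e) : ℝ) ≤ stdX n v := by exact_mod_cast h
      nlinarith

theorem stdPlanar (n : ℕ) (e f : StdEdge n) (hef : e ≠ f) :
    Disjoint (openSegment ℝ (stdPos n (stdSrc n e)) (stdPos n (stdTgt n e)))
      (segment ℝ (stdPos n (stdSrc n f)) (stdPos n (stdTgt n f))) := by
  rw [Set.disjoint_left]
  intro p hp hq
  by_cases hend : p = stdPos n (stdSrc n f) ∨ p = stdPos n (stdTgt n f)
  · rcases hend with rfl | rfl
    · exact stdVertex_notMem n e _ hp
    · exact stdVertex_notMem n e _ hp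
  push Not at hend
  have hq := mem_openSegment_of_ne_left_right hend.1.symm hend.2.symm hq
  obtain ⟨a, b, ha, hb, hab, rfl⟩ := hp
  obtain ⟨c, d, hc, hd, hcd, h⟩ := hq
  simp only [stdPos, Prod.smul_mk, Prod.mk_add_mk, smul_eq_mul, Prod.mk.injEq] at h
  obtain ⟨hx, hy⟩ := h
  obtain rfl : a = 1 - b := by linarith
  obtain rfl : c = 1 - d := by linarith
  by_cases he : ∃ s, e = .slant s <;> by_cases hf : ∃ s, f = .slant s
  · obtain ⟨⟨L, I⟩, rfl⟩ := he
    obtain ⟨⟨L', I'⟩, rfl⟩ := hf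
    simp only [stdSrc, stdTgt, stdY, stdX] at hx hy
    push_cast at hx hy
    have h1 : ((L : ℕ) : ℝ) < ((L' : ℕ) : ℝ) + 1 := by nlinarith
    have h2 : ((L' : ℕ) : ℝ) < ((L : ℕ) : ℝ) + 1 := by nlinarith
    have h1' : (L : ℕ) < (L' : ℕ) + 1 := by exact_mod_cast h1
    have h2' : (L' : ℕ) < (L : ℕ) + 1 := by exact_mod_cast h2
    obtain rfl : L = L' := by omega
    have hbd : b = d := by nlinarith
    subst hbd
    have hI : ((I : ℕ) : ℝ) = ((I' : ℕ) : ℝ) := by nlinarith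
    have hI' : (I : ℕ) = (I' : ℕ) := by exact_mod_cast hI
    obtain rfl : I = I' := by omega
    exact hef rfl
  · obtain ⟨⟨L, I⟩, rfl⟩ := he
    push Not at hf
    rw [stdY_tgt n f hf] at hy
    rw [stdY_slant_src, stdY_slant_tgt] at hy
    push_cast at hy
    set z := stdY n (stdSrc n f)
    have h1 : ((L : ℕ) : ℝ) < (z : ℝ) := by nlinarith
    have h2 : (z : ℝ) < ((L : ℕ) : ℝ) + 1 := by nlinarith
    have h1' : ((L : ℕ) : ℤ) < z := by exact_mod_cast h1
    have h2' : z < ((L : ℕ) : ℤ) + 1 := by exact_mod_cast h2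
    omega
  · obtain ⟨⟨L, I⟩, rfl⟩ := hf
    push Not at he
    rw [stdY_tgt n e he] at hy
    rw [stdY_slant_src, stdY_slant_tgt] at hy
    push_cast at hy
    set z := stdY n (stdSrc n e)
    have h1 : ((L : ℕ) : ℝ) < (z : ℝ) := by nlinarith
    have h2 : (z : ℝ) < ((L : ℕ) : ℝ) + 1 := by nlinarith
    have h1' : ((L : ℕ) : ℤ) < z := by exact_mod_cast h1
    have h2' : z < ((L : ℕ) : ℤ) + 1 := by exact_mod_cast h2
    omega
  · push Not at he hf
    rw [stdY_tgt n e he, stdY_tgt n f hf] at hy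
    have hyy : stdY n (stdSrc n f) = stdY n (stdSrc n e) := by
      have : (stdY n (stdSrc n f) : ℝ) = stdY n (stdSrc n e) := by linarith
      exact_mod_cast this
    have hne : stdX n (stdSrc n e) ≠ stdX n (stdSrc n f) := fun hxx =>
      hef (stdSrc_injective n e f he hf (stdXY_injective n _ _ hxx hyy.symm))
    have hle : (stdX n (stdSrc n e) : ℝ) < stdX n (stdTgt n e) := by exact_mod_cast stdX_lt n e
    have hlf : (stdX n (stdSrc n f) : ℝ) < stdX n (stdTgt n f) := by exact_mod_cast stdX_lt n f
    rcases stdX_outside n e he _ hyy with h | h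
    · rcases stdX_outside n f hf _ hyy.symm with h' | h'
      · omega
      · have h'' : (stdX n (stdTgt n f) : ℝ) ≤ stdX n (stdSrc n e) := by exact_mod_cast h'
        nlinarith
    · have h'' : (stdX n (stdTgt n e) : ℝ) ≤ stdX n (stdSrc n f) := by exact_mod_cast h
      nlinarith

/-- The standard planar network of rank `n`. -/
noncomputable def stdNetwork (n : ℕ) : PlanarNetwork n where
  Inner := StdInner n
  Edge := StdEdge n
  finite_inner := Finite.of_injective
    (fun v : StdInner n => match v with
      | .left s => (Sum.inl s : StdSlant n ⊕ StdSlant n)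
      | .right s => Sum.inr s)
    (by rintro (s | s) (s' | s') h <;> simp_all)
  finite_edge := Finite.of_injective
    (fun e : StdEdge n => match e with
      | .slant s => (Sum.inl (Sum.inl s) : (StdSlant n ⊕ Fin n) ⊕ (StdSlant n ⊕ StdSlant n))
      | .fromSource l => Sum.inl (Sum.inr l)
      | .fromLeft s => Sum.inr (Sum.inl s)
      | .fromRight s => Sum.inr (Sum.inr s))
    (by rintro (s | s | s | s) (s' | s' | s' | s') h <;> simp_all)
  src := stdSrc n
  tgt := stdTgt n
  width := 3 * n + 1
  pos := stdPos n
  width_pos := by positivity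
  pos_source l := by simp [stdPos, stdX, stdY]
  pos_sink l := by simp [stdPos, stdX, stdY]
  pos_inner v := by
    have h : 0 < stdX n (.inner v) ∧ stdX n (.inner v) < 3 * n + 1 ∧
        1 ≤ stdY n (.inner v) ∧ stdY n (.inner v) ≤ n := by
      rcases v with ⟨L, I⟩ | ⟨L, I⟩ <;> have hI := I.isLt <;> have hL := L.isLt <;>
        simp only [stdX, stdY] <;> omega
    obtain ⟨h1, h2, h3, h4⟩ := h
    refine ⟨⟨?_, ?_⟩, ?_, ?_⟩ <;> simp only [stdPos]
    · exact_mod_cast h1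
    · exact_mod_cast h2
    · exact_mod_cast h3
    · exact_mod_cast h4
  pos_injective v v' h := by
    simp only [stdPos, Prod.mk.injEq, Int.cast_inj] at h
    exact stdXY_injective n v v' h.1 h.2
  left_to_right e := by
    simp only [stdPos]
    exact_mod_cast stdX_lt n e
  vertex_notMem := stdVertex_notMem n
  planar := stdPlanar n

/-! ### Concatenations and multipaths -/

/-- Vertices of the concatenation of a `k`-tuple of networks: the points `(j, l)` of the `k + 1`
verticals, the sink `l` of each network being glued to the source `l` of the next one, and the
inner vertices of the networks. -/
abbrev CompVertex {n k : ℕ} (N : Fin k → PlanarNetwork n) : Type :=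
  (Fin (k + 1) × Fin n) ⊕ ((j : Fin k) × (N j).Inner)

/-- Edges of the concatenation. -/
abbrev CompEdge {n k : ℕ} (N : Fin k → PlanarNetwork n) : Type := (j : Fin k) × (N j).Edge

/-- The vertices of the `j`-th network as vertices of the concatenation. -/
def glue {n k : ℕ} (N : Fin k → PlanarNetwork n) (j : Fin k) :
    NetVertex n (N j).Inner → CompVertex N
  | .source l => .inl (j.castSucc, l)
  | .inner v => .inr ⟨j, v⟩
  | .sink l => .inl (j.succ, l)

/-- Initial vertex of an edge of the concatenation. -/
def compSrc {n k : ℕ} (N : Fin k → PlanarNetwork n) (e : CompEdge N) : CompVertex N :=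
  glue N e.1 ((N e.1).src e.2)

/-- Terminal vertex of an edge of the concatenation. -/
def compTgt {n k : ℕ} (N : Fin k → PlanarNetwork n) (e : CompEdge N) : CompVertex N :=
  glue N e.1 ((N e.1).tgt e.2)

/-- `IsPath N v es v'`: the edges `es`, in this order, form an oriented path from `v` to `v'`. -/
def IsPath {n k : ℕ} (N : Fin k → PlanarNetwork n) :
    CompVertex N → List (CompEdge N) → CompVertex N → Prop
  | v, [], v' => v = v'
  | v, e :: es, v' => compSrc N e = v ∧ IsPath N (compTgt N e) es v'

/-- A tuple of tropical weightings of a tuple of networks. -/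
abbrev Weighting {n k : ℕ} (N : Fin k → PlanarNetwork n) : Type :=
  (j : Fin k) → (N j).Edge → Trop

/-- An `α`-multipath in the concatenation of `N 0, …, N (k-1)`: for each `i` a collection of `α i`
paths from the sources of `N 0` to the sinks of `N i`, all these paths (for all `i`) being pairwise
non-intersecting, that is, without common vertex. (The paths of a multipath are listed in some
order, which plays no role.) -/
structure Multipath {n k : ℕ} (N : Fin k → PlanarNetwork n) (α : Fin k → ℕ) where
  start : (i : Fin k) → Fin (α i) → Fin n
  finish : (i : Fin k) → Fin (α i) → Fin n
  route : (i : Fin k) → Fin (α i) → List (CompEdge N)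
  isPath : ∀ i a, IsPath N (.inl (0, start i a)) (route i a) (.inl (i.succ, finish i a))
  nonintersecting : ∀ i a i' a', (⟨i, a⟩ : (i : Fin k) × Fin (α i)) ≠ ⟨i', a'⟩ →
    List.Disjoint (.inl (0, start i a) :: (route i a).map (compTgt N))
      (.inl (0, start i' a') :: (route i' a').map (compTgt N))

/-- The set of (labels of) sources of a multipath. -/
def Multipath.sources {n k : ℕ} {N : Fin k → PlanarNetwork n} {α : Fin k → ℕ}
    (p : Multipath N α) : Set (Fin n) := {l | ∃ i a, p.start i a = l}

/-- The set of (labels of) sinks of the `i`-th component of a multipath. -/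
def Multipath.sinks {n k : ℕ} {N : Fin k → PlanarNetwork n} {α : Fin k → ℕ}
    (p : Multipath N α) (i : Fin k) : Set (Fin n) := {l | ∃ a, p.finish i a = l}

/-- The weight of a multipath: the tropical product of the weights of its edges. -/
noncomputable def Multipath.weight {n k : ℕ} {N : Fin k → PlanarNetwork n} {α : Fin k → ℕ}
    (p : Multipath N α) (w : Weighting N) : Trop :=
  ∑ i, ∑ a, ((p.route i a).map fun e => w e.1 e.2).sum

/-- The integer points of the simplex `Δᵏ(n)`. -/
abbrev Simplex (k n : ℕ) : Type := {α : Fin k → ℕ // ∑ i, α i ≤ n}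

/-- The map `m`: its component `m_α` is the maximal weight of an `α`-multipath
(`-∞` if there are none). -/
noncomputable def mMap {n k : ℕ} (N : Fin k → PlanarNetwork n) (w : Weighting N) :
    Simplex k n → Trop :=
  fun α => sSup (Set.range fun p : Multipath N α.1 => p.weight w)

/-- The multi-Gelfand–Zeitlin condition for a weighting of a concatenation: for every `α` some
`α`-multipath of maximal weight starts at the `∑ α i` highest sources and has as sinks, for each
`i`, the `α i` lowest points of the `i`-th vertical. -/
def MultiGZ {n k : ℕ} (N : Fin k → PlanarNetwork n) (w : Weighting N) : Prop :=
  ∀ α : Simplex k n, ∃ p : Multipath N α.1,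
    p.sources = {l : Fin n | n ≤ (l : ℕ) + ∑ i, α.1 i} ∧
    (∀ i, p.sinks i = {l : Fin n | (l : ℕ) < α.1 i}) ∧
    ∀ q : Multipath N α.1, q.weight w ≤ p.weight w

/-- The multi-Gelfand–Zeitlin condition for the product of the networks number `f 0, f 1, …`. -/
def SubGZ {n k r : ℕ} (N : Fin k → PlanarNetwork n) (w : Weighting N) (f : Fin r → Fin k) : Prop :=
  MultiGZ (fun j => N (f j)) (fun j => w (f j))

/-- Each of three weighted networks, the product of the first two, the product of the last two and
the product of all three satisfy the multi-Gelfand–Zeitlin condition. -/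
structure AllMultiGZ {n : ℕ} (N : Fin 3 → PlanarNetwork n) (w : Weighting N) : Prop where
  gz1 : SubGZ N w ![0]
  gz2 : SubGZ N w ![1]
  gz3 : SubGZ N w ![2]
  gz12 : SubGZ N w ![0, 1]
  gz23 : SubGZ N w ![1, 2]
  gz123 : SubGZ N w ![0, 1, 2]

/-! ### The cone -/

/-- The barycentric coordinates `(n - i - j - k, i, j, k)` of an integer point of `Δ³(n)`. -/
def bary {n : ℕ} (α : Simplex 3 n) : Fin 4 → ℕ := Fin.cons (n - ∑ i, α.1 i) α.1

/-- The rhombus inequalities. In barycentric coordinates, the rhombus with the long diagonal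
`(0,0,0), (1,1,0)` and the short diagonal `(1,0,0), (0,1,0)` has, up to translation, the long
diagonal `2e₀, e₁ + e₂` and the short diagonal `e₀ + e₁, e₀ + e₂`, and the symmetric group permutes
the coordinates. -/
def RhombusIneq {n : ℕ} (x : Simplex 3 n → Trop) : Prop :=
  ∀ (u : Fin 4 → ℕ) (a b c : Fin 4), a ≠ b → a ≠ c → b ≠ c →
    ∀ long₁ long₂ short₁ short₂ : Simplex 3 n,
      bary long₁ = u + Pi.single a 1 + Pi.single a 1 →
      bary long₂ = u + Pi.single b 1 + Pi.single c 1 →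
      bary short₁ = u + Pi.single a 1 + Pi.single b 1 →
      bary short₂ = u + Pi.single a 1 + Pi.single c 1 →
      x long₁ + x long₂ ≤ x short₁ + x short₂

/-- The point `(i, j, k)` of the simplex. -/
def pt {n : ℕ} (i j k : ℕ) (h : i + j + k ≤ n) : Simplex 3 n :=
  ⟨![i, j, k], by simpa [Fin.sum_univ_three] using h⟩

/-- The octahedron recurrence, for all small tetrahedra in `Δ³(n)`. -/
def OctahedronRec {n : ℕ} (x : Simplex 3 n → Trop) : Prop :=
  ∀ (i j k : ℕ) (h : i + j + k + 2 ≤ n),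
    x (pt i (j + 1) k (by omega)) + x (pt (i + 1) j (k + 1) (by omega)) =
      max (x (pt (i + 1) j k (by omega)) + x (pt i (j + 1) (k + 1) (by omega)))
        (x (pt i j (k + 1) (by omega)) + x (pt (i + 1) (j + 1) k (by omega)))

/-- The octahedron recurrence cone, in the space of tropical functions on `Δ³(n)` normalized by
`x (0,0,0) = 0`. -/
def octCone (n : ℕ) : Set (Simplex 3 n → Trop) :=
  {x | x (pt 0 0 0 (Nat.zero_le _)) = 0 ∧ RhombusIneq x ∧ OctahedronRec x}

end TropHorn

/-! A multipath in a concatenation of `k` networks is read as a motion of `n` particles that start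
on all `n` lines. A particle may leave at any of the verticals `0, …, k - 1` or arrive at vertical
`k`; an unused source is a particle that leaves at vertical `0`. Thus the maximal weight for given
end points is a tropical maximal minor of the path matrix, with `n` rows and one column for each
point of each vertical.

With edge weights `exp (t w)` the ordinary minors satisfy the three-term Plücker relation
(`det_plucker`). A minor is a signed sum over disjoint families of paths, hence at most a constant
times `exp` of `t` times the tropical minor (`abs_pathMinor_le`). If the end points are the lowest
ones on each vertical, planarity forces the particles to finish in order (`LRun.rank_lt`), all terms
have one sign and nothing cancels (`texp_opt_le_pathMinor`). Comparing growth rates in `t` makes the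
relations tropical. Four columns on four different verticals give the octahedron recurrence
(`opt_octahedron`), for every system of nets. Two neighbouring columns on one vertical and one on
each of two others give the rhombus inequality, except that two of the minors have a gap
(`opt_rhombus`); the multi-Gelfand–Zeitlin condition bounds these by the minors of lowest points
(`stdOpt_insert_two_le`).

For surjectivity, the faces `k = 0` and `i = 0` of a real `x` are hives, and differences along a
hive serve as weights of the slanted edges, up to a gauge change by potentials on the lines.
Estimates for single nets (`Hive.yRun_le`, `yRun_Ico`) show that lowest end points have optimal
weight `x` on these two faces, and the octahedron recurrence propagates this to the whole simplex
(`OctHive.eq_of_face`).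

It remains to see that other end points are never better. Put weightless slanted edges around every
net: any run of the original system can then be pushed down to lowest end points without loss
(`NRun.pad`). The padded system satisfies the same estimates on the two faces, hence, by the same
recurrence, also has the values `x` (`OctHive.tripleOpt_padSys_eq`). This is the
multi-Gelfand–Zeitlin condition for the triple product (`OctHive.gzRuns`). It passes to blocks of
consecutive nets by letting no particle leave at the first vertical or reach the last one
(`GZRuns.tail`, `GZRuns.dropLast`). -/

namespace TropHorn

/-! ### Exponentials of tropical numbers -/

/-- `exp (t a)`, with `exp (-∞) = 0`. -/
noncomputable def texp (t : ℝ) (a : Trop) : ℝ := a.recBotCoe 0 fun r => Real.exp (t * r)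

@[simp] theorem texp_bot (t : ℝ) : texp t ⊥ = 0 := rfl

@[simp] theorem texp_coe (t r : ℝ) : texp t (r : Trop) = Real.exp (t * r) := rfl

@[simp] theorem texp_zero (t : ℝ) : texp t 0 = 1 := by
  have : texp t ((0 : ℝ) : Trop) = 1 := by rw [texp_coe, mul_zero, Real.exp_zero]
  exact this

theorem texp_nonneg (t : ℝ) (a : Trop) : 0 ≤ texp t a := by
  induction a using WithBot.recBotCoe with
  | bot => simp
  | coe r => simpa using (Real.exp_pos _).le

theorem texp_add (t : ℝ) (a b : Trop) : texp t (a + b) = texp t a * texp t b := by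
  induction a using WithBot.recBotCoe with
  | bot => simp
  | coe r =>
    induction b using WithBot.recBotCoe with
    | bot => simp
    | coe s => rw [← WithBot.coe_add, texp_coe, texp_coe, texp_coe, mul_add, Real.exp_add]

theorem texp_mono {t : ℝ} (ht : 0 ≤ t) {a b : Trop} (h : a ≤ b) : texp t a ≤ texp t b := by
  induction a using WithBot.recBotCoe with
  | bot => simpa using texp_nonneg t b
  | coe r =>
    induction b using WithBot.recBotCoe with
    | bot => simp at h
    | coe s =>
      have := WithBot.coe_le_coe.1 h
      simpa using mul_le_mul_of_nonneg_left this ht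

theorem texp_max_le (t : ℝ) (a b : Trop) : texp t (max a b) ≤ texp t a + texp t b := by
  rcases max_cases a b with ⟨h, _⟩ | ⟨h, _⟩ <;> rw [h] <;>
    linarith [texp_nonneg t a, texp_nonneg t b]

/-- An inequality between tropical numbers can be read off from exponential growth rates. -/
theorem le_of_texp_le {a b : Trop} (C : ℝ) (h : ∀ t : ℝ, 0 ≤ t → texp t a ≤ C * texp t b) :
    a ≤ b := by
  induction a using WithBot.recBotCoe with
  | bot => exact bot_le
  | coe r =>
    induction b using WithBot.recBotCoe with
    | bot =>
      have := h 0 le_rfl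
      simp at this
      linarith
    | coe s =>
      by_contra hlt
      have hlt : s < r := by simpa using hlt
      have key : ∀ t : ℝ, 0 ≤ t → Real.exp (t * (r - s)) ≤ C := by
        intro t ht
        have h1 := h t ht
        simp only [texp_coe] at h1
        rw [mul_sub, Real.exp_sub, div_le_iff₀ (Real.exp_pos _)]
        exact h1
      have hC : 1 ≤ C := by simpa using key 0 le_rfl
      -- At this `t` the bound reads `exp C ≤ C`, against `C + 1 ≤ exp C`.
      have h2 := key (C / (r - s)) (div_nonneg (by linarith) (by linarith))
      rw [div_mul_cancel₀ _ (by linarith)] at h2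
      linarith [Real.add_one_le_exp C]

/-! ### Elementary operations and their runs -/

/-- Positions of particles: the line `l`, or, for a particle that has left the system, the point
`(p, l)` at which it has done so. -/
abbrev Pos : Type := ℕ ⊕ (ℕ × ℕ)

/-- An elementary operation: a particle at `src` stays there or moves to `tgt`, provided that `tgt`
is free; a particle at `tgt` stays there. The three lists are the edges passed. -/
structure Op (E : Type) where
  src : Pos
  tgt : Pos
  ne : src ≠ tgt
  stay : List E
  move : List E
  rest : List E

variable {E : Type}

/-- The weight of a list of edges. -/
noncomputable def wt (w : E → Trop) (l : List E) : Trop := (l.map w).sum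

@[simp] theorem wt_nil (w : E → Trop) : wt w [] = 0 := rfl

theorem wt_append (w : E → Trop) (l l' : List E) : wt w (l ++ l') = wt w l + wt w l' := by
  simp [wt]

/-- The weight of an operation if no particle moves. -/
noncomputable def Op.stayWt (w : E → Trop) (o : Op E) (S : Finset Pos) : Trop :=
  (if o.src ∈ S then wt w o.stay else 0) + (if o.tgt ∈ S then wt w o.rest else 0)

/-- `SRun w ops S T W`: performing the operations `ops`, with particles initially at `S`, one can
arrive at `T` with weight `W`. -/
inductive SRun (w : E → Trop) : List (Op E) → Finset Pos → Finset Pos → Trop → Prop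
  | nil (S : Finset Pos) : SRun w [] S S 0
  | stay {o : Op E} {ops : List (Op E)} {S T : Finset Pos} {W : Trop} (h : SRun w ops S T W) :
      SRun w (o :: ops) S T (o.stayWt w S + W)
  | move {o : Op E} {ops : List (Op E)} {S T : Finset Pos} {W : Trop} (h₁ : o.src ∈ S)
      (h₂ : o.tgt ∉ S) (h : SRun w ops (insert o.tgt (S.erase o.src)) T W) :
      SRun w (o :: ops) S T (wt w o.move + W)

theorem SRun.append {w : E → Trop} {l l' : List (Op E)} {S M T : Finset Pos} {W W' : Trop}
    (h : SRun w l S M W) (h' : SRun w l' M T W') : SRun w (l ++ l') S T (W + W') := by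
  induction h with
  | nil S => simpa using h'
  | stay _ ih => rw [add_assoc]; exact .stay (ih h')
  | move h₁ h₂ _ ih => rw [add_assoc]; exact .move h₁ h₂ (ih h')

theorem SRun.split {w : E → Trop} {l l' : List (Op E)} {S T : Finset Pos} {W : Trop}
    (h : SRun w (l ++ l') S T W) :
    ∃ M W₁ W₂, SRun w l S M W₁ ∧ SRun w l' M T W₂ ∧ W = W₁ + W₂ := by
  induction l generalizing S W with
  | nil => exact ⟨S, 0, W, .nil S, h, by simp⟩
  | cons o l ih =>
    rw [List.cons_append] at h
    cases h with
    | stay h =>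
      obtain ⟨M, W₁, W₂, h₁, h₂, rfl⟩ := ih h
      exact ⟨M, _, W₂, .stay h₁, h₂, by rw [add_assoc]⟩
    | move ha hb h =>
      obtain ⟨M, W₁, W₂, h₁, h₂, rfl⟩ := ih h
      exact ⟨M, _, W₂, .move ha hb h₁, h₂, by rw [add_assoc]⟩

/-- The maximal weight of a run. -/
noncomputable def opt (w : E → Trop) : List (Op E) → Finset Pos → Finset Pos → Trop
  | [], S, T => if S = T then 0 else ⊥
  | o :: ops, S, T =>
    max (o.stayWt w S + opt w ops S T)
      (if o.src ∈ S ∧ o.tgt ∉ S then wt w o.move + opt w ops (insert o.tgt (S.erase o.src)) T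
        else ⊥)

theorem SRun.le_opt {w : E → Trop} {l : List (Op E)} {S T : Finset Pos} {W : Trop}
    (h : SRun w l S T W) : W ≤ opt w l S T := by
  induction h with
  | nil S => simp [opt]
  | stay _ ih => exact le_max_of_le_left (add_le_add_right ih _)
  | move h₁ h₂ _ ih =>
    rw [opt, if_pos ⟨h₁, h₂⟩]
    exact le_max_of_le_right (add_le_add_right ih _)

/-- The value `⊥` stands both for the absence of runs and for runs through an edge of weight `⊥`, so
a run can be recovered only from another value. -/
theorem exists_sRun_opt {w : E → Trop} {l : List (Op E)} {S T : Finset Pos}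
    (h : opt w l S T ≠ ⊥) : SRun w l S T (opt w l S T) := by
  induction l generalizing S with
  | nil =>
    rw [opt] at h ⊢
    split_ifs at h ⊢ with hST
    · subst hST; exact .nil S
    · exact absurd rfl h
  | cons o l ih =>
    rw [opt] at h ⊢
    rcases max_cases (o.stayWt w S + opt w l S T)
      (if o.src ∈ S ∧ o.tgt ∉ S then wt w o.move + opt w l (insert o.tgt (S.erase o.src)) T
        else ⊥) with ⟨hm, _⟩ | ⟨hm, _⟩
    · rw [hm] at h ⊢
      exact .stay (ih fun h' => h (by simp [h']))
    · rw [hm] at h ⊢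
      split_ifs at h ⊢ with hc
      · exact .move hc.1 hc.2 (ih fun h' => h (by simp [h']))
      · exact absurd rfl h

/-! ### Labelled runs -/

variable {ι : Type}

/-- The edges passed by a particle at `a` if no particle moves. -/
def Op.keep (o : Op E) (a : Pos) : List E :=
  if a = o.src then o.stay else if a = o.tgt then o.rest else []

/-- The edges passed by a particle at `a` if the particle at `src` moves. -/
def Op.go (o : Op E) (a : Pos) : List E := if a = o.src then o.move else []

/-- The new position of a particle at `a` if the particle at `src` moves. -/
def Op.shift (o : Op E) (a : Pos) : Pos := if a = o.src then o.tgt else a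

/-- `LRun ops ρ ρ' R`: performing the operations `ops`, the labelled particles can move from the
positions `ρ` to the positions `ρ'` along the routes `R`. -/
inductive LRun : List (Op E) → (ι → Pos) → (ι → Pos) → (ι → List E) → Prop
  | nil (ρ : ι → Pos) : LRun [] ρ ρ fun _ => []
  | stay {o : Op E} {ops : List (Op E)} {ρ ρ' : ι → Pos} {R : ι → List E}
      (h : LRun ops ρ ρ' R) : LRun (o :: ops) ρ ρ' fun x => o.keep (ρ x) ++ R x
  | move {o : Op E} {ops : List (Op E)} {ρ ρ' : ι → Pos} {R : ι → List E}
      (h₁ : ∃ x, ρ x = o.src) (h₂ : ∀ x, ρ x ≠ o.tgt) (h : LRun ops (o.shift ∘ ρ) ρ' R) :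
      LRun (o :: ops) ρ ρ' fun x => o.go (ρ x) ++ R x

theorem LRun.split {l l' : List (Op E)} {ρ ρ'' : ι → Pos} {R : ι → List E}
    (h : LRun (l ++ l') ρ ρ'' R) : ∃ ρ' R₁ R₂, LRun l ρ ρ' R₁ ∧ LRun l' ρ' ρ'' R₂ := by
  induction l generalizing ρ R with
  | nil => exact ⟨ρ, _, R, .nil ρ, h⟩
  | cons o l ih =>
    rw [List.cons_append] at h
    cases h with
    | stay h =>
      obtain ⟨M, W₁, W₂, h₁, h₂⟩ := ih h
      exact ⟨M, _, W₂, .stay h₁, h₂⟩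
    | move ha hb h =>
      obtain ⟨M, W₁, W₂, h₁, h₂⟩ := ih h
      exact ⟨M, _, W₂, .move ha hb h₁, h₂⟩

theorem shift_injective (o : Op E) {ρ : ι → Pos} (hρ : Function.Injective ρ)
    (h : ∀ x, ρ x ≠ o.tgt) : Function.Injective (o.shift ∘ ρ) := by
  intro x y hxy
  simp only [Function.comp, Op.shift] at hxy
  split_ifs at hxy with h1 h2 h2
  · exact hρ (h1.trans h2.symm)
  · exact absurd hxy.symm (h y)
  · exact absurd hxy (h x)
  · exact hρ hxy

theorem LRun.injective {l : List (Op E)} {ρ ρ' : ι → Pos} {R : ι → List E} (h : LRun l ρ ρ' R)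
    (hρ : Function.Injective ρ) : Function.Injective ρ' := by
  induction h with
  | nil => exact hρ
  | stay _ ih => exact ih hρ
  | move _ h₂ _ ih => exact ih (shift_injective _ hρ h₂)

variable [Fintype ι]

theorem image_shift (o : Op E) {ρ : ι → Pos} (h₁ : ∃ x, ρ x = o.src) :
    Finset.univ.image (o.shift ∘ ρ) =
      insert o.tgt ((Finset.univ.image ρ).erase o.src) := by
  ext a
  simp only [Finset.mem_image, Finset.mem_univ, true_and, Finset.mem_insert, Finset.mem_erase,
    Function.comp, Op.shift]
  constructor
  · rintro ⟨x, rfl⟩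
    split_ifs with h
    · simp
    · exact Or.inr ⟨h, x, rfl⟩
  · rintro (rfl | ⟨h, x, rfl⟩)
    · obtain ⟨x, hx⟩ := h₁
      exact ⟨x, by simp [hx]⟩
    · exact ⟨x, by simp [h]⟩

theorem sum_ite_eq_pos {ρ : ι → Pos} (hρ : Function.Injective ρ) (a : Pos) (c : Trop) :
    ∑ x, (if ρ x = a then c else 0) = if a ∈ Finset.univ.image ρ then c else 0 := by
  classical
  by_cases h : ∃ x, ρ x = a
  · obtain ⟨x, rfl⟩ := h
    simp [hρ.eq_iff]
  · have h' : ∀ x, ρ x ≠ a := fun x hx => h ⟨x, hx⟩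
    simp [h']

theorem sum_wt_keep (w : E → Trop) (o : Op E) {ρ : ι → Pos} (hρ : Function.Injective ρ) :
    ∑ x, wt w (o.keep (ρ x)) = o.stayWt w (Finset.univ.image ρ) := by
  rw [Op.stayWt, ← sum_ite_eq_pos hρ, ← sum_ite_eq_pos hρ, ← Finset.sum_add_distrib]
  refine Finset.sum_congr rfl fun x _ => ?_
  have := o.ne
  rw [Op.keep]
  split_ifs with h1 h2 h2 <;> simp_all

theorem sum_wt_go (w : E → Trop) (o : Op E) {ρ : ι → Pos} (hρ : Function.Injective ρ)
    (h : ∃ x, ρ x = o.src) : ∑ x, wt w (o.go (ρ x)) = wt w o.move := by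
  have h' : o.src ∈ Finset.univ.image ρ := by simpa using h
  have := sum_ite_eq_pos hρ o.src (wt w o.move)
  rw [if_pos h'] at this
  rw [← this]
  refine Finset.sum_congr rfl fun x _ => ?_
  rw [Op.go]
  split_ifs <;> simp

/-- Labels are forgotten. Each of `src` and `tgt` carries at most one particle, so the weights of
the particles add up to the weight of the unlabelled step. -/
theorem LRun.sRun (w : E → Trop) {l : List (Op E)} {ρ ρ' : ι → Pos} {R : ι → List E}
    (h : LRun l ρ ρ' R) (hρ : Function.Injective ρ) :
    SRun w l (Finset.univ.image ρ) (Finset.univ.image ρ') (∑ x, wt w (R x)) := by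
  induction h with
  | nil ρ => simpa using SRun.nil _
  | stay _ ih =>
    simp only [wt_append, Finset.sum_add_distrib]
    rw [sum_wt_keep w _ hρ]
    exact .stay (ih hρ)
  | move h₁ h₂ _ ih =>
    simp only [wt_append, Finset.sum_add_distrib]
    rw [sum_wt_go w _ hρ h₁]
    refine .move (by simpa using h₁) (by simpa using h₂) ?_
    rw [← image_shift _ h₁]
    exact ih (shift_injective _ hρ h₂)

/-- The particle that moves is determined by its position, so a run of occupied sets lifts to any
labelling of the initial set. -/
theorem SRun.lRun {w : E → Trop} {l : List (Op E)} {S T : Finset Pos} {W : Trop}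
    (h : SRun w l S T W) {ρ : ι → Pos} (hρ : Function.Injective ρ)
    (hS : Finset.univ.image ρ = S) :
    ∃ ρ' R, LRun l ρ ρ' R ∧ Finset.univ.image ρ' = T ∧ W = ∑ x, wt w (R x) := by
  induction h generalizing ρ with
  | nil S => exact ⟨ρ, _, .nil ρ, hS, by simp⟩
  | stay _ ih =>
    obtain ⟨ρ', R, h, hT, rfl⟩ := ih hρ hS
    refine ⟨ρ', _, .stay h, hT, ?_⟩
    simp only [wt_append, Finset.sum_add_distrib]
    rw [sum_wt_keep w _ hρ, hS]
  | @move o _ _ _ _ ha hb _ ih =>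
    subst hS
    have h₁ : ∃ x, ρ x = o.src := by simpa using ha
    have h₂ : ∀ x, ρ x ≠ o.tgt := by simpa using hb
    obtain ⟨ρ', R, h, hT, rfl⟩ := ih (shift_injective _ hρ h₂) (image_shift _ h₁)
    refine ⟨ρ', _, .move h₁ h₂ h, hT, ?_⟩
    simp only [wt_append, Finset.sum_add_distrib]
    rw [sum_wt_go w _ hρ h₁]

end TropHorn

/-! ### Minors of path matrices as signed sums over runs, and the Plücker relation -/

namespace TropHorn

variable {E : Type}

/-! ### Path matrices and their minors -/

/-- The path matrix of a list of operations for the weights `exp (t w)`. -/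
noncomputable def pathMat (t : ℝ) (w : E → Trop) : List (Op E) → Pos → Pos → ℝ
  | [], a, c => if a = c then 1 else 0
  | o :: ops, a, c =>
    if a = o.src then texp t (wt w o.stay) * pathMat t w ops o.src c +
        texp t (wt w o.move) * pathMat t w ops o.tgt c
    else if a = o.tgt then texp t (wt w o.rest) * pathMat t w ops o.tgt c
    else pathMat t w ops a c

variable {ι : Type} [Fintype ι] [DecidableEq ι]

/-- A minor of the path matrix. -/
noncomputable def pathMinor (t : ℝ) (w : E → Trop) (ops : List (Op E)) (ρ τ : ι → Pos) : ℝ :=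
  (Matrix.of fun x y => pathMat t w ops (ρ x) (τ y)).det

theorem prod_ite_eq_pos {ρ : ι → Pos} (hρ : Function.Injective ρ) (a : Pos) (c : ℝ) :
    ∏ x, (if ρ x = a then c else 1) = if a ∈ Finset.univ.image ρ then c else 1 := by
  by_cases h : ∃ x, ρ x = a
  · obtain ⟨x, rfl⟩ := h
    simp [hρ.eq_iff]
  · have h' : ∀ x, ρ x ≠ a := fun x hx => h ⟨x, hx⟩
    simp [h']

theorem pathMinor_eq_zero (t : ℝ) (w : E → Trop) (ops : List (Op E)) {ρ : ι → Pos} (τ : ι → Pos)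
    {x y : ι} (hxy : x ≠ y) (h : ρ x = ρ y) : pathMinor t w ops ρ τ = 0 :=
  Matrix.det_zero_of_row_eq hxy (by funext z; simp [h])

/-- Expansion of a minor along the first operation. -/
theorem pathMinor_cons (t : ℝ) (w : E → Trop) (o : Op E) (ops : List (Op E)) {ρ : ι → Pos}
    (τ : ι → Pos) (hρ : Function.Injective ρ) :
    pathMinor t w (o :: ops) ρ τ =
      texp t (o.stayWt w (Finset.univ.image ρ)) * pathMinor t w ops ρ τ +
        if o.src ∈ Finset.univ.image ρ ∧ o.tgt ∉ Finset.univ.image ρ then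
          texp t (wt w o.move) * pathMinor t w ops (o.shift ∘ ρ) τ else 0 := by
  set c : ι → ℝ := fun x => if ρ x = o.tgt then texp t (wt w o.rest) else 1 with hc
  have hprod : ∏ x, c x = texp t (if o.tgt ∈ Finset.univ.image ρ then wt w o.rest else 0) := by
    rw [prod_ite_eq_pos hρ]
    split_ifs <;> simp
  rw [Op.stayWt, texp_add, ← hprod]
  by_cases hs : ∃ x, ρ x = o.src
  · obtain ⟨x₀, hx₀⟩ := hs
    have hmem : o.src ∈ Finset.univ.image ρ := by simpa using ⟨x₀, hx₀⟩
    have hne : ∀ x, x ≠ x₀ → ρ x ≠ o.src := fun x hx h => hx (hρ (h.trans hx₀.symm))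
    set A : Matrix ι ι ℝ := Matrix.of fun x y => c x * pathMat t w ops (ρ x) (τ y) with hA
    -- Only the row of the particle at `src` splits in two; the other rows are those of the shorter
    -- system, multiplied by `c`.
    have hrow : (Matrix.of fun x y => pathMat t w (o :: ops) (ρ x) (τ y)) =
        A.updateRow x₀ ((texp t (wt w o.stay) • fun y => pathMat t w ops o.src (τ y)) +
          texp t (wt w o.move) • fun y => pathMat t w ops o.tgt (τ y)) := by
      ext x y
      by_cases hx : x = x₀
      · subst hx
        simp [pathMat, hx₀]
      · rw [Matrix.updateRow_ne hx]
        simp only [hA, hc, Matrix.of_apply, pathMat, if_neg (hne x hx)]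
        split_ifs with h
        · rw [h]
        · rw [one_mul]
    have hstay : (A.updateRow x₀ fun y => pathMat t w ops o.src (τ y)).det =
        (∏ x, c x) * pathMinor t w ops ρ τ := by
      rw [pathMinor, ← Matrix.det_mul_column]
      congr 1
      ext x y
      by_cases hx : x = x₀
      · subst hx
        have := o.ne
        simp [hc, hx₀, this]
      · rw [Matrix.updateRow_ne hx]
        simp [hA]
    have hmove : (A.updateRow x₀ fun y => pathMat t w ops o.tgt (τ y)).det =
        if o.tgt ∈ Finset.univ.image ρ then 0 else pathMinor t w ops (o.shift ∘ ρ) τ := by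
      have h1 : (A.updateRow x₀ fun y => pathMat t w ops o.tgt (τ y)).det =
          (∏ x, c x) * pathMinor t w ops (o.shift ∘ ρ) τ := by
        rw [pathMinor, ← Matrix.det_mul_column]
        congr 1
        ext x y
        by_cases hx : x = x₀
        · subst hx
          have := o.ne
          simp [hc, hx₀, this, Op.shift]
        · rw [Matrix.updateRow_ne hx]
          simp [hA, Op.shift, hne x hx]
      rw [h1]
      split_ifs with h
      -- If `tgt` is occupied, the moved row repeats another row. This is where colliding families
      -- of paths cancel.
      · obtain ⟨x₁, -, hx₁⟩ := Finset.mem_image.1 h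
        have h01 : x₁ ≠ x₀ := by
          rintro rfl
          exact o.ne (hx₀.symm.trans hx₁)
        rw [pathMinor_eq_zero t w ops τ h01, mul_zero]
        simp [Op.shift, hx₀, hx₁]
      · rw [hprod, if_neg h, texp_zero, one_mul]
    rw [pathMinor, hrow, Matrix.det_updateRow_add, Matrix.det_updateRow_smul,
      Matrix.det_updateRow_smul, hstay, hmove, if_pos hmem]
    by_cases h : o.tgt ∈ Finset.univ.image ρ
    · rw [if_pos h, if_neg fun h' => h'.2 h]
      ring
    · rw [if_neg h, if_pos ⟨hmem, h⟩]
      ring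
  · have hmem : o.src ∉ Finset.univ.image ρ := by simpa using hs
    rw [if_neg hmem, if_neg fun h => hmem h.1, texp_zero, one_mul, add_zero, pathMinor, pathMinor,
      ← Matrix.det_mul_column]
    congr 1
    ext x y
    have : ρ x ≠ o.src := fun h => hs ⟨x, h⟩
    simp only [Matrix.of_apply, pathMat, if_neg this, hc]
    split_ifs with h
    · rw [h]
    · rw [one_mul]

theorem pathMinor_nil_eq_zero (t : ℝ) (w : E → Trop) {ρ τ : ι → Pos}
    (hρ : Function.Injective ρ) (hτ : Function.Injective τ)
    (h : Finset.univ.image ρ ≠ Finset.univ.image τ) : pathMinor t w [] ρ τ = 0 := by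
  have : ∃ x, ρ x ∉ Finset.univ.image τ := by
    by_contra! hcon
    refine h (Finset.eq_of_subset_of_card_le ?_ ?_)
    · intro a ha
      obtain ⟨x, -, rfl⟩ := Finset.mem_image.1 ha
      exact hcon x
    · rw [Finset.card_image_of_injective _ hρ, Finset.card_image_of_injective _ hτ]
  obtain ⟨x, hx⟩ := this
  refine Matrix.det_eq_zero_of_row_eq_zero x fun y => ?_
  simp only [Matrix.of_apply, pathMat]
  rw [if_neg]
  rintro h
  exact hx (by simp [h])

/-- Minors are bounded by the exponential of the tropical minor. -/
theorem abs_pathMinor_le (w : E → Trop) (ops : List (Op E)) (τ : ι → Pos)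
    (hτ : Function.Injective τ) :
    ∃ C : ℝ, 0 ≤ C ∧ ∀ t : ℝ, 0 ≤ t → ∀ ρ : ι → Pos, Function.Injective ρ →
      |pathMinor t w ops ρ τ| ≤
        C * texp t (opt w ops (Finset.univ.image ρ) (Finset.univ.image τ)) := by
  induction ops with
  | nil =>
    -- The entries are `0` or `1`, so the determinant is at most the number of permutations. Each
    -- operation then doubles the constant, uniformly in `t` and `ρ`.
    refine ⟨(Fintype.card ι).factorial, by positivity, fun t ht ρ hρ => ?_⟩
    rw [opt]
    split_ifs with h
    · have := Matrix.det_le (A := Matrix.of fun x y => pathMat t w [] (ρ x) (τ y))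
        (abv := AbsoluteValue.abs) (x := (1 : ℝ)) (by
          intro i j
          simp only [Matrix.of_apply, pathMat]
          split_ifs <;> simp)
      simpa [pathMinor] using this
    · simp [pathMinor_nil_eq_zero t w hρ hτ h]
  | cons o ops ih =>
    obtain ⟨C, hC, ih⟩ := ih
    refine ⟨C + C, by positivity, fun t ht ρ hρ => ?_⟩
    rw [pathMinor_cons t w o ops τ hρ, add_mul]
    refine (abs_add_le _ _).trans (add_le_add ?_ ?_)
    · rw [abs_mul, abs_of_nonneg (texp_nonneg _ _)]
      calc _ ≤ texp t (o.stayWt w (Finset.univ.image ρ)) *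
            (C * texp t (opt w ops (Finset.univ.image ρ) (Finset.univ.image τ))) :=
            mul_le_mul_of_nonneg_left (ih t ht ρ hρ) (texp_nonneg _ _)
        _ = C * texp t (o.stayWt w (Finset.univ.image ρ) +
            opt w ops (Finset.univ.image ρ) (Finset.univ.image τ)) := by rw [texp_add]; ring
        _ ≤ _ := mul_le_mul_of_nonneg_left (texp_mono ht (le_max_left _ _)) hC
    · split_ifs with h
      · have h₁ : ∃ x, ρ x = o.src := by simpa using h.1
        have h₂ : ∀ x, ρ x ≠ o.tgt := by simpa using h.2
        rw [abs_mul, abs_of_nonneg (texp_nonneg _ _)]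
        have := ih t ht _ (shift_injective o hρ h₂)
        rw [image_shift o h₁] at this
        calc _ ≤ texp t (wt w o.move) * (C * texp t (opt w ops _ (Finset.univ.image τ))) :=
            mul_le_mul_of_nonneg_left this (texp_nonneg _ _)
          _ = C * texp t (wt w o.move + opt w ops _ (Finset.univ.image τ)) := by
            rw [texp_add]; ring
          _ ≤ _ := by
            refine mul_le_mul_of_nonneg_left (texp_mono ht ?_) hC
            rw [opt, if_pos h]
            exact le_max_right _ _
      · rw [abs_zero]
        exact mul_nonneg hC (texp_nonneg _ _)

/-! ### Signs -/

/-- Order of the final positions: by vertical (particles on the lines being at the last vertical,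
number `k`) and then by line. -/
def rank (k : ℕ) : Pos → ℕ ×ₗ ℕ
  | .inl l => toLex (k, l)
  | .inr q => toLex q

/-- `1` if `a` precedes `b`, `-1` if `b` precedes `a`. -/
def cmpSign (k : ℕ) (a b : Pos) : ℤ :=
  if rank k a < rank k b then 1 else if rank k b < rank k a then -1 else 0

theorem cmpSign_neg (k : ℕ) (a b : Pos) : cmpSign k a b = -cmpSign k b a := by
  rw [cmpSign, cmpSign]
  rcases lt_trichotomy (rank k a) (rank k b) with h | h | h
  · simp [h, h.not_gt]
  · simp [h]
  · simp [h, h.not_gt]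

theorem cmpSign_of_lt {k : ℕ} {a b : Pos} (h : rank k a < rank k b) : cmpSign k a b = 1 := by
  simp [cmpSign, h]

/-- The sign of an enumeration of positions. -/
def enumSign (k : ℕ) {n : ℕ} (τ : Fin n → Pos) : ℤ :=
  ∏ j, ∏ i ∈ Finset.Iio j, cmpSign k (τ i) (τ j)

theorem enumSign_eq_one {k n : ℕ} {τ : Fin n → Pos} (h : StrictMono (rank k ∘ τ)) :
    enumSign k τ = 1 := by
  refine Finset.prod_eq_one fun j _ => Finset.prod_eq_one fun i hi => ?_
  exact cmpSign_of_lt (h (Finset.mem_Iio.1 hi))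

theorem enumSign_comp_perm {k n : ℕ} (τ : Fin n → Pos) (σ : Equiv.Perm (Fin n)) :
    enumSign k (τ ∘ σ) = Equiv.Perm.sign σ * enumSign k τ :=
  σ.prod_Iio_comp_eq_sign_mul_prod (f := fun i j => cmpSign k (τ i) (τ j))
    fun _ _ => cmpSign_neg k _ _

theorem enumSign_cons (k : ℕ) {n : ℕ} (a : Pos) (τ : Fin n → Pos) :
    enumSign k (Fin.cons a τ : Fin (n + 1) → Pos) = (∏ j, cmpSign k a (τ j)) * enumSign k τ := by
  have h : ∀ {m : ℕ} (τ : Fin m → Pos), enumSign k τ =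
      ∏ i, ∏ j ∈ Finset.Ioi i, cmpSign k (τ i) (τ j) :=
    fun τ => Finset.prod_comm' (by simp)
  rw [h, h, Fin.prod_univ_succ, Fin.prod_Ioi_zero]
  simp [Fin.prod_Ioi_succ]

/-- The minor of a trivial system is the sign of the enumeration of the columns if the rows are
enumerated in order. -/
theorem enumSign_mul_pathMinor_nil {k n : ℕ} (t : ℝ) (w : E → Trop) {ρ τ : Fin n → Pos}
    (hρ : StrictMono (rank k ∘ ρ)) (hτ : Function.Injective τ)
    (h : Finset.univ.image ρ = Finset.univ.image τ) :
    (enumSign k τ : ℝ) * pathMinor t w [] ρ τ = 1 := by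
  have hρi : Function.Injective ρ := Function.Injective.of_comp hρ.injective
  have hex : ∀ x, ∃ y, τ y = ρ x := by
    intro x
    have : ρ x ∈ Finset.univ.image τ := h ▸ Finset.mem_image_of_mem ρ (Finset.mem_univ x)
    simpa using this
  choose f hf using hex
  have hfi : Function.Injective f := fun x y hxy => hρi (by rw [← hf x, ← hf y, hxy])
  set σ : Equiv.Perm (Fin n) := Equiv.ofBijective f (Finite.injective_iff_bijective.1 hfi)
  have hσ : ρ = τ ∘ σ := funext fun x => (hf x).symm
  have h1 : enumSign k τ = Equiv.Perm.sign σ := by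
    have h2 := enumSign_comp_perm (k := k) τ σ
    rw [← hσ, enumSign_eq_one hρ] at h2
    have h3 : ((Equiv.Perm.sign σ : ℤˣ) : ℤ) * (Equiv.Perm.sign σ : ℤˣ) = 1 := by
      rw [← Units.val_mul, Int.units_mul_self, Units.val_one]
    calc enumSign k τ = ((Equiv.Perm.sign σ : ℤ) * (Equiv.Perm.sign σ : ℤ)) * enumSign k τ := by
          rw [h3, one_mul]
      _ = Equiv.Perm.sign σ := by rw [mul_assoc, ← h2, mul_one]
  have h4 : (Matrix.of fun x y => pathMat t w [] (ρ x) (τ y)) =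
      (1 : Matrix (Fin n) (Fin n) ℝ).submatrix σ id := by
    ext x y
    simp [pathMat, hσ, hτ.eq_iff, Matrix.one_apply]
  rw [pathMinor, h4, h1, Matrix.det_permute, Matrix.det_one, mul_one]
  have h3 : ((Equiv.Perm.sign σ : ℤˣ) : ℤ) * (Equiv.Perm.sign σ : ℤˣ) = 1 := by
    rw [← Units.val_mul, Int.units_mul_self, Units.val_one]
  exact_mod_cast h3

/-- If all labelled runs to the given set of final positions end there in order, the minor is, up
to the sign of the enumeration of the columns, a sum over runs. -/
theorem texp_opt_le_pathMinor {k n : ℕ} (t : ℝ) (w : E → Trop) (ops : List (Op E))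
    {ρ τ : Fin n → Pos} (hρ : Function.Injective ρ) (hτ : Function.Injective τ)
    (h : ∀ ρ' R, LRun ops ρ ρ' R → Finset.univ.image ρ' = Finset.univ.image τ →
      StrictMono (rank k ∘ ρ')) :
    texp t (opt w ops (Finset.univ.image ρ) (Finset.univ.image τ)) ≤
      (enumSign k τ : ℝ) * pathMinor t w ops ρ τ := by
  induction ops generalizing ρ with
  | nil =>
    rw [opt]
    split_ifs with hi
    -- The order hypothesis enters here: every surviving term of the expansion ends in increasing
    -- order and has the sign `enumSign k τ`.
    · rw [enumSign_mul_pathMinor_nil t w (h ρ _ (.nil ρ) hi) hτ hi, texp_zero]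
    · simp [pathMinor_nil_eq_zero t w hρ hτ hi]
  | cons o ops ih =>
    rw [pathMinor_cons t w o ops τ hρ, opt]
    refine (texp_max_le _ _ _).trans ?_
    rw [mul_add]
    refine add_le_add ?_ ?_
    · rw [texp_add, mul_left_comm]
      exact mul_le_mul_of_nonneg_left (ih hρ fun ρ' R hr => h ρ' _ (.stay hr)) (texp_nonneg _ _)
    · split_ifs with hc
      · have h₁ : ∃ x, ρ x = o.src := by simpa using hc.1
        have h₂ : ∀ x, ρ x ≠ o.tgt := by simpa using hc.2
        rw [texp_add, mul_left_comm, ← image_shift o h₁]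
        exact mul_le_mul_of_nonneg_left
          (ih (shift_injective o hρ h₂) fun ρ' R hr => h ρ' _ (.move h₁ h₂ hr)) (texp_nonneg _ _)
      · simp

/-! ### The three-term Plücker relation -/

/-- Cramer's rule writes `P c d • b` as a combination of `c`, `d` and the rows of `B`, with
coefficients `P b d`, `P c b` and further minors. The linear form `P a` kills the rows of `B`, and
what is left is the relation. -/
theorem det_plucker {m : ℕ} (a b c d : Fin (m + 2) → ℝ) (B : Fin m → Fin (m + 2) → ℝ) :
    let P : (Fin (m + 2) → ℝ) → (Fin (m + 2) → ℝ) → ℝ := fun x y =>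
      (Matrix.of (Fin.cons x (Fin.cons y B : Fin (m + 1) → _) : Fin (m + 2) → _)).det
    P a c * P b d = P a b * P c d + P a d * P b c := by
  intro P
  set D := Matrix.detRowAlternating (R := ℝ) (n := Fin (m + 2))
  have h10 : (1 : Fin (m + 2)) ≠ 0 := by simp
  have hcons : ∀ x y, (Function.update (Fin.cons x (Fin.cons 0 B : Fin (m + 1) → _) :
      Fin (m + 2) → Fin (m + 2) → ℝ) 1 y) = Fin.cons x (Fin.cons y B : Fin (m + 1) → _) := by
    intro x y
    funext i
    refine Fin.cases ?_ (fun i => Fin.cases ?_ (fun i => ?_) i) i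
    · rw [Function.update_of_ne h10.symm]; simp
    · rw [Fin.succ_zero_eq_one, Function.update_self, ← Fin.succ_zero_eq_one]; simp
    · rw [Function.update_of_ne (by simp [Fin.ext_iff])]; simp
  have hcons0 : ∀ x y z, (Function.update (Fin.cons x (Fin.cons y B : Fin (m + 1) → _) :
      Fin (m + 2) → Fin (m + 2) → ℝ) 0 z) = Fin.cons z (Fin.cons y B : Fin (m + 1) → _) :=
    fun x y z => Fin.update_cons_zero _ _ _
  have hcons1 : ∀ x y z, (Function.update (Fin.cons x (Fin.cons y B : Fin (m + 1) → _) :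
      Fin (m + 2) → Fin (m + 2) → ℝ) 1 z) = Fin.cons x (Fin.cons z B : Fin (m + 1) → _) := by
    intro x y z
    rw [← hcons x y, Function.update_idem, hcons]
  have hswap : ∀ x y, P x y = -P y x := by
    intro x y
    have := D.map_swap (v := Fin.cons y (Fin.cons x B : Fin (m + 1) → _)) h10
    have hv : (Fin.cons y (Fin.cons x B : Fin (m + 1) → _) : Fin (m + 2) → Fin (m + 2) → ℝ) ∘
        Equiv.swap (1 : Fin (m + 2)) 0 = Fin.cons x (Fin.cons y B : Fin (m + 1) → _) := by
      funext i
      refine Fin.cases ?_ (fun i => Fin.cases ?_ (fun i => ?_) i) i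
      · rw [Function.comp, Equiv.swap_apply_right, ← Fin.succ_zero_eq_one]; simp
      · rw [Function.comp, Fin.succ_zero_eq_one, Equiv.swap_apply_left, ← Fin.succ_zero_eq_one]
        simp
      · rw [Function.comp, Equiv.swap_apply_of_ne_of_ne (by simp [Fin.ext_iff])
          (by simp [Fin.ext_iff])]
        simp
    rw [hv] at this
    exact this
  set φ := D.toMultilinearMap.toLinearMap (Fin.cons a (Fin.cons 0 B : Fin (m + 1) → _)) 1
  have hφ : ∀ y, φ y = P a y := by
    intro y
    change D _ = D _
    rw [hcons]
    rfl
  set A : Matrix (Fin (m + 2)) (Fin (m + 2)) ℝ :=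
    Matrix.of (Fin.cons c (Fin.cons d B : Fin (m + 1) → _) : Fin (m + 2) → _) with hA
  have hcr : A.det • b = ∑ i, (A.updateRow i b).det • A i := by
    funext j
    have := congrFun (Matrix.mulVec_cramer A.transpose b) j
    simp only [Matrix.mulVec, dotProduct, Matrix.transpose_apply, Pi.smul_apply, smul_eq_mul,
      Matrix.det_transpose, Matrix.cramer_transpose_apply] at this
    simp only [Pi.smul_apply, Finset.sum_apply, smul_eq_mul]
    rw [← this]
    exact Finset.sum_congr rfl fun i _ => mul_comm _ _
  have h := congrArg φ hcr
  rw [map_smul, map_sum, Fin.sum_univ_succ, Fin.sum_univ_succ, Finset.sum_eq_zero] at h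
  · simp only [map_smul] at h
    simp only [smul_eq_mul, hφ, add_zero, Fin.succ_zero_eq_one] at h
    have e0 : (A.updateRow 0 b).det = P b d := congrArg Matrix.det (hcons0 c d b)
    have e1 : (A.updateRow 1 b).det = P c b := congrArg Matrix.det (hcons1 c d b)
    have r0 : A 0 = c := rfl
    have r1 : A 1 = d := by
      rw [← Fin.succ_zero_eq_one]; rfl
    have hdet : A.det = P c d := rfl
    rw [e0, e1, r0, r1, hswap c b, hdet] at h
    linarith
  · intro i _
    rw [map_smul, hφ, smul_eq_mul]
    have : P a (A i.succ.succ) = 0 :=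
      D.map_eq_zero_of_eq _ (i := 1) (j := i.succ.succ) (by
        rw [← Fin.succ_zero_eq_one]; rfl) (by simp [Fin.ext_iff])
    rw [this, mul_zero]

end TropHorn

/-! ### From Plücker relations of minors to tropical relations -/

namespace TropHorn

variable {E : Type}

/-! ### Tropical Plücker relations -/

theorem abs_enumSign_le (k : ℕ) {n : ℕ} (τ : Fin n → Pos) : |(enumSign k τ : ℝ)| ≤ 1 := by
  rw [enumSign]
  push_cast
  simp only [Finset.abs_prod]
  refine Finset.prod_le_one (fun _ _ => Finset.prod_nonneg fun _ _ => abs_nonneg _) fun _ _ =>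
    Finset.prod_le_one (fun _ _ => abs_nonneg _) fun _ _ => ?_
  rw [cmpSign]
  split_ifs <;> simp

/-- All labelled runs from `ρ` to the set `T` end there in order. -/
def Ordered (k : ℕ) {n : ℕ} (ops : List (Op E)) (ρ : Fin n → Pos) (T : Finset Pos) : Prop :=
  ∀ ρ' R, LRun ops ρ ρ' R → Finset.univ.image ρ' = T → StrictMono (rank k ∘ ρ')

/-- The enumeration `a, b, B 0, B 1, …`. -/
def pairEnum {m : ℕ} (B : Fin m → Pos) (a b : Pos) : Fin (m + 2) → Pos :=
  Fin.cons a (Fin.cons b B : Fin (m + 1) → Pos)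

theorem pairEnum_injective {m : ℕ} {B : Fin m → Pos} (hB : Function.Injective B) {a b : Pos}
    (hab : a ≠ b) (ha : ∀ i, B i ≠ a) (hb : ∀ i, B i ≠ b) :
    Function.Injective (pairEnum B a b) := by
  rw [pairEnum, Fin.cons_injective_iff, Fin.cons_injective_iff]
  refine ⟨?_, ?_, hB⟩
  · rintro ⟨i, hi⟩
    refine Fin.cases (fun h => hab (by simpa using h.symm)) (fun i h => ha i (by simpa using h))
      i hi
  · rintro ⟨i, hi⟩
    exact hb i hi

theorem image_pairEnum {m : ℕ} (B : Fin m → Pos) (a b : Pos) :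
    Finset.univ.image (pairEnum B a b) = insert a (insert b (Finset.univ.image B)) := by
  ext c
  simp only [pairEnum, Finset.mem_image, Finset.mem_univ, true_and, Finset.mem_insert,
    Fin.exists_fin_succ, Fin.cons_zero, Fin.cons_succ]
  simp only [eq_comm]

/-- Apart from the comparison of `a` with `b`, the sign is a product of a factor for `a`, a factor
for `b` and one for `B`. Hence the three products of a Plücker relation with columns `a`, `b`, `c`,
`d` in increasing order carry the same sign. -/
theorem enumSign_pairEnum (k : ℕ) {m : ℕ} (B : Fin m → Pos) (a b : Pos) :
    enumSign k (pairEnum B a b) = cmpSign k a b * (∏ j, cmpSign k a (B j)) *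
      ((∏ j, cmpSign k b (B j)) * enumSign k B) := by
  rw [pairEnum, enumSign_cons, enumSign_cons, Fin.prod_univ_succ]
  simp

theorem pathMinor_plucker {m : ℕ} (t : ℝ) (w : E → Trop) (ops : List (Op E))
    (ρ : Fin (m + 2) → Pos) (B : Fin m → Pos) (a b c d : Pos) :
    pathMinor t w ops ρ (pairEnum B a c) * pathMinor t w ops ρ (pairEnum B b d) =
      pathMinor t w ops ρ (pairEnum B a b) * pathMinor t w ops ρ (pairEnum B c d) +
      pathMinor t w ops ρ (pairEnum B a d) * pathMinor t w ops ρ (pairEnum B b c) := by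
  have h : ∀ a b, pathMinor t w ops ρ (pairEnum B a b) = (Matrix.of (Fin.cons
      (fun x => pathMat t w ops (ρ x) a) (Fin.cons (fun x => pathMat t w ops (ρ x) b)
      (fun i x => pathMat t w ops (ρ x) (B i)) : Fin (m + 1) → _) :
        Fin (m + 2) → _)).det := by
    intro a b
    rw [pathMinor, ← Matrix.det_transpose]
    congr 1
    ext i j
    refine Fin.cases ?_ (fun i => Fin.cases ?_ (fun i => ?_) i) i <;> simp [pairEnum]
  simp only [h]
  exact det_plucker _ _ _ _ _

section
variable {k m : ℕ} {w : E → Trop} {ops : List (Op E)} {ρ : Fin (m + 2) → Pos}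
  {B : Fin m → Pos} {a b c d : Pos}

theorem exists_bound (w : E → Trop) (ops : List (Op E)) {n : ℕ} (ρ : Fin n → Pos)
    (hρ : Function.Injective ρ) (τ : Fin n → Pos) (hτ : Function.Injective τ) :
    ∃ C : ℝ, 0 ≤ C ∧ ∀ t : ℝ, 0 ≤ t → |pathMinor t w ops ρ τ| ≤
        C * texp t (opt w ops (Finset.univ.image ρ) (Finset.univ.image τ)) := by
  obtain ⟨C, hC, h⟩ := abs_pathMinor_le w ops τ hτ
  exact ⟨C, hC, fun t ht => h t ht ρ hρ⟩

theorem texp_le_abs_pathMinor {n : ℕ} {ρ : Fin n → Pos}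
    (hρ : Function.Injective ρ) {τ : Fin n → Pos} (hτ : Function.Injective τ)
    (h : Ordered k ops ρ (Finset.univ.image τ)) (t : ℝ) :
    texp t (opt w ops (Finset.univ.image ρ) (Finset.univ.image τ)) ≤ |pathMinor t w ops ρ τ| := by
  refine (texp_opt_le_pathMinor (k := k) t w ops hρ hτ h).trans ((le_abs_self _).trans ?_)
  rw [abs_mul]
  exact mul_le_of_le_one_left (abs_nonneg _) (abs_enumSign_le _ _)

/-- If in one of the three products of the three-term relation both minors are sums over runs, its
tropical version is bounded by those of the other two. -/
theorem opt_add_opt_le (hρ : Function.Injective ρ) (hB : Function.Injective B)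
    (hab : a ≠ b) (hac : a ≠ c) (had : a ≠ d) (hbc : b ≠ c) (hbd : b ≠ d) (hcd : c ≠ d)
    (ha : ∀ i, B i ≠ a) (hb : ∀ i, B i ≠ b) (hc : ∀ i, B i ≠ c) (hd : ∀ i, B i ≠ d)
    (h₁ : Ordered k ops ρ (Finset.univ.image (pairEnum B a b)))
    (h₂ : Ordered k ops ρ (Finset.univ.image (pairEnum B c d))) :
    opt w ops (Finset.univ.image ρ) (Finset.univ.image (pairEnum B a b)) +
      opt w ops (Finset.univ.image ρ) (Finset.univ.image (pairEnum B c d)) ≤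
    max (opt w ops (Finset.univ.image ρ) (Finset.univ.image (pairEnum B a c)) +
      opt w ops (Finset.univ.image ρ) (Finset.univ.image (pairEnum B b d)))
      (opt w ops (Finset.univ.image ρ) (Finset.univ.image (pairEnum B a d)) +
      opt w ops (Finset.univ.image ρ) (Finset.univ.image (pairEnum B b c))) := by
  obtain ⟨C₁, hC₁, hac'⟩ := exists_bound w ops ρ hρ _ (pairEnum_injective hB hac ha hc)
  obtain ⟨C₂, hC₂, hbd'⟩ := exists_bound w ops ρ hρ _ (pairEnum_injective hB hbd hb hd)
  obtain ⟨C₃, hC₃, had'⟩ := exists_bound w ops ρ hρ _ (pairEnum_injective hB had ha hd)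
  obtain ⟨C₄, hC₄, hbc'⟩ := exists_bound w ops ρ hρ _ (pairEnum_injective hB hbc hb hc)
  refine le_of_texp_le (C₁ * C₂ + C₃ * C₄) fun t ht => ?_
  have e₁ := texp_le_abs_pathMinor (w := w) hρ (pairEnum_injective hB hab ha hb) h₁ t
  have e₂ := texp_le_abs_pathMinor (w := w) hρ (pairEnum_injective hB hcd hc hd) h₂ t
  have hp := pathMinor_plucker t w ops ρ B a b c d
  have habs : |pathMinor t w ops ρ (pairEnum B a b)| * |pathMinor t w ops ρ (pairEnum B c d)| ≤
      |pathMinor t w ops ρ (pairEnum B a c)| * |pathMinor t w ops ρ (pairEnum B b d)| +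
      |pathMinor t w ops ρ (pairEnum B a d)| * |pathMinor t w ops ρ (pairEnum B b c)| := by
    -- The relation is solved for the product without cancellation; the other two enter by absolute
    -- values, so their signs do not matter.
    rw [← abs_mul, ← abs_mul, ← abs_mul, eq_sub_of_add_eq hp.symm]
    exact abs_sub _ _
  rw [texp_add]
  refine (mul_le_mul e₁ e₂ (texp_nonneg _ _) (abs_nonneg _)).trans (habs.trans ?_)
  rw [add_mul]
  refine add_le_add ?_ ?_
  · refine (mul_le_mul (hac' t ht) (hbd' t ht) (abs_nonneg _)
      (mul_nonneg hC₁ (texp_nonneg _ _))).trans ?_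
    rw [mul_mul_mul_comm, ← texp_add]
    exact mul_le_mul_of_nonneg_left (texp_mono ht (le_max_left _ _)) (mul_nonneg hC₁ hC₂)
  · refine (mul_le_mul (had' t ht) (hbc' t ht) (abs_nonneg _)
      (mul_nonneg hC₃ (texp_nonneg _ _))).trans ?_
    rw [mul_mul_mul_comm, ← texp_add]
    exact mul_le_mul_of_nonneg_left (texp_mono ht (le_max_right _ _)) (mul_nonneg hC₃ hC₄)

/-- If in the three-term relation all minors are sums over runs, the middle product of its
tropical version is bounded from below by the other two. -/
theorem max_le_opt_add_opt (hρ : Function.Injective ρ) (hBi : Function.Injective B)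
    (hab : rank k a < rank k b) (hbc : rank k b < rank k c) (hcd : rank k c < rank k d)
    (ha : ∀ i, B i ≠ a) (hb : ∀ i, B i ≠ b) (hc : ∀ i, B i ≠ c) (hd : ∀ i, B i ≠ d)
    (h₁ : Ordered k ops ρ (Finset.univ.image (pairEnum B a b)))
    (h₂ : Ordered k ops ρ (Finset.univ.image (pairEnum B c d)))
    (h₅ : Ordered k ops ρ (Finset.univ.image (pairEnum B a d)))
    (h₆ : Ordered k ops ρ (Finset.univ.image (pairEnum B b c))) :
    max (opt w ops (Finset.univ.image ρ) (Finset.univ.image (pairEnum B a b)) +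
      opt w ops (Finset.univ.image ρ) (Finset.univ.image (pairEnum B c d)))
      (opt w ops (Finset.univ.image ρ) (Finset.univ.image (pairEnum B a d)) +
      opt w ops (Finset.univ.image ρ) (Finset.univ.image (pairEnum B b c))) ≤
    opt w ops (Finset.univ.image ρ) (Finset.univ.image (pairEnum B a c)) +
      opt w ops (Finset.univ.image ρ) (Finset.univ.image (pairEnum B b d)) := by
  have hne : ∀ {a b : Pos}, rank k a < rank k b → a ≠ b := fun h h' => h.ne (congrArg _ h')
  have iab := pairEnum_injective hBi (hne hab) ha hb
  have icd := pairEnum_injective hBi (hne hcd) hc hd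
  have iac := pairEnum_injective hBi (hne (hab.trans hbc)) ha hc
  have ibd := pairEnum_injective hBi (hne (hbc.trans hcd)) hb hd
  have iad := pairEnum_injective hBi (hne (hab.trans (hbc.trans hcd))) ha hd
  have ibc := pairEnum_injective hBi (hne hbc) hb hc
  obtain ⟨C₁, hC₁, hac'⟩ := exists_bound w ops ρ hρ _ iac
  obtain ⟨C₂, hC₂, hbd'⟩ := exists_bound w ops ρ hρ _ ibd
  set s : Pos → ℤ := fun a => ∏ j, cmpSign k a (B j)
  set e : ℤ := enumSign k B
  have hsign : ∀ {a b : Pos}, rank k a < rank k b → enumSign k (pairEnum B a b) = s a * s b * e :=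
    fun {a b} h => by rw [enumSign_pairEnum, cmpSign_of_lt h]; ring
  have key : ∀ t : ℝ, 0 ≤ t → texp t (opt w ops (Finset.univ.image ρ)
        (Finset.univ.image (pairEnum B a b)) +
      opt w ops (Finset.univ.image ρ) (Finset.univ.image (pairEnum B c d))) +
      texp t (opt w ops (Finset.univ.image ρ) (Finset.univ.image (pairEnum B a d)) +
      opt w ops (Finset.univ.image ρ) (Finset.univ.image (pairEnum B b c))) ≤ C₁ * C₂ *
      texp t (opt w ops (Finset.univ.image ρ) (Finset.univ.image (pairEnum B a c)) +
      opt w ops (Finset.univ.image ρ) (Finset.univ.image (pairEnum B b d))) := by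
    intro t ht
    have e₁ := texp_opt_le_pathMinor (k := k) t w ops hρ iab h₁
    have e₂ := texp_opt_le_pathMinor (k := k) t w ops hρ icd h₂
    have e₅ := texp_opt_le_pathMinor (k := k) t w ops hρ iad h₅
    have e₆ := texp_opt_le_pathMinor (k := k) t w ops hρ ibc h₆
    have hp := pathMinor_plucker t w ops ρ B a b c d
    rw [hsign hab] at e₁
    rw [hsign hcd] at e₂
    rw [hsign (hab.trans (hbc.trans hcd))] at e₅
    rw [hsign hbc] at e₆
    have b₁ := mul_le_mul e₁ e₂ (texp_nonneg _ _) ((texp_nonneg _ _).trans e₁)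
    have b₂ := mul_le_mul e₅ e₆ (texp_nonneg _ _) ((texp_nonneg _ _).trans e₅)
    simp only [texp_add]
    have b₃ : (((s a * s c * e : ℤ) : ℝ) * pathMinor t w ops ρ (pairEnum B a c)) *
        (((s b * s d * e : ℤ) : ℝ) * pathMinor t w ops ρ (pairEnum B b d)) ≤
        |pathMinor t w ops ρ (pairEnum B a c)| * |pathMinor t w ops ρ (pairEnum B b d)| := by
      rw [← hsign (hab.trans hbc), ← hsign (hbc.trans hcd)]
      refine (le_abs_self _).trans ?_
      rw [abs_mul, abs_mul, abs_mul]
      refine mul_le_mul ?_ ?_ (by positivity) (by positivity)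
      · exact mul_le_of_le_one_left (abs_nonneg _) (abs_enumSign_le _ _)
      · exact mul_le_of_le_one_left (abs_nonneg _) (abs_enumSign_le _ _)
    have b₄ := mul_le_mul (hac' t ht) (hbd' t ht) (abs_nonneg _)
      (mul_nonneg hC₁ (texp_nonneg _ _))
    refine (add_le_add b₁ b₂).trans (le_trans (le_of_eq ?_) (b₃.trans (b₄.trans (le_of_eq ?_))))
    · push_cast
      -- All three products of the relation carry the factor `s a * s b * s c * s d * e * e`, so the
      -- two bounded from below add up to the third.
      linear_combination (-(s a * s b * s c * s d * e * e) : ℝ) * hp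
    · ring
  refine max_le ?_ ?_
  · exact le_of_texp_le _ fun t ht => (le_add_of_nonneg_right (texp_nonneg _ _)).trans (key t ht)
  · exact le_of_texp_le _ fun t ht => (le_add_of_nonneg_left (texp_nonneg _ _)).trans (key t ht)

end

end TropHorn

/-! ### Systems of nets: order of the particles, octahedron recurrence, rhombus inequalities -/

namespace TropHorn

variable {E : Type}

/-! ### Systems of nets -/

/-- A slanted operation moves a particle from a line to the line below. -/
def Op.IsSlant (o : Op E) : Prop := ∃ l, o.src = .inl (l + 1) ∧ o.tgt = .inl l

/-- A net: the edges by which it is entered, and slanted operations. -/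
structure Net (E : Type) where
  enter : ℕ → List E
  slants : List (Op E)
  isSlant : ∀ o ∈ slants, o.IsSlant

/-- At the `p`-th vertical, a particle on the line `l` may leave the system. -/
def exitOp (p l : ℕ) (c : List E) : Op E :=
  ⟨.inl l, .inr (p, l), Sum.inl_ne_inr, c, [], []⟩

/-- The operations at the `p`-th vertical. -/
def exitOps (n p : ℕ) (c : ℕ → List E) : List (Op E) :=
  (List.range n).map fun l => exitOp p l (c l)

/-- The operations of a concatenation of nets, the first vertical having the number `p`. -/
def sysOps (n : ℕ) : ℕ → List (Net E) → List (Op E)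
  | _, [] => []
  | p, N :: Ns => exitOps n p N.enter ++ (N.slants ++ sysOps n (p + 1) Ns)

section LRun

variable {ι : Type} {ρ ρ' : ι → Pos} {R : ι → List E}

/-- A particle moves by one line at a time and only to a free line, so it cannot pass its neighbour.
-/
theorem LRun.slants {l : List (Op E)} (h : LRun l ρ ρ' R) (hl : ∀ o ∈ l, o.IsSlant)
    (hρ : Function.Injective ρ) :
    (∀ x q, ρ x = .inr q → ρ' x = .inr q) ∧ (∀ x a, ρ x = .inl a → ∃ a', ρ' x = .inl a') ∧
      ∀ x y a b, ρ x = .inl a → ρ y = .inl b → a < b →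
        ∃ a' b', ρ' x = .inl a' ∧ ρ' y = .inl b' ∧ a' < b' := by
  induction h with
  | nil ρ => exact ⟨fun _ _ h => h, fun _ a h => ⟨a, h⟩, fun _ _ a b h h' hab => ⟨a, b, h, h', hab⟩⟩
  | stay _ ih => exact ih (fun o ho => hl o (List.mem_cons_of_mem _ ho)) hρ
  | @move o ops ρ ρ' R h₁ h₂ _ ih =>
    obtain ⟨i₁, i₂, i₃⟩ := ih (fun o ho => hl o (List.mem_cons_of_mem _ ho))
      (shift_injective o hρ h₂)
    obtain ⟨L, hs, ht⟩ := hl o List.mem_cons_self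
    refine ⟨fun x q hx => i₁ x q ?_, fun x a hx => ?_, fun x y a b hx hy hab => ?_⟩
    · simp [Op.shift, hx, hs]
    · by_cases ha : a = L + 1
      · exact i₂ x L (by simp [Op.shift, hx, hs, ht, ha])
      · exact i₂ x a (by simp [Op.shift, hx, hs, ha])
    · have hax : a ≠ L := fun h => h₂ x (by rw [hx, ht, h])
      by_cases ha : a = L + 1
      · exact i₃ x y L b (by simp [Op.shift, hx, hs, ht, ha])
          (by simp only [Function.comp, Op.shift, hy, hs, Sum.inl.injEq]; rw [if_neg (by omega)])
          (by omega)
      · by_cases hb : b = L + 1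
        · exact i₃ x y a L (by simp [Op.shift, hx, hs, ha]) (by simp [Op.shift, hy, hs, ht, hb])
            (by omega)
        · exact i₃ x y a b (by simp [Op.shift, hx, hs, ha]) (by simp [Op.shift, hy, hs, hb]) hab

theorem LRun.exits {p : ℕ} {l : List (Op E)} (h : LRun l ρ ρ' R)
    (hl : ∀ o ∈ l, ∃ a c, o = exitOp p a c) (x : ι) :
    ρ' x = ρ x ∨ ∃ a, ρ x = .inl a ∧ ρ' x = .inr (p, a) := by
  induction h with
  | nil ρ => exact Or.inl rfl
  | stay _ ih => exact ih (fun o ho => hl o (List.mem_cons_of_mem _ ho))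
  | @move o ops ρ ρ' R h₁ h₂ _ ih =>
    obtain ⟨a, c, rfl⟩ := hl o List.mem_cons_self
    have hs : (exitOp p a c).shift (ρ x) = if ρ x = .inl a then .inr (p, a) else ρ x := rfl
    rcases ih (fun o ho => hl o (List.mem_cons_of_mem _ ho)) with h | ⟨b, hb, h⟩
    · rw [h]
      simp only [Function.comp, hs]
      split_ifs with hx
      · exact Or.inr ⟨a, hx, rfl⟩
      · exact Or.inl rfl
    · simp only [Function.comp, hs] at hb
      split_ifs at hb with hx
      exact Or.inr ⟨b, hb, h⟩

theorem mem_exitOps {n p : ℕ} {c : ℕ → List E} {o : Op E} (ho : o ∈ exitOps n p c) :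
    ∃ a c, o = exitOp p a c := by
  obtain ⟨a, -, rfl⟩ := List.mem_map.1 ho
  exact ⟨a, _, rfl⟩

/-- A particle that has left is never touched again, and one still on a line can leave only at the
verticals to come. -/
theorem LRun.stored {n p : ℕ} {Ns : List (Net E)} (h : LRun (sysOps n p Ns) ρ ρ' R)
    (hρ : Function.Injective ρ) (x : ι) :
    (∀ q, ρ x = .inr q → ρ' x = .inr q) ∧
      ∀ a, ρ x = .inl a → (∃ b, ρ' x = .inl b) ∨
        ∃ q, ρ' x = .inr q ∧ p ≤ q.1 ∧ q.1 < p + Ns.length := by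
  induction Ns generalizing p ρ R with
  | nil =>
    rw [sysOps] at h
    cases h
    exact ⟨fun q h => h, fun a h => Or.inl ⟨a, h⟩⟩
  | cons N Ns ih =>
    rw [sysOps] at h
    obtain ⟨ρ₁, R₁, R', h₁, h'⟩ := h.split
    obtain ⟨ρ₂, R₂, R₃, h₂, h₃⟩ := h'.split
    have hv := h₁.exits (fun o ho => mem_exitOps ho) x
    have hρ₁ := h₁.injective hρ
    obtain ⟨s₁, s₂, -⟩ := h₂.slants N.isSlant hρ₁
    obtain ⟨j₁, j₂⟩ := ih h₃ (h₂.injective hρ₁)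
    refine ⟨fun q hq => ?_, fun a ha => ?_⟩
    · rcases hv with hv | ⟨a, ha, -⟩
      · exact j₁ q (s₁ x q (hv.trans hq))
      · rw [ha] at hq; cases hq
    · rcases hv with hv | ⟨b, hb, hv⟩
      · obtain ⟨b, hb⟩ := s₂ x a (hv.trans ha)
        rcases j₂ b hb with h | ⟨q, hq, h1, h2⟩
        · exact Or.inl h
        · exact Or.inr ⟨q, hq, by omega, by rw [List.length_cons]; omega⟩
      · exact Or.inr ⟨(p, b), j₁ _ (s₁ x _ hv), le_rfl, by simp⟩

/-- Particles that start in order end in order if on each vertical the lowest points are used. -/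
theorem LRun.rank_lt {n p k : ℕ} {Ns : List (Net E)} (h : LRun (sysOps n p Ns) ρ ρ' R)
    (hk : k = p + Ns.length) (hρ : Function.Injective ρ)
    (hpast : ∀ x q, ρ x = .inr q → q.1 < p)
    (hdown : ∀ x q l, ρ' x = .inr (q, l) → p ≤ q → ∀ l' < l, ∃ y, ρ' y = .inr (q, l'))
    {x y : ι} {a b : ℕ} (hx : ρ x = .inl a) (hy : ρ y = .inl b) (hab : a < b) :
    rank k (ρ' x) < rank k (ρ' y) := by
  induction Ns generalizing p ρ R a b with
  | nil =>
    rw [sysOps] at h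
    cases h
    rw [hx, hy, rank, rank, Prod.Lex.toLex_lt_toLex]
    exact Or.inr ⟨rfl, hab⟩
  | cons N Ns ih =>
    rw [sysOps] at h
    obtain ⟨ρ₁, R₁, R', h₁, h'⟩ := h.split
    obtain ⟨ρ₂, R₂, R₃, h₂, h₃⟩ := h'.split
    have hv := h₁.exits (fun o ho => mem_exitOps ho)
    have hρ₁ := h₁.injective hρ
    have hρ₂ := h₂.injective hρ₁
    obtain ⟨s₁, s₂, s₃⟩ := h₂.slants N.isSlant hρ₁
    have hst := fun z => h₃.stored hρ₂ z
    have hlen : k = p + 1 + Ns.length := by rw [hk, List.length_cons]; omega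
    have hexit : ∀ z c, ρ₁ z = .inr (p, c) → ρ' z = .inr (p, c) :=
      fun z c hz => (hst z).1 _ (s₁ z _ hz)
    have hlive : ∀ z c, ρ₁ z = .inl c → (∃ b, ρ' z = .inl b) ∨
        ∃ q, ρ' z = .inr q ∧ p + 1 ≤ q.1 ∧ q.1 < k := by
      intro z c hz
      obtain ⟨c', hc'⟩ := s₂ z c hz
      rw [hlen]
      exact (hst z).2 c' hc'
    have hx' := hv x
    have hy' := hv y
    rw [hx] at hx'
    rw [hy] at hy'
    rcases hx' with hx' | ⟨_, hxa, hx'⟩ <;> rcases hy' with hy' | ⟨_, hyb, hy'⟩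
    · obtain ⟨a', b', ha', hb', hab'⟩ := s₃ x y a b hx' hy' hab
      refine ih h₃ hlen hρ₂ (fun z q hz => ?_) (fun z q l hz hq => hdown z q l hz (by omega))
        ha' hb' hab'
      rcases hv z with h | ⟨c, hc, h⟩
      · rcases hz₀ : ρ z with c | q'
        · obtain ⟨c', hc'⟩ := s₂ z c (h.trans hz₀)
          rw [hc'] at hz; cases hz
        · have := s₁ z q' (h.trans hz₀)
          rw [hz] at this
          cases this
          exact (hpast z q hz₀).trans (Nat.lt_succ_self p)
      · have := s₁ z _ h
        rw [hz] at this
        cases this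
        exact Nat.lt_succ_self p
    · exfalso
      cases hyb
      -- If the upper particle left here and the lower one did not, the lower point `(p, a)` would
      -- also be an end point, by `hdown`. The particle ending there can only be the one standing on
      -- the line `a`, that is `x`, which however goes on.
      obtain ⟨z, hz⟩ := hdown y p b (hexit y b hy') le_rfl a hab
      have hzx : z = x := by
        apply hρ
        rw [hx]
        rcases hv z with h | ⟨c, hc, h⟩
        · rcases hz₀ : ρ z with c | q
          · rcases hlive z c (h.trans hz₀) with ⟨_, h'⟩ | ⟨q, h', hq, -⟩
            · rw [hz] at h'; cases h'
            · rw [hz] at h'; cases h'; omega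
          · have := (hst z).1 q (s₁ z q (h.trans hz₀))
            rw [hz] at this
            cases this
            exact absurd (hpast z _ hz₀) (lt_irrefl p)
        · have := hexit z c h
          rw [hz] at this
          cases this
          exact hc
      subst hzx
      rcases hlive z a hx' with ⟨_, h'⟩ | ⟨q, h', hq, -⟩
      · rw [hz] at h'; cases h'
      · rw [hz] at h'; cases h'; omega
    · cases hxa
      rw [hexit x a hx']
      rcases hlive y b hy' with ⟨c, h'⟩ | ⟨q, h', hq, -⟩
      · rw [h', rank, rank, Prod.Lex.toLex_lt_toLex]
        left
        change p < k
        rw [hlen]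
        omega
      · rw [h', rank, rank, Prod.Lex.toLex_lt_toLex]
        left
        exact hq
    · cases hxa
      cases hyb
      rw [hexit x a hx', hexit y b hy', rank, rank, Prod.Lex.toLex_lt_toLex]
      exact Or.inr ⟨rfl, hab⟩

end LRun

/-! ### Sets of final positions -/

/-- The `l`-th point of the `p`-th vertical as a final position, the last vertical being the
`k`-th. -/
def endPos (k p l : ℕ) : Pos := if p = k then .inl l else .inr (p, l)

theorem rank_endPos (k p l : ℕ) : rank k (endPos k p l) = toLex (p, l) := by
  rw [endPos]
  split_ifs with h
  · rw [rank, h]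
  · rfl

theorem endPos_inj {k p l p' l' : ℕ} : endPos k p l = endPos k p' l' ↔ p = p' ∧ l = l' := by
  constructor
  · intro h
    have := congrArg (rank k) h
    rw [rank_endPos, rank_endPos] at this
    simpa using this
  · rintro ⟨rfl, rfl⟩
    rfl

/-- The lowest `u p` points of each vertical. -/
def lowest (k : ℕ) (u : Fin (k + 1) → ℕ) : Finset Pos :=
  Finset.univ.biUnion fun p => (Finset.range (u p)).image (endPos k p)

theorem mem_lowest {k : ℕ} {u : Fin (k + 1) → ℕ} {a : Pos} :
    a ∈ lowest k u ↔ ∃ p : Fin (k + 1), ∃ l < u p, endPos k p l = a := by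
  simp [lowest]

theorem endPos_mem_lowest {k : ℕ} {u : Fin (k + 1) → ℕ} {p : Fin (k + 1)} {l : ℕ} :
    endPos k p l ∈ lowest k u ↔ l < u p := by
  rw [mem_lowest]
  constructor
  · rintro ⟨p', l', h, h'⟩
    obtain ⟨h1, rfl⟩ := endPos_inj.1 h'
    rwa [← Fin.ext h1]
  · exact fun h => ⟨p, l, h, rfl⟩

theorem card_lowest {k : ℕ} (u : Fin (k + 1) → ℕ) : (lowest k u).card = ∑ p, u p := by
  rw [lowest, Finset.card_biUnion]
  · refine Finset.sum_congr rfl fun p _ => ?_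
    rw [Finset.card_image_of_injective, Finset.card_range]
    intro l l' h
    exact (endPos_inj.1 h).2
  · intro p _ p' _ hpp'
    rw [Function.onFun, Finset.disjoint_left]
    intro a ha ha'
    obtain ⟨l, -, rfl⟩ := Finset.mem_image.1 ha
    obtain ⟨l', -, h⟩ := Finset.mem_image.1 ha'
    exact hpp' (Fin.ext (endPos_inj.1 h).1.symm)

theorem lowest_add_single {k : ℕ} (u : Fin (k + 1) → ℕ) (p : Fin (k + 1)) :
    lowest k (u + Pi.single p 1) = insert (endPos k p (u p)) (lowest k u) := by
  ext a
  rw [Finset.mem_insert]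
  constructor
  · intro h
    obtain ⟨q, l, hl, rfl⟩ := mem_lowest.1 h
    rw [endPos_inj, endPos_mem_lowest]
    by_cases hq : q = p
    · subst hq
      rw [Pi.add_apply, Pi.single_eq_same] at hl
      rcases Nat.lt_succ_iff_lt_or_eq.1 hl with h | h
      · exact Or.inr h
      · exact Or.inl ⟨rfl, h⟩
    · rw [Pi.add_apply, Pi.single_eq_of_ne hq, add_zero] at hl
      exact Or.inr hl
  · rintro (rfl | h)
    · rw [endPos_mem_lowest]; simp
    · obtain ⟨q, l, hl, rfl⟩ := mem_lowest.1 h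
      rw [endPos_mem_lowest]
      exact hl.trans_le (by simp)

/-- The initial positions: all lines are occupied. -/
def allLines (n : ℕ) : Finset Pos := (Finset.range n).image Sum.inl

/-- The enumeration of the initial positions. -/
def lineEnum (n : ℕ) (x : Fin n) : Pos := .inl x

theorem lineEnum_injective (n : ℕ) : Function.Injective (lineEnum n) := fun x y h => by
  simpa [lineEnum, Fin.ext_iff] using h

theorem image_lineEnum (n : ℕ) : Finset.univ.image (lineEnum n) = allLines n := by
  ext a
  simp only [lineEnum, allLines, Finset.mem_image, Finset.mem_univ, true_and, Finset.mem_range]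
  constructor
  · rintro ⟨x, rfl⟩; exact ⟨x, x.2, rfl⟩
  · rintro ⟨x, hx, rfl⟩; exact ⟨⟨x, hx⟩, rfl⟩

/-- Lowest points on each vertical are what `LRun.rank_lt` requires, so the corresponding minors
have no cancellation. -/
theorem ordered_lowest {n k : ℕ} {Ns : List (Net E)} (hk : Ns.length = k) (u : Fin (k + 1) → ℕ) :
    Ordered k (sysOps n 0 Ns) (lineEnum n) (lowest k u) := by
  intro ρ' R h him x y hxy
  refine h.rank_lt (by omega) (lineEnum_injective n) (fun z q hz => by simp [lineEnum] at hz)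
    (fun z q l hz _ l' hl' => ?_) (x := x) (y := y) rfl rfl hxy
  have hmem : (.inr (q, l) : Pos) ∈ lowest k u := by
    rw [← him, ← hz]
    exact Finset.mem_image_of_mem _ (Finset.mem_univ z)
  obtain ⟨p, l₀, hl₀, hp⟩ := mem_lowest.1 hmem
  have hpk : (p : ℕ) ≠ k := by
    intro hpk
    rw [endPos, if_pos hpk] at hp
    cases hp
  rw [endPos, if_neg hpk] at hp
  cases hp
  have : endPos k p l' ∈ lowest k u := endPos_mem_lowest.2 (hl'.trans hl₀)
  rw [← him, endPos, if_neg hpk] at this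
  simpa using this

/-! ### The octahedron recurrence and the rhombus inequalities for systems of nets -/

theorem exists_enum_lowest {m k : ℕ} {u : Fin (k + 1) → ℕ} (hu : ∑ p, u p = m) :
    ∃ B : Fin m → Pos, Function.Injective B ∧ Finset.univ.image B = lowest k u := by
  have hc : (lowest k u).card = m := by rw [card_lowest, hu]
  refine ⟨fun i => ((lowest k u).equivFinOfCardEq hc).symm i, fun i j h => ?_, ?_⟩
  · exact ((lowest k u).equivFinOfCardEq hc).symm.injective (Subtype.ext h)
  · ext a
    simp only [Finset.mem_image, Finset.mem_univ, true_and]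
    constructor
    · rintro ⟨i, rfl⟩; exact Subtype.property _
    · intro ha
      exact ⟨(lowest k u).equivFinOfCardEq hc ⟨a, ha⟩, by simp⟩

theorem endPos_notMem_lowest {k : ℕ} {u : Fin (k + 1) → ℕ} (p : Fin (k + 1)) {l : ℕ}
    (h : u p ≤ l) : endPos k p l ∉ lowest k u :=
  fun h' => absurd (endPos_mem_lowest.1 h') h.not_gt

theorem lowest_add_two {k : ℕ} (u : Fin (k + 1) → ℕ) {p q : Fin (k + 1)} (h : p ≠ q) :
    lowest k (u + Pi.single p 1 + Pi.single q 1) =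
      insert (endPos k p (u p)) (insert (endPos k q (u q)) (lowest k u)) := by
  rw [lowest_add_single, lowest_add_single, Pi.add_apply, Pi.single_eq_of_ne h.symm, add_zero,
    Finset.insert_comm]

theorem lowest_add_twice {k : ℕ} (u : Fin (k + 1) → ℕ) (p : Fin (k + 1)) :
    lowest k (u + Pi.single p 1 + Pi.single p 1) =
      insert (endPos k p (u p)) (insert (endPos k p (u p + 1)) (lowest k u)) := by
  rw [lowest_add_single, lowest_add_single, Pi.add_apply, Pi.single_eq_same, Finset.insert_comm]

/-- This is the relation for the columns `u a` and `u a + 1` of the vertical `a` and one column on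
each of `b` and `c`. Both minors on the left have lowest columns. On the right there are minors that
skip the column `u a`; for these the upper bound by the tropical minor suffices. -/
theorem opt_rhombus {n k : ℕ} (w : E → Trop) {Ns : List (Net E)} (hk : Ns.length = k)
    {u : Fin (k + 1) → ℕ} (hu : ∑ p, u p + 2 = n) {a b c : Fin (k + 1)} (hab : a ≠ b)
    (hac : a ≠ c) (hbc : b ≠ c) :
    opt w (sysOps n 0 Ns) (allLines n) (lowest k (u + Pi.single a 1 + Pi.single a 1)) +
      opt w (sysOps n 0 Ns) (allLines n) (lowest k (u + Pi.single b 1 + Pi.single c 1)) ≤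
    max (opt w (sysOps n 0 Ns) (allLines n) (lowest k (u + Pi.single a 1 + Pi.single b 1)) +
      opt w (sysOps n 0 Ns) (allLines n)
        (insert (endPos k a (u a + 1)) (insert (endPos k c (u c)) (lowest k u))))
      (opt w (sysOps n 0 Ns) (allLines n) (lowest k (u + Pi.single a 1 + Pi.single c 1)) +
      opt w (sysOps n 0 Ns) (allLines n)
        (insert (endPos k a (u a + 1)) (insert (endPos k b (u b)) (lowest k u)))) := by
  subst hu
  obtain ⟨B, hB, hBu⟩ := exists_enum_lowest (u := u) rfl
  have hBne : ∀ p : Fin (k + 1), ∀ l, u p ≤ l → ∀ i, B i ≠ endPos k p l := by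
    intro p l hl i hi
    refine endPos_notMem_lowest p hl ?_
    rw [← hi, ← hBu]
    exact Finset.mem_image_of_mem _ (Finset.mem_univ i)
  have hp : ∀ {p q : Fin (k + 1)} {l l'}, p ≠ q → endPos k p l ≠ endPos k q l' :=
    fun h h' => h (Fin.ext (endPos_inj.1 h').1)
  have hl : endPos k a (u a) ≠ endPos k a (u a + 1) := fun h => by
    have := (endPos_inj.1 h).2
    omega
  have := opt_add_opt_le (k := k) (w := w) (ops := sysOps _ 0 Ns) (lineEnum_injective _) hB
    (a := endPos k a (u a)) (b := endPos k a (u a + 1)) (c := endPos k b (u b))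
    (d := endPos k c (u c)) hl (hp hab) (hp hac) (hp hab) (hp hac) (hp hbc)
    (hBne _ _ le_rfl) (hBne _ _ (Nat.le_succ _)) (hBne _ _ le_rfl) (hBne _ _ le_rfl)
    (by rw [image_pairEnum, hBu, ← lowest_add_twice]; exact ordered_lowest hk _)
    (by rw [image_pairEnum, hBu, ← lowest_add_two _ hbc]; exact ordered_lowest hk _)
  simpa only [image_lineEnum, image_pairEnum, hBu, ← lowest_add_twice, ← lowest_add_two _ hab,
    ← lowest_add_two _ hac, ← lowest_add_two _ hbc] using this

/-- One new column is taken on each of four verticals. All six minors then have lowest columns, and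
both tropical inequalities are available. -/
theorem opt_octahedron {n k : ℕ} (w : E → Trop) {Ns : List (Net E)} (hk : Ns.length = k)
    {u : Fin (k + 1) → ℕ} (hu : ∑ p, u p + 2 = n) {a b c d : Fin (k + 1)} (hab : a < b)
    (hbc : b < c) (hcd : c < d) :
    opt w (sysOps n 0 Ns) (allLines n) (lowest k (u + Pi.single a 1 + Pi.single c 1)) +
      opt w (sysOps n 0 Ns) (allLines n) (lowest k (u + Pi.single b 1 + Pi.single d 1)) =
    max (opt w (sysOps n 0 Ns) (allLines n) (lowest k (u + Pi.single a 1 + Pi.single b 1)) +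
      opt w (sysOps n 0 Ns) (allLines n) (lowest k (u + Pi.single c 1 + Pi.single d 1)))
      (opt w (sysOps n 0 Ns) (allLines n) (lowest k (u + Pi.single a 1 + Pi.single d 1)) +
      opt w (sysOps n 0 Ns) (allLines n) (lowest k (u + Pi.single b 1 + Pi.single c 1))) := by
  subst hu
  obtain ⟨B, hB, hBu⟩ := exists_enum_lowest (u := u) rfl
  have hBne : ∀ p : Fin (k + 1), ∀ i, B i ≠ endPos k p (u p) := by
    intro p i hi
    refine endPos_notMem_lowest (u := u) p le_rfl ?_
    rw [← hi, ← hBu]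
    exact Finset.mem_image_of_mem _ (Finset.mem_univ i)
  have hp : ∀ {p q : Fin (k + 1)}, p < q → endPos k p (u p) ≠ endPos k q (u q) :=
    fun h h' => h.ne (Fin.ext (endPos_inj.1 h').1)
  have hr : ∀ {p q : Fin (k + 1)}, p < q →
      rank k (endPos k p (u p)) < rank k (endPos k q (u q)) := by
    intro p q h
    rw [rank_endPos, rank_endPos, Prod.Lex.toLex_lt_toLex]
    exact Or.inl h
  have hac := hab.trans hbc
  have hbd := hbc.trans hcd
  have had := hab.trans hbd
  have hord : ∀ {p q : Fin (k + 1)}, p < q → Ordered k (sysOps (∑ p, u p + 2) 0 Ns)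
      (lineEnum (∑ p, u p + 2))
      (Finset.univ.image (pairEnum B (endPos k p (u p)) (endPos k q (u q)))) := by
    intro p q h
    rw [image_pairEnum, hBu, ← lowest_add_two _ h.ne]
    exact ordered_lowest hk _
  refine le_antisymm ?_ ?_
  -- The roles of `b` and `c` are interchanged, so that the product of `ac` and `bd` is the one to
  -- be bounded.
  · have := opt_add_opt_le (k := k) (w := w) (ops := sysOps _ 0 Ns) (lineEnum_injective _) hB
      (a := endPos k a (u a)) (b := endPos k c (u c)) (c := endPos k b (u b))
      (d := endPos k d (u d)) (hp hac) (hp hab) (hp had) (hp hbc).symm (hp hcd) (hp hbd)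
      (hBne _) (hBne _) (hBne _) (hBne _) (hord hac) (hord hbd)
    have hcb : ∀ S : Finset Pos, insert (endPos k c (u c)) (insert (endPos k b (u b)) S) =
      insert (endPos k b (u b)) (insert (endPos k c (u c)) S) := fun S => Finset.insert_comm _ _ _
    simpa only [image_lineEnum, image_pairEnum, hBu, hcb, ← lowest_add_two _ hab.ne,
      ← lowest_add_two _ hac.ne, ← lowest_add_two _ hbc.ne, ← lowest_add_two _ had.ne,
      ← lowest_add_two _ hbd.ne, ← lowest_add_two _ hcd.ne] using this
  · have := max_le_opt_add_opt (k := k) (w := w) (ops := sysOps _ 0 Ns) (lineEnum_injective _) hB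
      (a := endPos k a (u a)) (b := endPos k b (u b)) (c := endPos k c (u c))
      (d := endPos k d (u d)) (hr hab) (hr hbc) (hr hcd)
      (hBne _) (hBne _) (hBne _) (hBne _) (hord hab) (hord hcd) (hord had) (hord hbc)
    simpa only [image_lineEnum, image_pairEnum, hBu, ← lowest_add_two _ hab.ne,
      ← lowest_add_two _ hac.ne, ← lowest_add_two _ hbc.ne, ← lowest_add_two _ had.ne,
      ← lowest_add_two _ hbd.ne, ← lowest_add_two _ hcd.ne] using this

end TropHorn

/-! ### Correspondence between labelled runs and families of disjoint paths -/

namespace TropHorn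

/-! ### Runs and families of disjoint paths -/

section

variable {n k : ℕ} {N : Fin k → PlanarNetwork n}

theorem isPath_append {v v' v'' : CompVertex N} {es es' : List (CompEdge N)}
    (h : IsPath N v es v') (h' : IsPath N v' es' v'') : IsPath N v (es ++ es') v'' := by
  induction es generalizing v with
  | nil => cases h; exact h'
  | cons e es ih => exact ⟨h.1, ih h.2⟩

theorem IsPath.mem {v v' : CompVertex N} {es : List (CompEdge N)} (h : IsPath N v es v') :
    v' ∈ v :: es.map (compTgt N) := by
  induction es generalizing v with
  | nil => cases h; simp
  | cons e es ih =>
    rw [List.map_cons]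
    exact List.mem_cons_of_mem _ (ih h.2)

/-- The vertices of a path. -/
def pathVerts (N : Fin k → PlanarNetwork n) (v : CompVertex N) (es : List (CompEdge N)) :
    List (CompVertex N) := v :: es.map (compTgt N)

theorem mem_pathVerts_append {v v' z : CompVertex N} {es es' : List (CompEdge N)}
    (h : IsPath N v es v') :
    z ∈ pathVerts N v (es ++ es') ↔ z ∈ pathVerts N v es ∨ z ∈ pathVerts N v' es' := by
  have := h.mem
  simp only [pathVerts, List.map_append, List.mem_cons, List.mem_append] at this ⊢
  constructor
  · rintro (h | h | h) <;> simp [h]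
  · rintro ((h | h) | (h | h))
    · simp [h]
    · simp [h]
    · subst h
      rcases this with h | h <;> simp [h]
    · simp [h]

/-- How an operation acts in a concatenation of networks. Before (after) it, a particle at the
position `y` is at the vertex `v` if `At y v` (`At' y v`), and only vertices in `U` (in `U'`) can
still be reached by moving particles. -/
structure Sound (o : Op (CompEdge N)) (At At' : Pos → CompVertex N → Prop)
    (U U' : Set (CompVertex N)) : Prop where
  inj : ∀ y y' v, At y v → At y' v → y = y'
  subset : U' ⊆ U
  other : ∀ y v, y ≠ o.src → y ≠ o.tgt → At y v → At' y v
  src_notMem : ∀ v, At o.src v → v ∉ U'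
  tgt_notMem : ∀ v, At o.tgt v → v ∉ U'
  tgt_line : ∀ v, At o.tgt v → ∃ l, o.tgt = .inl l
  stay : ∀ v, At o.src v → ∃ v' ∈ U', At' o.src v' ∧ IsPath N v o.stay v' ∧
    ∀ z ∈ o.stay.map (compTgt N), z = v'
  rest : ∀ v, At o.tgt v → ∃ v' ∈ U', At' o.tgt v' ∧ IsPath N v o.rest v' ∧
    ∀ z ∈ o.rest.map (compTgt N), z = v'
  move : ∀ v, At o.src v → ∃ v', At' o.tgt v' ∧ IsPath N v o.move v' ∧
    (∀ z ∈ o.move.map (compTgt N), z ∈ U) ∧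
    ∀ z ∈ pathVerts N v o.move, z = v' ∨
      z ∉ U' ∧ ∀ y w, y ≠ o.src → y ≠ o.tgt → At y w → w ≠ z
  split_src : ∀ v R t, At o.src v → IsPath N v R (.inl t) →
    (∃ R' v', R = o.stay ++ R' ∧ At' o.src v' ∧ IsPath N v o.stay v' ∧ IsPath N v' R' (.inl t)) ∨
    ∃ R' v', R = o.move ++ R' ∧ At' o.tgt v' ∧ IsPath N v o.move v' ∧ IsPath N v' R' (.inl t) ∧
      (∀ q, o.tgt = .inr q → R' = []) ∧ ∀ w, At o.tgt w → w ∈ pathVerts N v o.move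
  split_tgt : ∀ v R t, At o.tgt v → IsPath N v R (.inl t) →
    ∃ R' v', R = o.rest ++ R' ∧ At' o.tgt v' ∧ IsPath N v o.rest v' ∧ IsPath N v' R' (.inl t)

/-- The operations of the list act as described by `Sound`, the final positions corresponding to
the vertices given by `F`. -/
inductive Drawn (F : Pos → CompVertex N → Prop) :
    List (Op (CompEdge N)) → (Pos → CompVertex N → Prop) → Set (CompVertex N) → Prop
  | nil {At : Pos → CompVertex N → Prop} {U : Set (CompVertex N)}
      (inj : ∀ y y' v, At y v → At y' v → y = y') (final : ∀ y v, At y v → F y v)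
      (stuck : ∀ l v R t, At (.inl l) v → IsPath N v R (.inl t) → R = []) : Drawn F [] At U
  | cons {At At' : Pos → CompVertex N → Prop} {U U' : Set (CompVertex N)}
      {o : Op (CompEdge N)} {ops : List (Op (CompEdge N))} (h : Sound o At At' U U')
      (h' : Drawn F ops At' U') : Drawn F (o :: ops) At U

/-- Weakening of the initial state, which joins the state after one stage of the network to the
state before the next. -/
theorem Sound.mono {o : Op (CompEdge N)} {At At' At₂ : Pos → CompVertex N → Prop}
    {U U' U₂ : Set (CompVertex N)} (h : Sound o At At' U U') (hAt : ∀ y v, At₂ y v → At y v)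
    (hU : U ⊆ U₂) : Sound o At₂ At' U₂ U' where
  inj y y' v h1 h2 := h.inj y y' v (hAt _ _ h1) (hAt _ _ h2)
  subset := h.subset.trans hU
  other y v h1 h2 h3 := h.other y v h1 h2 (hAt _ _ h3)
  src_notMem v h1 := h.src_notMem v (hAt _ _ h1)
  tgt_notMem v h1 := h.tgt_notMem v (hAt _ _ h1)
  tgt_line v h1 := h.tgt_line v (hAt _ _ h1)
  stay v h1 := h.stay v (hAt _ _ h1)
  rest v h1 := h.rest v (hAt _ _ h1)
  move v h1 := by
    obtain ⟨v', h2, h3, h4, h5⟩ := h.move v (hAt _ _ h1)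
    refine ⟨v', h2, h3, fun z hz => hU (h4 z hz), fun z hz => ?_⟩
    rcases h5 z hz with h6 | ⟨h6, h7⟩
    · exact Or.inl h6
    · exact Or.inr ⟨h6, fun y w hy hy' hw => h7 y w hy hy' (hAt _ _ hw)⟩
  split_src v R t h1 h2 := by
    rcases h.split_src v R t (hAt _ _ h1) h2 with h3 | ⟨R', v', h3, h4, h5, h6, h7, h8⟩
    · exact Or.inl h3
    · exact Or.inr ⟨R', v', h3, h4, h5, h6, h7, fun w hw => h8 w (hAt _ _ hw)⟩
  split_tgt v R t h1 h2 := h.split_tgt v R t (hAt _ _ h1) h2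

theorem Drawn.mono {F : Pos → CompVertex N → Prop} {ops : List (Op (CompEdge N))}
    {At At₂ : Pos → CompVertex N → Prop} {U U₂ : Set (CompVertex N)} (h : Drawn F ops At U)
    (hAt : ∀ y v, At₂ y v → At y v) (hU : U ⊆ U₂) : Drawn F ops At₂ U₂ := by
  cases h with
  | nil inj final stuck =>
    exact .nil (fun y y' v h1 h2 => inj y y' v (hAt _ _ h1) (hAt _ _ h2))
      (fun y v h => final y v (hAt _ _ h)) fun l v R t h1 h2 => stuck l v R t (hAt _ _ h1) h2
  | cons h h' => exact .cons (h.mono hAt hU) h'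

variable {ι : Type}

/-- Disjointness comes from a sweep through the drawing: the vertices passed later lie in `U'`, and
the vertices left behind by the current operation do not. -/
theorem Drawn.paths {F : Pos → CompVertex N → Prop} {ops : List (Op (CompEdge N))}
    {At : Pos → CompVertex N → Prop} {U : Set (CompVertex N)} (h : Drawn F ops At U)
    {ρ ρ' : ι → Pos} {R : ι → List (CompEdge N)} (hr : LRun ops ρ ρ' R)
    (hρ : Function.Injective ρ) (v : ι → CompVertex N) (hv : ∀ x, At (ρ x) (v x)) :
    (∃ v' : ι → CompVertex N, ∀ x, F (ρ' x) (v' x) ∧ IsPath N (v x) (R x) (v' x)) ∧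
      (∀ x, ∀ z ∈ (R x).map (compTgt N), z ∈ U) ∧
      ∀ x y, x ≠ y → List.Disjoint (pathVerts N (v x) (R x)) (pathVerts N (v y) (R y)) := by
  induction h generalizing ρ R v with
  | nil inj final stuck =>
    cases hr
    refine ⟨⟨v, fun x => ⟨final _ _ (hv x), rfl⟩⟩, by simp, fun x y hxy => ?_⟩
    simp only [pathVerts, List.map_nil, List.disjoint_singleton, List.mem_singleton]
    exact fun h' => hxy (hρ (inj _ _ _ (hv x) (h' ▸ hv y)))
  | @cons At At' U U' o ops h _ ih =>
    cases hr with
    | @stay _ _ _ _ R hr =>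
      have hstep : ∀ x, ∃ v', At' (ρ x) v' ∧ IsPath N (v x) (o.keep (ρ x)) v' ∧
          (∀ z ∈ (o.keep (ρ x)).map (compTgt N), z = v' ∧ z ∈ U') ∧
          ((ρ x ≠ o.src ∧ ρ x ≠ o.tgt ∧ v' = v x) ∨ (v' ∈ U' ∧ v x ∉ U')) := by
        intro x
        have hx := hv x
        rw [Op.keep]
        split_ifs with h1 h2
        · rw [h1] at hx ⊢
          obtain ⟨v', a1, a2, a3, a4⟩ := h.stay _ hx
          exact ⟨v', a2, a3, fun z hz => ⟨a4 z hz, (a4 z hz) ▸ a1⟩,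
            Or.inr ⟨a1, h.src_notMem _ hx⟩⟩
        · rw [h2] at hx ⊢
          obtain ⟨v', a1, a2, a3, a4⟩ := h.rest _ hx
          exact ⟨v', a2, a3, fun z hz => ⟨a4 z hz, (a4 z hz) ▸ a1⟩,
            Or.inr ⟨a1, h.tgt_notMem _ hx⟩⟩
        · exact ⟨v x, h.other _ _ h1 h2 hx, rfl, by simp, Or.inl ⟨h1, h2, rfl⟩⟩
      choose v₁ b1 b2 b3 b4 using hstep
      obtain ⟨⟨v', c1⟩, c2, c3⟩ := ih hr hρ v₁ b1
      refine ⟨⟨v', fun x => ⟨(c1 x).1, isPath_append (b2 x) (c1 x).2⟩⟩, ?_, ?_⟩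
      · intro x z hz
        rw [List.map_append, List.mem_append] at hz
        rcases hz with hz | hz
        · exact h.subset (b3 x z hz).2
        · exact h.subset (c2 x z hz)
      · have hmem : ∀ x z, z ∈ pathVerts N (v x) (o.keep (ρ x) ++ R x) →
            z ∈ pathVerts N (v₁ x) (R x) ∨ (z = v x ∧ v x ∉ U') := by
          intro x z hz
          rw [mem_pathVerts_append (b2 x)] at hz
          rcases hz with hz | hz
          · rw [pathVerts, List.mem_cons] at hz
            rcases hz with rfl | hz
            · rcases b4 x with ⟨-, -, h4⟩ | ⟨-, h4⟩
              · left; rw [← h4]; simp [pathVerts]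
              · exact Or.inr ⟨rfl, h4⟩
            · left; rw [(b3 x z hz).1]; simp [pathVerts]
          · exact Or.inl hz
        -- A vertex outside `U'` cannot be met later on, and at present it carries one particle
        -- only, by `h.inj`.
        have hcross : ∀ x y, x ≠ y → v x ∉ U' → v x ∉ pathVerts N (v₁ y) (R y) := by
          intro x y hxy hx hmem
          rw [pathVerts, List.mem_cons] at hmem
          rcases hmem with h' | h'
          · rcases b4 y with ⟨-, -, h4⟩ | ⟨h4, -⟩
            · rw [h4] at h'
              exact hxy (hρ (h.inj _ _ _ (hv x) (h' ▸ hv y)))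
            · exact hx (h' ▸ h4)
          · exact hx (c2 y _ h')
        intro x y hxy z hz hz'
        rcases hmem x z hz with hz | ⟨hz, hx⟩ <;> rcases hmem y z hz' with hz' | ⟨hz', hy⟩
        · exact c3 x y hxy hz hz'
        · exact hcross y x hxy.symm hy (hz' ▸ hz)
        · exact hcross x y hxy hx (hz ▸ hz')
        · exact hxy (hρ (h.inj _ _ _ (hv x) (hz.symm.trans hz' ▸ hv y)))
    | @move _ _ _ _ R h₁ h₂ hr =>
      obtain ⟨x₀, hx₀⟩ := h₁
      have hne : ∀ x, x ≠ x₀ → ρ x ≠ o.src := fun x hx h => hx (hρ (h.trans hx₀.symm))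
      obtain ⟨v₀, d1, d2, d3, d4⟩ := h.move (v x₀) (hx₀ ▸ hv x₀)
      classical
      have b1 : ∀ x, At' ((o.shift ∘ ρ) x) (if x = x₀ then v₀ else v x) := by
        intro x
        split_ifs with hx
        · simpa [Op.shift, hx, hx₀] using d1
        · simpa [Op.shift, hne x hx] using h.other _ _ (hne x hx) (h₂ x) (hv x)
      have b2 : ∀ x, IsPath N (v x) (o.go (ρ x)) (if x = x₀ then v₀ else v x) := by
        intro x
        split_ifs with hx
        · subst hx; simpa [Op.go, hx₀] using d2
        · rw [Op.go, if_neg (hne x hx)]; exact rfl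
      obtain ⟨⟨v', c1⟩, c2, c3⟩ := ih hr (shift_injective o hρ h₂) _ b1
      refine ⟨⟨v', fun x => ⟨(c1 x).1, isPath_append (b2 x) (c1 x).2⟩⟩, ?_, ?_⟩
      · intro x z hz
        rw [List.map_append, List.mem_append] at hz
        rcases hz with hz | hz
        · rw [Op.go] at hz
          split_ifs at hz with hx
          · exact d3 z hz
          · simp at hz
        · exact h.subset (c2 x z hz)
      · have hother : ∀ x, x ≠ x₀ → ∀ z, z ∈ pathVerts N (v x) (o.go (ρ x) ++ R x) →
            z ∈ pathVerts N (if x = x₀ then v₀ else v x) (R x) := by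
          intro x hx z hz
          rw [Op.go, if_neg (hne x hx)] at hz
          rw [if_neg hx]
          exact hz
        -- Vertices on the moving particle's way, other than its new place, are neither occupied by
        -- a bystander nor reachable later.
        have hx₀' : ∀ y, y ≠ x₀ → ∀ z, z ∈ pathVerts N (v x₀) (o.go (ρ x₀) ++ R x₀) →
            z ∈ pathVerts N (if y = x₀ then v₀ else v y) (R y) → False := by
          intro y hy z hz hzy
          rw [mem_pathVerts_append (b2 x₀), if_pos rfl] at hz
          have key := c3 x₀ y hy.symm
          rw [if_pos rfl] at key
          rcases hz with hz | hz
          · rw [Op.go, if_pos hx₀] at hz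
            rcases d4 z hz with rfl | ⟨h3, h4⟩
            · exact key (by simp [pathVerts]) hzy
            · rw [pathVerts, List.mem_cons, if_neg hy] at hzy
              rcases hzy with rfl | hzy
              · exact h4 _ _ (hne y hy) (h₂ y) (hv y) rfl
              · exact h3 (c2 y z hzy)
          · exact key hz hzy
        intro x y hxy z hz hz'
        by_cases hx : x = x₀
        · subst hx
          exact hx₀' y hxy.symm z hz (hother y hxy.symm z hz')
        · by_cases hy : y = x₀
          · subst hy
            exact hx₀' x hx z hz' (hother x hx z hz)
          · exact c3 x y hxy (hother x hx z hz) (hother y hy z hz')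

/-- Conversely, a family of disjoint paths is consumed operation by operation: the operation is
performed as a move if some path begins with the edges `o.move`, and as a stay otherwise. -/
theorem Drawn.lRun {F : Pos → CompVertex N → Prop} {ops : List (Op (CompEdge N))}
    {At : Pos → CompVertex N → Prop} {U : Set (CompVertex N)} (h : Drawn F ops At U)
    {ρ : ι → Pos} {R : ι → List (CompEdge N)} (hρ : Function.Injective ρ)
    (v : ι → CompVertex N) (hv : ∀ x, At (ρ x) (v x)) (t : ι → Fin (k + 1) × Fin n)
    (hp : ∀ x, IsPath N (v x) (R x) (.inl (t x))) (hst : ∀ x q, ρ x = .inr q → R x = [])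
    (hd : ∀ x y, x ≠ y → List.Disjoint (pathVerts N (v x) (R x)) (pathVerts N (v y) (R y))) :
    ∃ ρ', LRun ops ρ ρ' R ∧ ∀ x, F (ρ' x) (.inl (t x)) := by
  induction h generalizing ρ R v with
  | nil inj final stuck =>
    have hR : R = fun _ => [] := by
      funext x
      rcases hx : ρ x with l | q
      · exact stuck l (v x) (R x) (t x) (hx ▸ hv x) (hp x)
      · exact hst x q hx
    subst hR
    refine ⟨ρ, .nil ρ, fun x => ?_⟩
    have : v x = .inl (t x) := hp x
    exact this ▸ final _ _ (hv x)
  | @cons At At' U U' o ops h _ ih =>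
    have hsub : ∀ x (es R' : List (CompEdge N)) v', R x = es ++ R' → IsPath N (v x) es v' →
        ∀ z ∈ pathVerts N v' R', z ∈ pathVerts N (v x) (R x) := by
      intro x es R' v' hR hes z hz
      rw [hR, mem_pathVerts_append hes]
      exact Or.inr hz
    have htgt : ∀ x, ρ x = o.tgt → ∃ R' v', R x = o.rest ++ R' ∧ At' o.tgt v' ∧
        IsPath N (v x) o.rest v' ∧ IsPath N v' R' (.inl (t x)) :=
      fun x hx => h.split_tgt _ _ _ (hx ▸ hv x) (hp x)
    by_cases hmove : ∃ x₀ R₀ v₀, ρ x₀ = o.src ∧ R x₀ = o.move ++ R₀ ∧ At' o.tgt v₀ ∧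
        IsPath N (v x₀) o.move v₀ ∧ IsPath N v₀ R₀ (.inl (t x₀)) ∧
        (∀ q, o.tgt = .inr q → R₀ = []) ∧ ∀ w, At o.tgt w → w ∈ pathVerts N (v x₀) o.move
    · obtain ⟨x₀, R₀, v₀, e1, e2, e3, e4, e5, e6, e7⟩ := hmove
      have hne : ∀ x, x ≠ x₀ → ρ x ≠ o.src := fun x hx h => hx (hρ (h.trans e1.symm))
      -- The moving path contains the vertex of the position `tgt`, so a particle standing there
      -- would violate disjointness. The move is therefore legal.
      have hfree : ∀ x, ρ x ≠ o.tgt := by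
        intro x hx
        have hxx : x ≠ x₀ := by
          rintro rfl
          exact o.ne (e1.symm.trans hx)
        refine hd x x₀ hxx (a := v x) (by simp [pathVerts]) ?_
        rw [e2, mem_pathVerts_append e4]
        exact Or.inl (e7 _ (hx ▸ hv x))
      classical
      set R' : ι → List (CompEdge N) := fun x => if x = x₀ then R₀ else R x with hR'
      have hRR : R = fun x => o.go (ρ x) ++ R' x := by
        funext x
        by_cases hx : x = x₀
        · subst hx; simp [hR', Op.go, e1, e2]
        · simp [hR', Op.go, hne x hx, hx]
      obtain ⟨ρ', i1, i2⟩ := ih (ρ := o.shift ∘ ρ) (R := R') (shift_injective o hρ hfree)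
        (fun x => if x = x₀ then v₀ else v x) (by
          intro x
          by_cases hx : x = x₀
          · subst hx; simpa [Op.shift, e1] using e3
          · simpa [hx, Op.shift, hne x hx] using h.other _ _ (hne x hx) (hfree x) (hv x)) (by
          intro x
          by_cases hx : x = x₀
          · subst hx; simpa [hR'] using e5
          · simpa [hR', hx] using hp x) (by
          intro x q hq
          by_cases hx : x = x₀
          · subst hx
            simp only [Function.comp, Op.shift, e1, if_true] at hq
            simpa [hR'] using e6 q hq
          · simp only [Function.comp, Op.shift, hne x hx, if_false] at hq
            simpa [hR', hx] using hst x q hq) (by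
          have hs : ∀ x, ∀ z ∈ pathVerts N (if x = x₀ then v₀ else v x) (R' x),
              z ∈ pathVerts N (v x) (R x) := by
            intro x z hz
            by_cases hx : x = x₀
            · subst hx
              exact hsub x _ _ _ e2 e4 z (by simpa [hR'] using hz)
            · simpa [hR', hx] using hz
          exact fun x y hxy z hz hz' => hd x y hxy (hs x z hz) (hs y z hz'))
      refine ⟨ρ', ?_, i2⟩
      rw [hRR]
      exact .move ⟨x₀, e1⟩ hfree i1
    · have hstep : ∀ x, ∃ R' v', R x = o.keep (ρ x) ++ R' ∧ At' (ρ x) v' ∧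
          IsPath N (v x) (o.keep (ρ x)) v' ∧ IsPath N v' R' (.inl (t x)) := by
        intro x
        rw [Op.keep]
        split_ifs with h1 h2
        · rw [h1]
          rcases h.split_src _ _ _ (h1 ▸ hv x) (hp x) with h3 | ⟨R', v', h3⟩
          · exact h3
          · exact absurd ⟨x, R', v', h1, h3⟩ hmove
        · rw [h2]; exact htgt x h2
        · exact ⟨R x, v x, rfl, h.other _ _ h1 h2 (hv x), rfl, hp x⟩
      choose R' v' f1 f2 f3 f4 using hstep
      obtain ⟨ρ', i1, i2⟩ := ih (R := R') hρ v' f2 f4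
        (fun x q hq => by
          have := hst x q hq
          rw [f1 x, List.append_eq_nil_iff] at this
          exact this.2)
        (fun x y hxy z hz hz' => hd x y hxy (hsub x _ _ _ (f1 x) (f3 x) z hz)
          (hsub y _ _ _ (f1 y) (f3 y) z hz'))
      refine ⟨ρ', ?_, i2⟩
      have : R = fun x => o.keep (ρ x) ++ R' x := funext f1
      rw [this]
      exact .stay i1

end

end TropHorn

/-! ### The standard network, swept by its slanted edges -/

namespace TropHorn

/-! ### The standard network as a net -/

/-- The slanted edges `(m, I), (m - 1, I), …, (I + 1, I)`. -/
def diagSlants (n I : ℕ) : ℕ → List (StdSlant n)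
  | 0 => []
  | m + 1 =>
    if h : I < m + 1 ∧ m + 1 < n then ⟨⟨m + 1, h.2⟩, ⟨I, h.1⟩⟩ :: diagSlants n I m
    else diagSlants n I m

/-- The slanted edges `(L, J)` with `I ≤ J < I + f`, in an order compatible with the network. -/
def sweepSlants (n : ℕ) : ℕ → ℕ → List (StdSlant n)
  | 0, _ => []
  | f + 1, I => diagSlants n I (n - 1) ++ sweepSlants n f (I + 1)

/-- The slanted edges of the standard network, in an order compatible with the network. -/
def netSlants (n : ℕ) : List (StdSlant n) := sweepSlants n n 0

/-- The first vertex on the line `l` that belongs to one of the given slanted edges. -/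
def front {n : ℕ} : List (StdSlant n) → Fin n → NetVertex n (StdInner n)
  | [], l => .sink l
  | s :: r, l =>
    if (l : ℕ) = s.1 then .inner (.left s) else if (l : ℕ) + 1 = s.1 then .inner (.right s)
    else front r l

theorem front_cases {n : ℕ} (r : List (StdSlant n)) (l : Fin n) :
    front r l = .sink l ∨ ∃ s ∈ r, (front r l = .inner (.left s) ∧ (l : ℕ) = s.1) ∨
      (front r l = .inner (.right s) ∧ (l : ℕ) + 1 = s.1) := by
  induction r with
  | nil => exact Or.inl rfl
  | cons s r ih =>
    rw [front]
    split_ifs with h1 h2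
    · exact Or.inr ⟨s, by simp, Or.inl ⟨rfl, h1⟩⟩
    · exact Or.inr ⟨s, by simp, Or.inr ⟨rfl, h2⟩⟩
    · rcases ih with h | ⟨s', hs', h⟩
      · exact Or.inl h
      · exact Or.inr ⟨s', by simp [hs'], h⟩

theorem stdY_front {n : ℕ} (r : List (StdSlant n)) (l : Fin n) :
    stdY n (front r l) = (l : ℕ) + 1 := by
  rcases front_cases r l with h | ⟨s, -, ⟨h, h'⟩ | ⟨h, h'⟩⟩ <;> rw [h] <;> simp only [stdY]
  · rw [h']
  · exact_mod_cast h'.symm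

theorem front_injective {n : ℕ} (r : List (StdSlant n)) : Function.Injective (front r) := by
  intro l l' h
  have := congrArg (stdY n) h
  rw [stdY_front, stdY_front] at this
  exact Fin.ext (by omega)

theorem front_diagSlants {n I : ℕ} (m : ℕ) (hm : m < n) (r : List (StdSlant n)) (l : Fin n) :
    front (diagSlants n I m ++ r) l =
      if h : I < l ∧ (l : ℕ) = m then .inner (.left ⟨l, ⟨I, h.1⟩⟩)
      else if h : I ≤ l ∧ (l : ℕ) < m then
        .inner (.right ⟨⟨l + 1, by omega⟩, ⟨I, Nat.lt_succ_of_le h.1⟩⟩)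
      else front r l := by
  induction m with
  | zero =>
    rw [dif_neg (by omega), dif_neg (by omega)]
    rfl
  | succ m ih =>
    rw [diagSlants]
    obtain ⟨l, hl⟩ := l
    by_cases h1 : I < m + 1 ∧ m + 1 < n
    · rw [dif_pos h1, List.cons_append, front]
      simp only
      by_cases h2 : l = m + 1
      · subst h2
        rw [if_pos rfl, dif_pos ⟨h1.1, rfl⟩]
      · rw [if_neg h2, dif_neg (by omega)]
        by_cases h3 : l = m
        · subst h3
          rw [if_pos rfl, dif_pos (by omega)]
        · rw [if_neg (by omega), ih (by omega)]
          simp only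
          split_ifs <;> first | rfl | omega
    · rw [dif_neg h1, ih (by omega)]
      simp only
      split_ifs <;> first | rfl | omega

/-- With the diagonals from `I` on still to be passed, the next vertex on a line is an end of a
slant of diagonal `I`, or the sink. This closed form reduces `Sorted` to a case by case comparison
with `stdTgt`. -/
theorem front_sweepSlants {n : ℕ} (f I : ℕ) (hf : n ≤ I + f) (l : Fin n) :
    front (sweepSlants n f I) l =
      if h : I ≤ l ∧ (l : ℕ) + 1 < n then
        .inner (.right ⟨⟨l + 1, h.2⟩, ⟨I, Nat.lt_succ_of_le h.1⟩⟩)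
      else if h : I < l then .inner (.left ⟨l, ⟨I, h⟩⟩)
      else .sink l := by
  induction f generalizing I with
  | zero =>
    have := l.2
    rw [dif_neg (by omega), dif_neg (by omega)]
    rfl
  | succ f ih =>
    have := l.2
    rw [sweepSlants, front_diagSlants _ (by omega), ih (I + 1) (by omega)]
    split_ifs <;> first | rfl | omega

/-- The slanted edges are listed in an order compatible with the network. -/
def Sorted {n : ℕ} : List (StdSlant n) → Prop
  | [] => True
  | s :: r => (s ∉ r ∧ stdTgt n (.fromLeft s) = front r s.1 ∧
      stdTgt n (.fromRight s) =
        front r ⟨(s.1 : ℕ) - 1, lt_of_le_of_lt (Nat.sub_le _ _) s.1.isLt⟩) ∧ Sorted r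

theorem mem_diagSlants {n I m : ℕ} {s : StdSlant n} (h : s ∈ diagSlants n I m) :
    (s.2 : ℕ) = I ∧ (s.1 : ℕ) ≤ m := by
  induction m with
  | zero => simp [diagSlants] at h
  | succ m ih =>
    rw [diagSlants] at h
    split_ifs at h with h1
    · rcases List.mem_cons.1 h with rfl | h
      · simp
      · exact ⟨(ih h).1, (ih h).2.trans (Nat.le_succ m)⟩
    · exact ⟨(ih h).1, (ih h).2.trans (Nat.le_succ m)⟩

theorem mem_sweepSlants {n f I : ℕ} {s : StdSlant n} (h : s ∈ sweepSlants n f I) :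
    I ≤ (s.2 : ℕ) := by
  induction f generalizing I with
  | zero => simp [sweepSlants] at h
  | succ f ih =>
    rw [sweepSlants, List.mem_append] at h
    rcases h with h | h
    · exact (mem_diagSlants h).1.ge
    · exact (Nat.le_succ I).trans (ih h)

theorem sorted_diagSlants {n f I : ℕ} (hf : n ≤ I + 1 + f) (m : ℕ) (hm : m < n)
    (h : Sorted (sweepSlants n f (I + 1))) :
    Sorted (diagSlants n I m ++ sweepSlants n f (I + 1)) := by
  induction m with
  | zero => exact h
  | succ m ih =>
    rw [diagSlants]
    split_ifs with h1
    · rw [List.cons_append]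
      refine ⟨⟨?_, ?_, ?_⟩, ih (by omega)⟩
      · rw [List.mem_append]
        rintro (h2 | h2)
        · have := (mem_diagSlants h2).2
          simp at this
        · have := mem_sweepSlants h2
          simp at this
      · rw [front_diagSlants _ (by omega), dif_neg (by simp), dif_neg (by simp),
          front_sweepSlants _ _ hf, stdTgt]
        simp only
        split_ifs <;> first | rfl | omega
      · rw [front_diagSlants _ (by omega), front_sweepSlants _ _ hf, stdTgt]
        simp only [Nat.add_sub_cancel, and_true]
        split_ifs <;> first | rfl | omega
    · exact ih (by omega)

theorem sorted_sweepSlants {n : ℕ} (f I : ℕ) (hf : n ≤ I + f) : Sorted (sweepSlants n f I) := by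
  induction f generalizing I with
  | zero => trivial
  | succ f ih =>
    rw [sweepSlants]
    rcases Nat.eq_zero_or_pos n with rfl | hn
    · simpa [diagSlants] using ih (I + 1) (by omega)
    · exact sorted_diagSlants (by omega) _ (by omega) (ih (I + 1) (by omega))

theorem sorted_netSlants (n : ℕ) : Sorted (netSlants n) := sorted_sweepSlants n 0 (by omega)

theorem front_netSlants {n : ℕ} (l : Fin n) :
    front (netSlants n) l = stdTgt n (.fromSource l) := by
  rw [netSlants, front_sweepSlants _ _ (by omega), stdTgt]
  split_ifs <;> first | rfl | omega

/-! ### Concatenations of standard networks -/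

/-- `k` copies of the standard network. -/
noncomputable abbrev stdNets (n k : ℕ) : Fin k → PlanarNetwork n := fun _ => stdNetwork n

variable {n k : ℕ}

/-- Edges of the concatenation of standard networks. -/
noncomputable def stdE (j : Fin k) (e : StdEdge n) : CompEdge (stdNets n k) := ⟨j, e⟩

/-- Vertices of the concatenation of standard networks. -/
noncomputable def stdV (j : Fin k) (v : NetVertex n (StdInner n)) : CompVertex (stdNets n k) :=
  glue (stdNets n k) j v

/-- The `l`-th point of the `q`-th vertical. -/
noncomputable def vertPt (q : Fin (k + 1)) (l : Fin n) : CompVertex (stdNets n k) := .inl (q, l)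

theorem compTgt_stdE (j : Fin k) (e : StdEdge n) :
    compTgt (stdNets n k) (stdE j e) = stdV j (stdTgt n e) := rfl

theorem vertPt_inj {q q' : Fin (k + 1)} {l l' : Fin n} :
    vertPt q l = vertPt q' l' ↔ q = q' ∧ l = l' := by
  simp [vertPt]

theorem stdV_sink (j : Fin k) (l : Fin n) : stdV j (.sink l) = vertPt j.succ l := rfl

/-- The network and inner vertex of a vertex of the concatenation. -/
def innerOf : CompVertex (stdNets n k) → Option (Fin k × StdInner n)
  | .inl _ => none
  | .inr v => some (v.1, v.2)

theorem stdV_inner_inj {j j' : Fin k} {i i' : StdInner n} :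
    stdV j (.inner i) = stdV j' (.inner i') ↔ j = j' ∧ i = i' := by
  constructor
  · intro h
    have := congrArg innerOf h
    simpa [innerOf, stdV, glue] using this
  · rintro ⟨rfl, rfl⟩; rfl

theorem stdV_inner_ne {j : Fin k} {i : StdInner n} {q : Fin (k + 1)} {l : Fin n} :
    stdV j (.inner i) ≠ vertPt q l := fun h => by
  have := congrArg innerOf h
  simp [innerOf, stdV, glue, vertPt] at this

theorem stdV_front_ne {j : Fin k} {r : List (StdSlant n)} {l l' : Fin n} {q : Fin (k + 1)}
    (hq : q ≤ j.castSucc) : stdV j (front r l) ≠ vertPt q l' := by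
  intro h
  rcases front_cases r l with h' | ⟨s, -, ⟨h', -⟩ | ⟨h', -⟩⟩ <;> rw [h'] at h
  · rw [stdV_sink, vertPt_inj] at h
    rw [← h.1] at hq
    exact absurd (Fin.castSucc_lt_succ (i := j)) hq.not_gt
  · exact stdV_inner_ne h
  · exact stdV_inner_ne h

theorem stdV_front_injective (j : Fin k) (r : List (StdSlant n)) {l l' : Fin n}
    (h : stdV j (front r l) = stdV j (front r l')) : l = l' := by
  apply front_injective r
  rcases front_cases r l with h1 | ⟨s, -, ⟨h1, -⟩ | ⟨h1, -⟩⟩ <;>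
    rcases front_cases r l' with h2 | ⟨s', -, ⟨h2, -⟩ | ⟨h2, -⟩⟩ <;> rw [h1, h2] at h ⊢ <;> first
      | (rw [stdV_inner_inj] at h; rw [h.2])
      | (rw [stdV_sink, stdV_sink, vertPt_inj] at h; rw [h.2])
      | exact absurd h stdV_inner_ne
      | exact absurd h.symm stdV_inner_ne

theorem eq_of_src_left {e : CompEdge (stdNets n k)} {j : Fin k} {s : StdSlant n}
    (h : compSrc (stdNets n k) e = stdV j (.inner (.left s))) :
    e = stdE j (.slant s) ∨ e = stdE j (.fromLeft s) := by
  obtain ⟨j', e⟩ := e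
  change stdV j' (stdSrc n e) = _ at h
  change StdEdge n at e
  rcases e with s' | l | s' | s'
  · obtain ⟨rfl, h⟩ := stdV_inner_inj.1 h
    cases h
    exact Or.inl rfl
  · exact absurd h.symm stdV_inner_ne
  · obtain ⟨rfl, h⟩ := stdV_inner_inj.1 h
    cases h
    exact Or.inr rfl
  · obtain ⟨rfl, h⟩ := stdV_inner_inj.1 h
    cases h

theorem eq_of_src_right {e : CompEdge (stdNets n k)} {j : Fin k} {s : StdSlant n}
    (h : compSrc (stdNets n k) e = stdV j (.inner (.right s))) : e = stdE j (.fromRight s) := by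
  obtain ⟨j', e⟩ := e
  change stdV j' (stdSrc n e) = _ at h
  change StdEdge n at e
  rcases e with s' | l | s' | s'
  · obtain ⟨rfl, h⟩ := stdV_inner_inj.1 h
    cases h
  · exact absurd h.symm stdV_inner_ne
  · obtain ⟨rfl, h⟩ := stdV_inner_inj.1 h
    cases h
  · obtain ⟨rfl, h⟩ := stdV_inner_inj.1 h
    cases h
    rfl

theorem eq_of_src_vertPt {e : CompEdge (stdNets n k)} {q : Fin (k + 1)} {l : Fin n}
    (h : compSrc (stdNets n k) e = vertPt q l) :
    ∃ j : Fin k, q = j.castSucc ∧ e = stdE j (.fromSource l) := by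
  obtain ⟨j', e⟩ := e
  change stdV j' (stdSrc n e) = _ at h
  change StdEdge n at e
  rcases e with s' | l | s' | s'
  · exact absurd h stdV_inner_ne
  · obtain ⟨rfl, rfl⟩ := vertPt_inj.1 h
    exact ⟨j', rfl, rfl⟩
  · exact absurd h stdV_inner_ne
  · exact absurd h stdV_inner_ne

/-- The operation of a slanted edge. -/
noncomputable def slantOp (j : Fin k) (s : StdSlant n) : Op (CompEdge (stdNets n k)) where
  src := .inl s.1
  tgt := .inl (s.1 - 1)
  ne := by
    have := s.2.isLt
    simp only [ne_eq, Sum.inl.injEq]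
    omega
  stay := [stdE j (.fromLeft s)]
  move := [stdE j (.slant s), stdE j (.fromRight s)]
  rest := [stdE j (.fromRight s)]

/-- The `j`-th standard network as a net. -/
noncomputable def stdNet (n : ℕ) {k : ℕ} (j : Fin k) : Net (CompEdge (stdNets n k)) where
  enter l := if h : l < n then [stdE j (.fromSource ⟨l, h⟩)] else []
  slants := (netSlants n).map (slantOp j)
  isSlant o ho := by
    obtain ⟨s, -, rfl⟩ := List.mem_map.1 ho
    have := s.2.isLt
    exact ⟨s.1 - 1, by simp only [slantOp, Sum.inl.injEq]; omega, rfl⟩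

/-- The concatenation of `k` standard networks as a system of nets. -/
noncomputable def stdSys (n k : ℕ) : List (Net (CompEdge (stdNets n k))) := (List.finRange k).map (stdNet n)

/-- Vertices and positions inside the `j`-th network, with the slanted edges in `r` still to be
passed. -/
def NetAt (j : Fin k) (r : List (StdSlant n)) (y : Pos) (v : CompVertex (stdNets n k)) : Prop :=
  (∃ l : Fin n, y = .inl l ∧ v = stdV j (front r l)) ∨
    ∃ (q : Fin (k + 1)) (l : Fin n), q ≤ j.castSucc ∧ y = .inr (q, l) ∧ v = vertPt q l

/-- The vertices still to be passed, apart from those of the `j`-th vertical. -/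
def NetRest (j : Fin k) (r : List (StdSlant n)) : Set (CompVertex (stdNets n k)) :=
  {v | (∃ s ∈ r, v = stdV j (.inner (.left s)) ∨ v = stdV j (.inner (.right s))) ∨
    (∃ (q : Fin (k + 1)) (l : Fin n), j.castSucc < q ∧ v = vertPt q l) ∨
    ∃ (j' : Fin k) (i : StdInner n), j < j' ∧ v = stdV j' (.inner i)}

/-- Vertices and positions at the `j`-th vertical, with the lines from `m` on still to be
passed. -/
def VertAt (j : Fin k) (m : ℕ) (y : Pos) (v : CompVertex (stdNets n k)) : Prop :=
  (∃ l : Fin n, y = .inl l ∧ (l : ℕ) < m ∧ v = stdV j (front (netSlants n) l)) ∨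
  (∃ l : Fin n, y = .inl l ∧ m ≤ (l : ℕ) ∧ v = vertPt j.castSucc l) ∨
    ∃ (q : Fin (k + 1)) (l : Fin n), (q < j.castSucc ∨ q = j.castSucc ∧ (l : ℕ) < m) ∧
      y = .inr (q, l) ∧ v = vertPt q l

/-- The vertices still to be passed at the `j`-th vertical. -/
def VertRest (j : Fin k) (m : ℕ) : Set (CompVertex (stdNets n k)) :=
  {v | (∃ l : Fin n, m ≤ (l : ℕ) ∧ v = vertPt j.castSucc l) ∨ v ∈ NetRest j (netSlants n)}

theorem stdV_front_mem (j : Fin k) (r : List (StdSlant n)) (l : Fin n) :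
    stdV j (front r l) ∈ NetRest j r := by
  rcases front_cases r l with h | ⟨s, hs, ⟨h, -⟩ | ⟨h, -⟩⟩ <;> rw [h]
  · exact Or.inr (Or.inl ⟨j.succ, l, Fin.castSucc_lt_succ, rfl⟩)
  · exact Or.inl ⟨s, hs, Or.inl rfl⟩
  · exact Or.inl ⟨s, hs, Or.inr rfl⟩

theorem left_notMem {j : Fin k} {r : List (StdSlant n)} {s : StdSlant n} (hs : s ∉ r) :
    stdV j (.inner (.left s)) ∉ NetRest j r := by
  rintro (⟨s', hs', h | h⟩ | ⟨q, l, -, h⟩ | ⟨j', i, hj, h⟩)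
  · cases (stdV_inner_inj.1 h).2; exact hs hs'
  · cases (stdV_inner_inj.1 h).2
  · exact stdV_inner_ne h
  · exact hj.ne (stdV_inner_inj.1 h).1

theorem right_notMem {j : Fin k} {r : List (StdSlant n)} {s : StdSlant n} (hs : s ∉ r) :
    stdV j (.inner (.right s)) ∉ NetRest j r := by
  rintro (⟨s', hs', h | h⟩ | ⟨q, l, -, h⟩ | ⟨j', i, hj, h⟩)
  · cases (stdV_inner_inj.1 h).2
  · cases (stdV_inner_inj.1 h).2; exact hs hs'
  · exact stdV_inner_ne h
  · exact hj.ne (stdV_inner_inj.1 h).1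

theorem vertPt_notMem {j : Fin k} {r : List (StdSlant n)} {q : Fin (k + 1)} {l : Fin n}
    (hq : q ≤ j.castSucc) : vertPt q l ∉ NetRest j r := by
  rintro (⟨s', hs', h | h⟩ | ⟨q', l, hq', h⟩ | ⟨j', i, hj, h⟩)
  · exact stdV_inner_ne h.symm
  · exact stdV_inner_ne h.symm
  · exact absurd (vertPt_inj.1 h).1 (hq.trans_lt hq').ne
  · exact stdV_inner_ne h.symm

theorem netAt_inl {j : Fin k} {r : List (StdSlant n)} {l : ℕ} {v : CompVertex (stdNets n k)}
    (h : NetAt j r (.inl l) v) : ∃ hl : l < n, v = stdV j (front r ⟨l, hl⟩) := by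
  rcases h with ⟨l', h, rfl⟩ | ⟨q, l', -, h, -⟩
  · cases h; exact ⟨l'.2, rfl⟩
  · cases h

/-- Before the slant, the next vertices on the two lines concerned are the two ends of `s`. After it
they are the right ends of the horizontal edges leaving `s`; this is what `Sorted` guarantees. -/
theorem sound_slantOp (j : Fin k) {s : StdSlant n} {r : List (StdSlant n)}
    (hs : Sorted (s :: r)) :
    Sound (slantOp j s) (NetAt j (s :: r)) (NetAt j r) (NetRest j (s :: r)) (NetRest j r) := by
  obtain ⟨⟨hsr, hl, hr⟩, -⟩ := hs
  have hpos := s.2.isLt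
  have hlt : (s.1 : ℕ) - 1 < n := lt_of_le_of_lt (Nat.sub_le _ _) s.1.isLt
  have hsrc : ∀ v, NetAt j (s :: r) (slantOp j s).src v → v = stdV j (.inner (.left s)) := by
    intro v hv
    obtain ⟨_, rfl⟩ := netAt_inl hv
    simp [front]
  have htgt : ∀ v, NetAt j (s :: r) (slantOp j s).tgt v → v = stdV j (.inner (.right s)) := by
    intro v hv
    obtain ⟨_, rfl⟩ := netAt_inl hv
    simp only [front]
    rw [if_neg (by omega), if_pos (by omega)]
  have hinj : ∀ y y' v, NetAt j (s :: r) y v → NetAt j (s :: r) y' v → y = y' := by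
    rintro y y' v (⟨l, rfl, rfl⟩ | ⟨q, l, hq, rfl, rfl⟩) (⟨l', rfl, h⟩ | ⟨q', l', hq', rfl, h⟩)
    · rw [stdV_front_injective j _ h]
    · exact absurd h (stdV_front_ne hq')
    · exact absurd h.symm (stdV_front_ne hq)
    · obtain ⟨rfl, rfl⟩ := vertPt_inj.1 h; rfl
  have hat : ∀ (l : ℕ) (h : l < n), NetAt j (s :: r) (.inl l) (stdV j (front (s :: r) ⟨l, h⟩)) :=
    fun l h => Or.inl ⟨⟨l, h⟩, rfl, rfl⟩
  have hatsrc : NetAt j (s :: r) (slantOp j s).src (stdV j (.inner (.left s))) := by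
    have := hat s.1 s.1.isLt
    simpa [front, slantOp] using this
  have hattgt : NetAt j (s :: r) (slantOp j s).tgt (stdV j (.inner (.right s))) := by
    have := hat (s.1 - 1) hlt
    rw [front] at this
    simp only at this
    rwa [if_neg (by omega), if_pos (by omega)] at this
  have hsrc' : NetAt j r (slantOp j s).src (stdV j (stdTgt n (.fromLeft s))) :=
    Or.inl ⟨s.1, rfl, by rw [hl]⟩
  have htgt' : NetAt j r (slantOp j s).tgt (stdV j (stdTgt n (.fromRight s))) :=
    Or.inl ⟨⟨s.1 - 1, hlt⟩, rfl, by rw [hr]⟩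
  have hpL : IsPath (stdNets n k) (stdV j (.inner (.left s))) (slantOp j s).stay
      (stdV j (stdTgt n (.fromLeft s))) := ⟨rfl, rfl⟩
  have hpR : IsPath (stdNets n k) (stdV j (.inner (.right s))) (slantOp j s).rest
      (stdV j (stdTgt n (.fromRight s))) := ⟨rfl, rfl⟩
  have hpM : IsPath (stdNets n k) (stdV j (.inner (.left s))) (slantOp j s).move
      (stdV j (stdTgt n (.fromRight s))) := ⟨rfl, rfl, rfl⟩
  have hsub : NetRest j r ⊆ NetRest j (s :: r) := by
    rintro v (⟨s', hs', h⟩ | h | h)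
    · exact Or.inl ⟨s', List.mem_cons_of_mem _ hs', h⟩
    · exact Or.inr (Or.inl h)
    · exact Or.inr (Or.inr h)
  have hmemL : stdV j (stdTgt n (.fromLeft s)) ∈ NetRest j r := by
    rw [hl]; exact stdV_front_mem j r _
  have hmemR : stdV j (stdTgt n (.fromRight s)) ∈ NetRest j r := by
    rw [hr]; exact stdV_front_mem j r _
  refine
    { inj := hinj
      subset := hsub
      other := ?_
      src_notMem := fun v hv => hsrc v hv ▸ left_notMem hsr
      tgt_notMem := fun v hv => htgt v hv ▸ right_notMem hsr
      tgt_line := fun v hv => ⟨_, rfl⟩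
      stay := ?_
      rest := ?_
      move := ?_
      split_src := ?_
      split_tgt := ?_ }
  · rintro y v h1 h2 (⟨l, rfl, rfl⟩ | h)
    · refine Or.inl ⟨l, rfl, ?_⟩
      have h1' : (l : ℕ) ≠ s.1 := fun h => h1 (by simp [slantOp, h])
      have h2' : (l : ℕ) + 1 ≠ s.1 := fun h => h2 (by simp [slantOp, ← h])
      rw [front, if_neg h1', if_neg h2']
    · exact Or.inr h
  · intro v hv
    rw [hsrc v hv]
    refine ⟨_, hmemL, hsrc', hpL, fun z hz => ?_⟩
    exact List.mem_singleton.1 hz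
  · intro v hv
    rw [htgt v hv]
    refine ⟨_, hmemR, htgt', hpR, fun z hz => ?_⟩
    exact List.mem_singleton.1 hz
  · intro v hv
    rw [hsrc v hv]
    refine ⟨_, htgt', hpM, fun z hz => ?_, fun z hz => ?_⟩
    · have hz' : z = stdV j (.inner (.right s)) ∨ z = stdV j (stdTgt n (.fromRight s)) := by
        simpa [slantOp, compTgt_stdE, stdTgt] using hz
      rcases hz' with rfl | rfl
      · exact Or.inl ⟨s, by simp, Or.inr rfl⟩
      · exact hsub hmemR
    · have hz' : z = stdV j (.inner (.left s)) ∨ z = stdV j (.inner (.right s)) ∨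
          z = stdV j (stdTgt n (.fromRight s)) := by
        simpa [slantOp, pathVerts, compTgt_stdE, stdTgt] using hz
      rcases hz' with rfl | rfl | rfl
      · exact Or.inr ⟨left_notMem hsr, fun y w hy _ hw h => hy (hinj _ _ _ hw (h ▸ hatsrc))⟩
      · exact Or.inr ⟨right_notMem hsr, fun y w _ hy hw h => hy (hinj _ _ _ hw (h ▸ hattgt))⟩
      · exact Or.inl rfl
  · intro v R t hv hR
    rw [hsrc v hv] at hR ⊢
    rcases R with _ | ⟨e, R⟩
    · exact absurd hR stdV_inner_ne
    · obtain ⟨he, hR⟩ := hR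
      rcases eq_of_src_left he with rfl | rfl
      · right
        rcases R with _ | ⟨e', R⟩
        · exact absurd hR stdV_inner_ne
        · obtain ⟨he', hR⟩ := hR
          obtain rfl := eq_of_src_right he'
          refine ⟨R, _, rfl, htgt', hpM, hR, fun q hq => by simp [slantOp] at hq,
            fun w hw => ?_⟩
          rw [htgt w hw]
          exact List.mem_cons_of_mem _ (List.mem_cons_self)
      · exact Or.inl ⟨R, _, rfl, hsrc', hpL, hR⟩
  · intro v R t hv hR
    rw [htgt v hv] at hR ⊢
    rcases R with _ | ⟨e, R⟩
    · exact absurd hR stdV_inner_ne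
    · obtain ⟨he, hR⟩ := hR
      obtain rfl := eq_of_src_right he
      exact ⟨R, _, rfl, htgt', hpR, hR⟩

/-- The clauses about `tgt` hold vacuously, since only points of earlier verticals and of lines
below `m` have been used for leaving. A path from the `m`-th point either is empty, and the particle
leaves, or starts with the source edge. -/
theorem sound_exitOp (j : Fin k) {m : ℕ} (hm : m < n) :
    Sound (exitOp j m ((stdNet n j).enter m)) (VertAt j m) (VertAt j (m + 1)) (VertRest j m)
      (VertRest j (m + 1)) := by
  have henter : (stdNet n j).enter m = [stdE j (.fromSource ⟨m, hm⟩)] := by simp [stdNet, hm]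
  rw [henter]
  set o : Op (CompEdge (stdNets n k)) := exitOp j m [stdE j (.fromSource ⟨m, hm⟩)]
  have hsrc : ∀ v, VertAt j m o.src v → v = vertPt j.castSucc ⟨m, hm⟩ := by
    rintro v (⟨l, h, hl, -⟩ | ⟨l, h, hl, rfl⟩ | ⟨q, l, -, h, -⟩)
    · simp only [o, exitOp, Sum.inl.injEq] at h; omega
    · simp only [o, exitOp, Sum.inl.injEq] at h
      rw [vertPt_inj]
      exact ⟨rfl, Fin.ext h.symm⟩
    · cases h
  have htgt : ∀ v : CompVertex (stdNets n k), ¬ VertAt j m o.tgt v := by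
    rintro v (⟨l, h, hl, -⟩ | ⟨l, h, hl, -⟩ | ⟨q, l, hq, h, -⟩)
    · cases h
    · cases h
    · simp only [o, exitOp, Sum.inr.injEq, Prod.mk.injEq] at h
      rcases hq with hq | ⟨hq, hl⟩
      · rw [Fin.lt_def] at hq
        simp only [Fin.val_castSucc] at hq
        omega
      · omega
  have hinj : ∀ (y y' : Pos) (v : CompVertex (stdNets n k)), VertAt j m y v → VertAt j m y' v → y = y' := by
    rintro y y' v (⟨l, rfl, hl, rfl⟩ | ⟨l, rfl, hl, rfl⟩ | ⟨q, l, hq, rfl, rfl⟩)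
      (⟨l', rfl, hl', h⟩ | ⟨l', rfl, hl', h⟩ | ⟨q', l', hq', rfl, h⟩)
    · rw [stdV_front_injective j _ h]
    · exact absurd h (stdV_front_ne le_rfl)
    · exact absurd h (stdV_front_ne (hq'.elim le_of_lt fun h => h.1.le))
    · exact absurd h.symm (stdV_front_ne le_rfl)
    · rw [(vertPt_inj.1 h).2]
    · obtain ⟨rfl, rfl⟩ := vertPt_inj.1 h
      rcases hq' with hq' | hq'
      · exact absurd hq' (lt_irrefl _)
      · omega
    · exact absurd h.symm (stdV_front_ne (hq.elim le_of_lt fun h => h.1.le))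
    · obtain ⟨rfl, rfl⟩ := vertPt_inj.1 h
      rcases hq with hq | hq
      · exact absurd hq (lt_irrefl _)
      · omega
    · obtain ⟨rfl, rfl⟩ := vertPt_inj.1 h; rfl
  have hp : IsPath (stdNets n k) (vertPt j.castSucc ⟨m, hm⟩) o.stay
      (stdV j (stdTgt n (.fromSource ⟨m, hm⟩))) := ⟨rfl, rfl⟩
  have hsrc' : VertAt j (m + 1) o.src (stdV j (stdTgt n (.fromSource ⟨m, hm⟩))) :=
    Or.inl ⟨⟨m, hm⟩, rfl, Nat.lt_succ_self m, by rw [front_netSlants]⟩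
  have htgt' : VertAt j (m + 1) o.tgt (vertPt j.castSucc ⟨m, hm⟩) :=
    Or.inr (Or.inr ⟨j.castSucc, ⟨m, hm⟩, Or.inr ⟨rfl, Nat.lt_succ_self m⟩, rfl, rfl⟩)
  have hnot : vertPt j.castSucc ⟨m, hm⟩ ∉ VertRest (n := n) j (m + 1) := by
    rintro (⟨l, hl, h⟩ | h)
    · have := congrArg Fin.val (vertPt_inj.1 h).2
      simp only at this
      omega
    · exact vertPt_notMem le_rfl h
  refine
    { inj := hinj
      subset := ?_
      other := ?_
      src_notMem := fun v hv => hsrc v hv ▸ hnot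
      tgt_notMem := fun v hv => absurd hv (htgt v)
      tgt_line := fun v hv => absurd hv (htgt v)
      stay := ?_
      rest := fun v hv => absurd hv (htgt v)
      move := ?_
      split_src := ?_
      split_tgt := fun v _ _ hv => absurd hv (htgt v) }
  · rintro v (⟨l, hl, h⟩ | h)
    · exact Or.inl ⟨l, by omega, h⟩
    · exact Or.inr h
  · rintro y v h1 h2 (⟨l, rfl, hl, rfl⟩ | ⟨l, rfl, hl, rfl⟩ | ⟨q, l, hq, rfl, rfl⟩)
    · exact Or.inl ⟨l, rfl, by omega, rfl⟩
    · have : (l : ℕ) ≠ m := fun h => h1 (by simp [o, exitOp, h])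
      exact Or.inr (Or.inl ⟨l, rfl, by omega, rfl⟩)
    · refine Or.inr (Or.inr ⟨q, l, ?_, rfl, rfl⟩)
      rcases hq with hq | hq
      · exact Or.inl hq
      · exact Or.inr ⟨hq.1, by omega⟩
  · intro v hv
    rw [hsrc v hv]
    refine ⟨_, Or.inr ?_, hsrc', hp, fun z hz => ?_⟩
    · rw [← front_netSlants]; exact stdV_front_mem j _ _
    · simpa [o, exitOp, compTgt_stdE] using hz
  · intro v hv
    rw [hsrc v hv]
    refine ⟨_, htgt', rfl, by simp [o, exitOp], fun z hz => Or.inl ?_⟩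
    simpa [o, exitOp, pathVerts] using hz
  · intro v R t hv hR
    rw [hsrc v hv] at hR ⊢
    rcases R with _ | ⟨e, R⟩
    · exact Or.inr ⟨[], _, rfl, htgt', rfl, hR, fun _ _ => rfl, fun w hw => absurd hw (htgt w)⟩
    · obtain ⟨he, hR⟩ := hR
      obtain ⟨j', hj, rfl⟩ := eq_of_src_vertPt he
      obtain rfl := Fin.castSucc_injective _ hj
      exact Or.inl ⟨R, _, rfl, hsrc', hp, hR⟩

/-- Vertices and final positions. -/
def EndAt (y : Pos) (v : CompVertex (stdNets n k)) : Prop :=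
  ∃ (q : Fin (k + 1)) (l : Fin n), y = endPos k q l ∧ v = vertPt q l

/-- Vertices and positions before the `p`-th vertical. -/
def StartAt (p : ℕ) (y : Pos) (v : CompVertex (stdNets n k)) : Prop :=
  ∃ (q : Fin (k + 1)) (l : Fin n), ((q : ℕ) = p ∧ y = .inl l ∨ (q : ℕ) < p ∧ y = .inr (q, l)) ∧
    v = vertPt q l

/-- The vertices still to be passed before the `p`-th vertical. -/
def StartRest (p : ℕ) : Set (CompVertex (stdNets n k)) :=
  {v | (∃ (q : Fin (k + 1)) (l : Fin n), p ≤ (q : ℕ) ∧ v = vertPt q l) ∨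
    ∃ (j : Fin k) (i : StdInner n), p ≤ (j : ℕ) ∧ v = stdV j (.inner i)}

theorem drawn_slants {F : Pos → CompVertex (stdNets n k) → Prop} (j : Fin k)
    {ops : List (Op (CompEdge (stdNets n k)))} (h : Drawn F ops (NetAt j []) (NetRest j []))
    (r : List (StdSlant n)) (hr : Sorted r) :
    Drawn F (r.map (slantOp j) ++ ops) (NetAt j r) (NetRest j r) := by
  induction r with
  | nil => exact h
  | cons s r ih => exact .cons (sound_slantOp j hr) (ih hr.2)

theorem drawn_exits {F : Pos → CompVertex (stdNets n k) → Prop} (j : Fin k)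
    {ops : List (Op (CompEdge (stdNets n k)))}
    (h : Drawn F ops (NetAt j (netSlants n)) (NetRest j (netSlants n))) (d m : ℕ)
    (hd : m + d = n) :
    Drawn F ((List.range' m d).map (fun l => exitOp j l ((stdNet n j).enter l)) ++ ops)
      (VertAt j m) (VertRest j m) := by
  induction d generalizing m with
  | zero =>
    refine h.mono ?_ fun v hv => Or.inr hv
    rintro y v (⟨l, rfl, hl, rfl⟩ | ⟨l, rfl, hl, rfl⟩ | ⟨q, l, hq, rfl, rfl⟩)
    · exact Or.inl ⟨l, rfl, rfl⟩
    · have := l.isLt; omega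
    · exact Or.inr ⟨q, l, hq.elim le_of_lt fun h => h.1.le, rfl, rfl⟩
  | succ d ih =>
    rw [List.range'_succ, List.map_cons, List.cons_append]
    exact .cons (sound_exitOp j (by omega)) (ih (m + 1) (by omega))

/-- Induction from the last vertical, which has no outgoing edge, back to vertical `p`; `Drawn.mono`
matches the states at the junctions. -/
theorem drawn_sysOps (d p : ℕ) (hd : p + d = k) :
    Drawn EndAt (sysOps n p (((List.finRange k).drop p).map (stdNet n))) (StartAt p)
      (StartRest p) := by
  induction d generalizing p with
  | zero =>
    have hp : p = k := by omega
    have hnil : (List.finRange k).drop p = [] := List.drop_eq_nil_of_le (by simp [hp])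
    rw [hnil]
    refine .nil ?_ ?_ ?_
    · rintro y y' v ⟨q, l, h, rfl⟩ ⟨q', l', h', hv⟩
      obtain ⟨rfl, rfl⟩ := vertPt_inj.1 hv
      rcases h with ⟨h, rfl⟩ | ⟨h, rfl⟩ <;> rcases h' with ⟨h', rfl⟩ | ⟨h', rfl⟩ <;>
        first | rfl | omega
    · rintro y v ⟨q, l, h, rfl⟩
      refine ⟨q, l, ?_, rfl⟩
      rw [endPos]
      rcases h with ⟨h, rfl⟩ | ⟨h, rfl⟩
      · rw [if_pos (by omega)]
      · rw [if_neg (by omega)]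
    · rintro l v R t ⟨q, l', h, rfl⟩ hR
      rcases h with ⟨h, hl⟩ | ⟨-, hl⟩
      · rcases R with _ | ⟨e, R⟩
        · rfl
        · obtain ⟨j, hj, -⟩ := eq_of_src_vertPt hR.1
          have := j.isLt
          rw [hj, Fin.val_castSucc] at h
          omega
      · cases hl
  | succ d ih =>
    have hp : p < k := by omega
    set j : Fin k := ⟨p, hp⟩
    have hdrop : (List.finRange k).drop p = j :: (List.finRange k).drop (p + 1) := by
      rw [List.drop_eq_getElem_cons (by simpa using hp)]
      simp [j]
    rw [hdrop, List.map_cons, sysOps, exitOps, List.range_eq_range']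
    have h1 : Drawn EndAt (sysOps n (p + 1) (((List.finRange k).drop (p + 1)).map (stdNet n)))
        (NetAt j []) (NetRest j []) := by
      refine (ih (p + 1) (by omega)).mono ?_ ?_
      · rintro y v (⟨l, rfl, rfl⟩ | ⟨q, l, hq, rfl, rfl⟩)
        · exact ⟨j.succ, l, Or.inl ⟨rfl, rfl⟩, rfl⟩
        · refine ⟨q, l, Or.inr ⟨?_, rfl⟩, rfl⟩
          have : (q : ℕ) ≤ p := hq
          omega
      · rintro v (⟨q, l, hq, rfl⟩ | ⟨j', i, hj, rfl⟩)
        · exact Or.inr (Or.inl ⟨q, l, Nat.lt_of_succ_le hq, rfl⟩)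
        · exact Or.inr (Or.inr ⟨j', i, Nat.lt_of_succ_le hj, rfl⟩)
    refine (drawn_exits j (drawn_slants j h1 _ (sorted_netSlants n)) n 0 (by omega)).mono ?_ ?_
    · rintro y v ⟨q, l, ⟨h, rfl⟩ | ⟨h, rfl⟩, rfl⟩
      · exact Or.inr (Or.inl ⟨l, rfl, Nat.zero_le _, by rw [vertPt_inj]; exact ⟨Fin.ext h, rfl⟩⟩)
      · exact Or.inr (Or.inr ⟨q, l, Or.inl h, rfl, rfl⟩)
    · rintro v (⟨l, -, rfl⟩ | ⟨s, -, h | h⟩ | ⟨q, l, hq, rfl⟩ | ⟨j', i, hj, rfl⟩)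
      · exact Or.inl ⟨j.castSucc, l, le_rfl, rfl⟩
      · exact Or.inr ⟨j, _, le_rfl, h⟩
      · exact Or.inr ⟨j, _, le_rfl, h⟩
      · exact Or.inl ⟨q, l, (show p < (q : ℕ) from hq).le, rfl⟩
      · exact Or.inr ⟨j', i, (show p < (j' : ℕ) from hj).le, rfl⟩

/-- Labelled runs in the concatenation of standard networks are families of disjoint paths. -/
theorem drawn_stdSys (n k : ℕ) :
    Drawn EndAt (sysOps n 0 (stdSys n k)) (StartAt 0) (StartRest 0) := by
  simpa [stdSys] using drawn_sysOps (n := n) k 0 (Nat.zero_add k)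

end TropHorn

/-! ### Multipaths as runs, and the map `m` as a tropical minor -/

namespace TropHorn

/-! ### Multipaths and runs -/

/-- The points of the verticals given by sets of lines, as final positions. -/
def points (k : ℕ) (J : Fin (k + 1) → Finset ℕ) : Finset Pos :=
  Finset.univ.biUnion fun p => (J p).image (endPos k p)

theorem lowest_eq_points (k : ℕ) (u : Fin (k + 1) → ℕ) :
    lowest k u = points k fun p => Finset.range (u p) := rfl

theorem mem_points {k : ℕ} {J : Fin (k + 1) → Finset ℕ} {a : Pos} :
    a ∈ points k J ↔ ∃ p : Fin (k + 1), ∃ l ∈ J p, endPos k p l = a := by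
  simp [points]

theorem endPos_mem_points {k : ℕ} {J : Fin (k + 1) → Finset ℕ} {p : Fin (k + 1)} {l : ℕ} :
    endPos k p l ∈ points k J ↔ l ∈ J p := by
  rw [mem_points]
  constructor
  · rintro ⟨p', l', h, h'⟩
    obtain ⟨h1, rfl⟩ := endPos_inj.1 h'
    rwa [← Fin.ext h1]
  · exact fun h => ⟨p, l, h, rfl⟩

theorem insert_points {k : ℕ} (J : Fin (k + 1) → Finset ℕ) (p : Fin (k + 1)) (l : ℕ) :
    insert (endPos k p l) (points k J) = points k (Function.update J p (insert l (J p))) := by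
  ext a
  rw [Finset.mem_insert, mem_points, mem_points]
  constructor
  · rintro (rfl | ⟨q, l', h, rfl⟩)
    · exact ⟨p, l, by simp, rfl⟩
    · refine ⟨q, l', ?_, rfl⟩
      by_cases hq : q = p
      · subst hq; simp [h]
      · simpa [hq] using h
  · rintro ⟨q, l', h, rfl⟩
    by_cases hq : q = p
    · subst hq
      rw [Function.update_self, Finset.mem_insert] at h
      rcases h with rfl | h
      · exact Or.inl rfl
      · exact Or.inr ⟨q, l', h, rfl⟩
    · rw [Function.update_of_ne hq] at h
      exact Or.inr ⟨q, l', h, rfl⟩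

section

variable {n k : ℕ}

/-- The weights of the edges of a concatenation of standard networks. -/
def edgeWt (w : Weighting (stdNets n k)) (e : CompEdge (stdNets n k)) : Trop := w e.1 e.2

theorem compTgt_ne_zero (e : CompEdge (stdNets n k)) (l : Fin n) :
    compTgt (stdNets n k) e ≠ vertPt 0 l := by
  obtain ⟨j, e⟩ := e
  change stdV j (stdTgt n e) ≠ _
  generalize hv : stdTgt n e = v
  rcases v with l' | i | l'
  · have h : ∀ e : StdEdge n, stdTgt n e ≠ .source l' := by
      rintro (s | l | ⟨L, I⟩ | ⟨L, I⟩) <;> rw [stdTgt] <;> (try split_ifs) <;> simp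
    exact absurd hv (h e)
  · exact stdV_inner_ne
  · rw [stdV_sink]
    exact fun h => Fin.succ_ne_zero j (vertPt_inj.1 h).1

/-- No edge ends on vertical `0`, so the particles that leave there are exactly those with empty
routes, that is, the unused sources. -/
theorem eq_nil_of_isPath_zero {v : CompVertex (stdNets n k)} {es : List (CompEdge (stdNets n k))}
    {l : Fin n} (h : IsPath (stdNets n k) v es (vertPt 0 l)) : es = [] := by
  induction es generalizing v with
  | nil => rfl
  | cons e es ih =>
    have h2 := h.2
    have := ih h.2
    subst this
    exact absurd h2 (compTgt_ne_zero e l)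

theorem Multipath.start_injective {N : Fin k → PlanarNetwork n} {α : Fin k → ℕ}
    (p : Multipath N α) :
    Function.Injective fun x : (i : Fin k) × Fin (α i) => p.start x.1 x.2 := by
  intro x y hxy
  by_contra hne
  have hd := p.nonintersecting x.1 x.2 y.1 y.2 hne
  have hxy : p.start x.1 x.2 = p.start y.1 y.2 := hxy
  rw [hxy] at hd
  exact hd List.mem_cons_self List.mem_cons_self

/-- Each unused source is given the empty route from itself to itself on vertical `0`; thus `J 0` is
the complement of the set of sources. -/
theorem Multipath.exists_sRun {α : Fin k → ℕ} (p : Multipath (stdNets n k) α)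
    (w : Weighting (stdNets n k)) :
    ∃ J : Fin (k + 1) → Finset ℕ,
      SRun (edgeWt w) (sysOps n 0 (stdSys n k)) (allLines n) (points k J) (p.weight w) ∧
      (∀ q, J q ⊆ Finset.range n) ∧ (∀ l : Fin n, l ∈ p.sources ↔ (l : ℕ) ∉ J 0) ∧
      ∀ i (l : Fin n), l ∈ p.sinks i ↔ (l : ℕ) ∈ J i.succ := by
  classical
  set σ : ((i : Fin k) × Fin (α i)) → Fin n := fun x => p.start x.1 x.2 with hσdef
  have hσ : Function.Injective σ := p.start_injective
  set R : Fin n → List (CompEdge (stdNets n k)) :=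
    Function.extend σ (fun x => p.route x.1 x.2) fun _ => [] with hR
  set t : Fin n → Fin (k + 1) × Fin n :=
    Function.extend σ (fun x => (x.1.succ, p.finish x.1 x.2)) fun l => (0, l) with ht
  have hR1 : ∀ x, R (σ x) = p.route x.1 x.2 := fun x => hσ.extend_apply _ _ x
  have ht1 : ∀ x, t (σ x) = (x.1.succ, p.finish x.1 x.2) := fun x => hσ.extend_apply _ _ x
  have hR2 : ∀ l, (¬ ∃ x, σ x = l) → R l = [] := fun l hl => Function.extend_apply' _ _ l hl
  have ht2 : ∀ l, (¬ ∃ x, σ x = l) → t l = (0, l) := fun l hl => Function.extend_apply' _ _ l hl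
  have hstart : ∀ x, StartAt (n := n) (k := k) 0 (lineEnum n x) (vertPt 0 x) :=
    fun x => ⟨0, x, Or.inl ⟨rfl, rfl⟩, rfl⟩
  -- A path cannot run through an unused source, because no edge ends there; so the added empty
  -- routes are disjoint from the others.
  have hcross : ∀ (l m : Fin n), l ≠ m → vertPt 0 m ∉ pathVerts (stdNets n k) (vertPt 0 l) (R l) := by
    intro l m hlm h
    rcases List.mem_cons.1 h with h | h
    · exact hlm (vertPt_inj.1 h).2.symm
    · obtain ⟨e, -, he⟩ := List.mem_map.1 h
      exact compTgt_ne_zero e m he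
  obtain ⟨ρ', hrun, hend⟩ := (drawn_stdSys n k).lRun (lineEnum_injective n)
    (R := R) (fun l => vertPt 0 l) hstart t
    (by
      intro l
      by_cases hl : ∃ x, σ x = l
      · obtain ⟨x, rfl⟩ := hl
        rw [hR1, ht1]
        exact p.isPath x.1 x.2
      · rw [hR2 l hl, ht2 l hl]
        rfl)
    (fun l q hq => by simp [lineEnum] at hq)
    (by
      intro l m hlm z hz hz'
      by_cases hl : ∃ x, σ x = l
      · by_cases hm : ∃ x, σ x = m
        · obtain ⟨x, rfl⟩ := hl
          obtain ⟨y, rfl⟩ := hm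
          rw [hR1] at hz hz'
          exact p.nonintersecting x.1 x.2 y.1 y.2 (fun h => hlm (congrArg σ h)) hz hz'
        · rw [hR2 m hm] at hz'
          rw [List.mem_singleton.1 hz'] at hz
          exact hcross l m hlm hz
      · rw [hR2 l hl] at hz
        rw [List.mem_singleton.1 hz] at hz'
        exact hcross m l hlm.symm hz')
  have hend' : ∀ l, ρ' l = endPos k (t l).1 (t l).2 := by
    intro l
    obtain ⟨q, l', h1, h2⟩ := hend l
    have h3 : t l = (q, l') := Sum.inl_injective h2
    rw [h1, h3]
  have hs := hrun.sRun (edgeWt w) (lineEnum_injective n)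
  set J : Fin (k + 1) → Finset ℕ := fun q => (Finset.univ.filter fun l => (t l).1 = q).image
    fun l => ((t l).2 : ℕ) with hJ
  refine ⟨J, ?_, ?_, ?_, ?_⟩
  · have h1 : points k J = Finset.univ.image ρ' := by
      ext a
      simp only [mem_points, hJ, Finset.mem_image, Finset.mem_filter, Finset.mem_univ, true_and]
      constructor
      · rintro ⟨q, l, ⟨m, rfl, rfl⟩, rfl⟩
        exact ⟨m, hend' m⟩
      · rintro ⟨m, rfl⟩
        exact ⟨_, _, ⟨m, rfl, rfl⟩, (hend' m).symm⟩
    have h2 : p.weight w = ∑ l, wt (edgeWt w) (R l) := by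
      rw [Multipath.weight, ← Fintype.sum_sigma' (f := fun i a =>
        ((p.route i a).map fun e => w e.1 e.2).sum)]
      refine Fintype.sum_of_injective σ hσ _ _ (fun l hl => ?_) fun x => ?_
      · rw [hR2 l hl, wt_nil]
      · rw [hR1]; rfl
    rw [h1, h2, ← image_lineEnum]
    exact hs
  · intro q a ha
    obtain ⟨l, -, rfl⟩ := Finset.mem_image.1 ha
    exact Finset.mem_range.2 (t l).2.2
  · intro l
    have : (l : ℕ) ∈ J 0 ↔ ¬ ∃ x, σ x = l := by
      simp only [hJ, Finset.mem_image, Finset.mem_filter, Finset.mem_univ, true_and]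
      constructor
      · rintro ⟨m, h1, h2⟩ hl
        by_cases hm : ∃ x, σ x = m
        · obtain ⟨x, rfl⟩ := hm
          rw [ht1] at h1
          exact Fin.succ_ne_zero _ h1
        · rw [ht2 m hm] at h2
          have h5 : m = l := Fin.ext h2
          exact hm (h5 ▸ hl)
      · intro hl
        exact ⟨l, by rw [ht2 l hl], by rw [ht2 l hl]⟩
    rw [this, not_not]
    exact ⟨fun ⟨i, a, h⟩ => ⟨⟨i, a⟩, h⟩, fun ⟨x, h⟩ => ⟨x.1, x.2, h⟩⟩
  · intro i l
    simp only [hJ, Finset.mem_image, Finset.mem_filter, Finset.mem_univ, true_and]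
    constructor
    · rintro ⟨a, rfl⟩
      exact ⟨σ ⟨i, a⟩, by rw [ht1], by rw [ht1]⟩
    · rintro ⟨m, h1, h2⟩
      by_cases hm : ∃ x, σ x = m
      · obtain ⟨⟨i', a⟩, rfl⟩ := hm
        rw [ht1] at h1 h2
        obtain rfl := Fin.succ_injective _ h1
        exact ⟨a, Fin.ext h2⟩
      · rw [ht2 m hm] at h1
        exact absurd h1.symm (Fin.succ_ne_zero _)

/-- The routes of the particles that end beyond vertical `0` are the paths; those on vertical `0`
have empty routes and do not change the weight. -/
theorem SRun.exists_multipath {α : Fin k → ℕ} {w : Weighting (stdNets n k)}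
    {J : Fin (k + 1) → Finset ℕ} {W : Trop}
    (h : SRun (edgeWt w) (sysOps n 0 (stdSys n k)) (allLines n) (points k J) W)
    (hJ : ∀ i : Fin k, (J i.succ).card = α i) :
    ∃ p : Multipath (stdNets n k) α, p.weight w = W ∧
      (∀ l : Fin n, l ∈ p.sources ↔ (l : ℕ) ∉ J 0) ∧
      ∀ i (l : Fin n), l ∈ p.sinks i ↔ (l : ℕ) ∈ J i.succ := by
  obtain ⟨ρ', R, hrun, him, rfl⟩ := h.lRun (lineEnum_injective n) (image_lineEnum n)
  have hinj := hrun.injective (lineEnum_injective n)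
  obtain ⟨⟨v', hv'⟩, -, hdisj⟩ := (drawn_stdSys n k).paths hrun (lineEnum_injective n)
    (fun l => vertPt 0 l) fun x => ⟨0, x, Or.inl ⟨rfl, rfl⟩, rfl⟩
  -- A multipath needs its paths indexed by `Fin (α i)`; the increasing enumeration of the sinks `J
  -- i.succ` provides the index.
  have hex : ∀ (i : Fin k) (a : Fin (α i)), ∃ (x m : Fin n),
      ρ' x = endPos k i.succ ((J i.succ).orderEmbOfFin (hJ i) a) ∧
      (m : ℕ) = (J i.succ).orderEmbOfFin (hJ i) a ∧ v' x = vertPt i.succ m := by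
    intro i a
    have hmem : endPos k i.succ ((J i.succ).orderEmbOfFin (hJ i) a) ∈ points k J :=
      endPos_mem_points.2 (Finset.orderEmbOfFin_mem _ _ _)
    rw [← him] at hmem
    obtain ⟨x, -, hx⟩ := Finset.mem_image.1 hmem
    obtain ⟨q, m, h1, h2⟩ := (hv' x).1
    rw [hx] at h1
    obtain ⟨h3, h4⟩ := endPos_inj.1 h1
    exact ⟨x, m, hx, h4.symm, by rw [h2, Fin.ext h3]⟩
  choose x m hx hm hvx using hex
  have hxinj : ∀ i a i' a', x i a = x i' a' →
      (⟨i, a⟩ : (i : Fin k) × Fin (α i)) = ⟨i', a'⟩ := by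
    intro i a i' a' h
    have h1 := (hx i a).symm.trans ((congrArg ρ' h).trans (hx i' a'))
    obtain ⟨h2, h3⟩ := endPos_inj.1 h1
    obtain rfl : i = i' := Fin.succ_injective _ (Fin.ext h2)
    obtain rfl := ((J i.succ).orderEmbOfFin (hJ i)).injective h3
    rfl
  have hcase : ∀ y, (∃ i a, x i a = y) ↔ (y : ℕ) ∉ J 0 := by
    intro y
    constructor
    · rintro ⟨i, a, rfl⟩ hy
      have h1 : endPos k (0 : Fin (k + 1)) (x i a) ∈ points k J := endPos_mem_points.2 hy
      rw [← him] at h1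
      obtain ⟨z, -, hz⟩ := Finset.mem_image.1 h1
      obtain ⟨q, l, h2, h3⟩ := (hv' z).1
      obtain ⟨h4, h5⟩ := endPos_inj.1 (hz.symm.trans h2)
      obtain rfl : q = 0 := Fin.ext h4.symm
      have h6 := (hv' z).2
      rw [h3] at h6
      have h7 := eq_nil_of_isPath_zero h6
      rw [h7] at h6
      have h8 : z = l := (vertPt_inj.1 h6).2
      have h9 : z = x i a := by rw [h8]; exact Fin.ext h5.symm
      rw [h9, hx] at hz
      exact Fin.succ_ne_zero i (Fin.ext (endPos_inj.1 hz).1)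
    · intro hy
      obtain ⟨q, l, h2, h3⟩ := (hv' y).1
      have h1 : ρ' y ∈ points k J := him ▸ Finset.mem_image_of_mem _ (Finset.mem_univ y)
      rw [h2, endPos_mem_points] at h1
      rcases Fin.eq_zero_or_eq_succ q with rfl | ⟨i, rfl⟩
      · have h6 := (hv' y).2
        rw [h3] at h6
        have h7 := eq_nil_of_isPath_zero h6
        rw [h7] at h6
        have h8 : y = l := (vertPt_inj.1 h6).2
        exact absurd (h8 ▸ h1) hy
      · have h4 : (l : ℕ) ∈ Set.range ((J i.succ).orderEmbOfFin (hJ i)) := by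
          rw [Finset.range_orderEmbOfFin]; exact h1
        obtain ⟨a, ha⟩ := h4
        refine ⟨i, a, hinj ?_⟩
        rw [hx, ha, h2]
  have hempty : ∀ y, (¬ ∃ i a, x i a = y) → R y = [] := by
    intro y hy
    obtain ⟨q, l, h2, h3⟩ := (hv' y).1
    have h1 : ρ' y ∈ points k J := him ▸ Finset.mem_image_of_mem _ (Finset.mem_univ y)
    rw [h2, endPos_mem_points] at h1
    rcases Fin.eq_zero_or_eq_succ q with rfl | ⟨i, rfl⟩
    · have h6 := (hv' y).2
      rw [h3] at h6
      exact eq_nil_of_isPath_zero h6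
    · have h4 : (l : ℕ) ∈ Set.range ((J i.succ).orderEmbOfFin (hJ i)) := by
        rw [Finset.range_orderEmbOfFin]; exact h1
      obtain ⟨a, ha⟩ := h4
      exact absurd ⟨i, a, hinj (by rw [hx, ha, h2])⟩ hy
  refine ⟨⟨x, m, fun i a => R (x i a), ?_, ?_⟩, ?_, ?_, ?_⟩
  · intro i a
    have := (hv' (x i a)).2
    rw [hvx] at this
    exact this
  · intro i a i' a' h
    exact hdisj _ _ fun h' => h (hxinj i a i' a' h')
  · rw [Multipath.weight, ← Fintype.sum_sigma' (f := fun i a =>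
      ((R (x i a)).map fun e => w e.1 e.2).sum)]
    refine Fintype.sum_of_injective (fun z : (i : Fin k) × Fin (α i) => x z.1 z.2)
      (fun z z' hz => hxinj _ _ _ _ hz) _ _ (fun y hy => ?_) fun z => rfl
    rw [hempty y fun ⟨i, a, h⟩ => hy ⟨⟨i, a⟩, h⟩, wt_nil]
  · exact hcase
  · intro i l
    constructor
    · rintro ⟨a, rfl⟩
      change ((m i a : Fin n) : ℕ) ∈ _
      rw [hm]
      exact Finset.orderEmbOfFin_mem _ _ _
    · intro hl
      have h4 : (l : ℕ) ∈ Set.range ((J i.succ).orderEmbOfFin (hJ i)) := by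
        rw [Finset.range_orderEmbOfFin]; exact hl
      obtain ⟨a, ha⟩ := h4
      exact ⟨a, Fin.ext ((hm i a).trans ha)⟩

theorem Multipath.card_sinks {α : Fin k → ℕ} (p : Multipath (stdNets n k) α) (i : Fin k)
    {J : Finset ℕ} (hJ : J ⊆ Finset.range n) (h : ∀ l : Fin n, l ∈ p.sinks i ↔ (l : ℕ) ∈ J) :
    J.card = α i := by
  have hinj : Function.Injective fun a => ((p.finish i a : Fin n) : ℕ) := by
    intro a a' haa
    by_contra hne
    refine p.nonintersecting i a i a' (by simpa using hne) (p.isPath i a).mem ?_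
    have h2 := (p.isPath i a').mem
    have h1 : p.finish i a = p.finish i a' := Fin.ext haa
    rwa [← h1] at h2
  have : J = Finset.univ.image fun a => ((p.finish i a : Fin n) : ℕ) := by
    ext l
    simp only [Finset.mem_image, Finset.mem_univ, true_and]
    constructor
    · intro hl
      obtain ⟨a, ha⟩ := (h ⟨l, Finset.mem_range.1 (hJ hl)⟩).2 hl
      exact ⟨a, by rw [ha]⟩
    · rintro ⟨a, rfl⟩
      exact (h _).1 ⟨a, rfl⟩
  rw [this, Finset.card_image_of_injective _ hinj, Finset.card_univ, Fintype.card_fin]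

theorem Multipath.card_sources {α : Fin k → ℕ} (p : Multipath (stdNets n k) α)
    {J : Finset ℕ} (hJ : J ⊆ Finset.range n) (h : ∀ l : Fin n, l ∈ p.sources ↔ (l : ℕ) ∉ J) :
    J.card + ∑ i, α i = n := by
  have hinj : Function.Injective fun x : (i : Fin k) × Fin (α i) =>
      ((p.start x.1 x.2 : Fin n) : ℕ) := fun x y h => p.start_injective (Fin.ext h)
  have h1 : Finset.range n \ J =
      Finset.univ.image fun x : (i : Fin k) × Fin (α i) => ((p.start x.1 x.2 : Fin n) : ℕ) := by
    ext l
    simp only [Finset.mem_image, Finset.mem_univ, true_and, Finset.mem_sdiff, Finset.mem_range]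
    constructor
    · rintro ⟨hl, hl'⟩
      obtain ⟨i, a, ha⟩ := (h ⟨l, hl⟩).2 hl'
      exact ⟨⟨i, a⟩, by rw [ha]⟩
    · rintro ⟨x, rfl⟩
      exact ⟨Fin.isLt _, (h _).1 ⟨x.1, x.2, rfl⟩⟩
  have h2 := congrArg Finset.card h1
  rw [Finset.card_image_of_injective _ hinj, Finset.card_univ, Fintype.card_sigma,
    Finset.card_sdiff_of_subset hJ, Finset.card_range] at h2
  simp only [Fintype.card_fin] at h2
  have h3 := Finset.card_le_card hJ
  rw [Finset.card_range] at h3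
  omega

/-- The barycentric coordinates of a point of the simplex. -/
def baryOf (α : Simplex k n) : Fin (k + 1) → ℕ := Fin.cons (n - ∑ i, α.1 i) α.1

/-- The maximal weight of a run of the concatenation of standard networks. -/
noncomputable def stdOpt (w : Weighting (stdNets n k)) (T : Finset Pos) : Trop :=
  opt (edgeWt w) (sysOps n 0 (stdSys n k)) (allLines n) T

theorem Multipath.exists_weight_le {α : Simplex k n} (p : Multipath (stdNets n k) α.1)
    (w : Weighting (stdNets n k)) : ∃ J : Fin (k + 1) → Finset ℕ, (∀ q, J q ⊆ Finset.range n) ∧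
      (∀ q, (J q).card = baryOf α q) ∧ p.weight w ≤ stdOpt w (points k J) := by
  obtain ⟨J, h1, h2, h3, h4⟩ := p.exists_sRun w
  refine ⟨J, h2, fun q => ?_, h1.le_opt⟩
  rcases Fin.eq_zero_or_eq_succ q with rfl | ⟨i, rfl⟩
  · have := p.card_sources (h2 0) h3
    rw [baryOf, Fin.cons_zero]
    omega
  · rw [baryOf, Fin.cons_succ]
    exact p.card_sinks i (h2 _) (h4 i)

/-- Since multipaths are runs, the condition says that among all end sets with given cardinalities
the lowest ones have the largest tropical minor, which then is the value of `m`. -/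
theorem multiGZ_mMap {w : Weighting (stdNets n k)} (h : MultiGZ (stdNets n k) w)
    (α : Simplex k n) : mMap (stdNets n k) w α = stdOpt w (lowest k (baryOf α)) ∧
      ∀ J : Fin (k + 1) → Finset ℕ, (∀ q, (J q).card = baryOf α q) →
        stdOpt w (points k J) ≤ stdOpt w (lowest k (baryOf α)) := by
  obtain ⟨p, hsrc, hsink, hmax⟩ := h α
  have hub : ∀ J : Fin (k + 1) → Finset ℕ, (∀ q, (J q).card = baryOf α q) →
      stdOpt w (points k J) ≤ p.weight w := by
    intro J hJ
    by_cases hbot : stdOpt w (points k J) = ⊥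
    · rw [hbot]; exact bot_le
    · obtain ⟨q, hq, -⟩ := (exists_sRun_opt hbot).exists_multipath (α := α.1) fun i => by
        rw [hJ, baryOf, Fin.cons_succ]
      rw [stdOpt, ← hq]
      exact hmax q
  have hle : p.weight w ≤ stdOpt w (lowest k (baryOf α)) := by
    obtain ⟨J, h1, h2, h3, h4⟩ := p.exists_sRun w
    have : points k J = lowest k (baryOf α) := by
      rw [lowest_eq_points]
      congr 1
      funext q
      ext l
      rw [Finset.mem_range]
      rcases Fin.eq_zero_or_eq_succ q with rfl | ⟨i, rfl⟩
      · rw [baryOf, Fin.cons_zero]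
        constructor
        · intro hl
          have hln := Finset.mem_range.1 (h2 0 hl)
          have := (not_congr (h3 ⟨l, hln⟩)).2 (not_not.2 hl)
          rw [hsrc, Set.mem_ofPred_eq] at this
          simp only at this
          omega
        · intro hl
          by_contra hl'
          have := (h3 ⟨l, by omega⟩).2 hl'
          rw [hsrc, Set.mem_ofPred_eq] at this
          simp only at this
          omega
      · rw [baryOf, Fin.cons_succ]
        constructor
        · intro hl
          have hln := Finset.mem_range.1 (h2 _ hl)
          have := (h4 i ⟨l, hln⟩).2 hl
          rwa [hsink, Set.mem_ofPred_eq] at this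
        · intro hl
          have hαn : α.1 i ≤ n :=
            (Finset.single_le_sum (fun _ _ => Nat.zero_le _) (Finset.mem_univ i)).trans α.2
          have := (h4 i ⟨l, by omega⟩).1
          rw [hsink, Set.mem_ofPred_eq] at this
          exact this hl
    rw [← this]
    exact h1.le_opt
  refine ⟨?_, fun J hJ => (hub J hJ).trans hle⟩
  have h1 : mMap (stdNets n k) w α = p.weight w := by
    -- The supremum is attained by `p`, so no separate boundedness argument is needed.
    refine IsGreatest.csSup_eq ⟨⟨p, rfl⟩, ?_⟩
    rintro _ ⟨q, rfl⟩
    exact hmax q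
  rw [h1]
  refine le_antisymm hle ?_
  rw [lowest_eq_points]
  exact hub _ fun q => Finset.card_range _

/-- The condition asks for an actual multipath; that the value is not `⊥` guarantees one. -/
theorem multiGZ_of_opt {w : Weighting (stdNets n k)}
    (h : ∀ α : Simplex k n, stdOpt w (lowest k (baryOf α)) ≠ ⊥ ∧
      ∀ J : Fin (k + 1) → Finset ℕ, (∀ q, J q ⊆ Finset.range n) →
        (∀ q, (J q).card = baryOf α q) →
        stdOpt w (points k J) ≤ stdOpt w (lowest k (baryOf α))) : MultiGZ (stdNets n k) w := by
  intro α
  obtain ⟨h1, h2⟩ := h α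
  obtain ⟨p, hp, hsrc, hsink⟩ := (exists_sRun_opt h1).exists_multipath (α := α.1)
    (J := fun q => Finset.range (baryOf α q)) fun i => by
      rw [Finset.card_range, baryOf, Fin.cons_succ]
  refine ⟨p, ?_, fun i => ?_, fun q => ?_⟩
  · ext l
    rw [hsrc, Finset.mem_range, baryOf, Fin.cons_zero, Set.mem_ofPred_eq]
    have := α.2
    omega
  · ext l
    rw [hsink, Finset.mem_range, baryOf, Fin.cons_succ, Set.mem_ofPred_eq]
  · obtain ⟨J, h3, h4, h5⟩ := q.exists_weight_le w
    rw [hp]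
    exact h5.trans (h2 J h3 h4)

end

end TropHorn

/-! ### The map `m` takes values in the octahedron recurrence cone -/

namespace TropHorn

section

variable {n k : ℕ}

theorem length_stdSys (n k : ℕ) : (stdSys n k).length = k := by
  simp [stdSys]

theorem sum_baryOf (α : Simplex k n) : ∑ p, baryOf α p = n := by
  rw [Fin.sum_univ_succ]
  simp only [baryOf, Fin.cons_zero, Fin.cons_succ]
  have := α.2
  omega

theorem exists_baryOf {u : Fin (k + 1) → ℕ} (hu : ∑ p, u p = n) :
    ∃ α : Simplex k n, baryOf α = u := by
  rw [Fin.sum_univ_succ] at hu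
  have hle : ∑ i : Fin k, u i.succ ≤ n := by omega
  refine ⟨⟨fun i => u i.succ, hle⟩, ?_⟩
  funext p
  rcases Fin.eq_zero_or_eq_succ p with rfl | ⟨i, rfl⟩
  · rw [baryOf, Fin.cons_zero]
    simp only
    omega
  · rw [baryOf, Fin.cons_succ]

theorem multiGZ_points_le {w : Weighting (stdNets n k)} (h : MultiGZ (stdNets n k) w)
    {u : Fin (k + 1) → ℕ} (hu : ∑ p, u p = n) (J : Fin (k + 1) → Finset ℕ)
    (hJ : ∀ q, (J q).card = u q) : stdOpt w (points k J) ≤ stdOpt w (lowest k u) := by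
  obtain ⟨α, rfl⟩ := exists_baryOf hu
  exact (multiGZ_mMap h α).2 J hJ

/-- The end set with a gap at the point `u a` of vertical `a` has the same numbers of points on each
vertical as the lowest set on the right, which dominates it by the multi-Gelfand–Zeitlin condition.
-/
theorem stdOpt_insert_two_le {w : Weighting (stdNets n k)} (h : MultiGZ (stdNets n k) w)
    {u : Fin (k + 1) → ℕ} (hu : ∑ p, u p + 2 = n) {a c : Fin (k + 1)} (hac : a ≠ c) :
    stdOpt w (insert (endPos k a (u a + 1)) (insert (endPos k c (u c)) (lowest k u))) ≤
      stdOpt w (lowest k (u + Pi.single a 1 + Pi.single c 1)) := by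
  rw [← lowest_add_single, lowest_eq_points, insert_points]
  refine multiGZ_points_le h ?_ _ fun q => ?_
  · simp only [Pi.add_apply, Finset.sum_add_distrib, Finset.sum_pi_single', Finset.mem_univ,
      if_true]
    omega
  · by_cases hq : q = a
    · subst hq
      rw [Function.update_self, Finset.card_insert_of_notMem (by simp [hac]), Finset.card_range]
      simp only [Pi.add_apply, Pi.single_eq_same, Pi.single_eq_of_ne hac, add_zero]
    · rw [Function.update_of_ne hq, Finset.card_range]
      simp only [Pi.add_apply, Pi.single_eq_of_ne hq, add_zero]

theorem mMap_add_le {w : Weighting (stdNets n k)} (h : MultiGZ (stdNets n k) w)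
    {u : Fin (k + 1) → ℕ} {a b c : Fin (k + 1)} (hab : a ≠ b) (hac : a ≠ c) (hbc : b ≠ c)
    {l₁ l₂ s₁ s₂ : Simplex k n} (hl₁ : baryOf l₁ = u + Pi.single a 1 + Pi.single a 1)
    (hl₂ : baryOf l₂ = u + Pi.single b 1 + Pi.single c 1)
    (hs₁ : baryOf s₁ = u + Pi.single a 1 + Pi.single b 1)
    (hs₂ : baryOf s₂ = u + Pi.single a 1 + Pi.single c 1) :
    mMap (stdNets n k) w l₁ + mMap (stdNets n k) w l₂ ≤
      mMap (stdNets n k) w s₁ + mMap (stdNets n k) w s₂ := by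
  have hu : ∑ p, u p + 2 = n := by
    have := sum_baryOf l₁
    rw [hl₁] at this
    simp only [Pi.add_apply, Finset.sum_add_distrib, Finset.sum_pi_single', Finset.mem_univ,
      if_true] at this
    omega
  rw [(multiGZ_mMap h l₁).1, (multiGZ_mMap h l₂).1, (multiGZ_mMap h s₁).1, (multiGZ_mMap h s₂).1,
    hl₁, hl₂, hs₁, hs₂]
  refine (opt_rhombus (edgeWt w) (length_stdSys n k) hu hab hac hbc).trans (max_le ?_ ?_)
  · exact add_le_add le_rfl (stdOpt_insert_two_le h hu hac)
  · exact (add_le_add le_rfl (stdOpt_insert_two_le h hu hab)).trans_eq (add_comm _ _)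

theorem mMap_octahedron {w : Weighting (stdNets n k)} (h : MultiGZ (stdNets n k) w)
    {u : Fin (k + 1) → ℕ} {a b c d : Fin (k + 1)} (hab : a < b) (hbc : b < c) (hcd : c < d)
    {ac bd ab cd ad bc : Simplex k n} (hac' : baryOf ac = u + Pi.single a 1 + Pi.single c 1)
    (hbd' : baryOf bd = u + Pi.single b 1 + Pi.single d 1)
    (hab' : baryOf ab = u + Pi.single a 1 + Pi.single b 1)
    (hcd' : baryOf cd = u + Pi.single c 1 + Pi.single d 1)
    (had' : baryOf ad = u + Pi.single a 1 + Pi.single d 1)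
    (hbc' : baryOf bc = u + Pi.single b 1 + Pi.single c 1) :
    mMap (stdNets n k) w ac + mMap (stdNets n k) w bd =
      max (mMap (stdNets n k) w ab + mMap (stdNets n k) w cd)
        (mMap (stdNets n k) w ad + mMap (stdNets n k) w bc) := by
  have hu : ∑ p, u p + 2 = n := by
    have := sum_baryOf ac
    rw [hac'] at this
    simp only [Pi.add_apply, Finset.sum_add_distrib, Finset.sum_pi_single', Finset.mem_univ,
      if_true] at this
    omega
  rw [(multiGZ_mMap h ac).1, (multiGZ_mMap h bd).1, (multiGZ_mMap h ab).1, (multiGZ_mMap h cd).1,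
    (multiGZ_mMap h ad).1, (multiGZ_mMap h bc).1, hac', hbd', hab', hcd', had', hbc']
  exact opt_octahedron (edgeWt w) (length_stdSys n k) hu hab hbc hcd

theorem baryOf_pt {i j l : ℕ} (h : i + j + l ≤ n) :
    baryOf (pt i j l h) = ![n - (i + j + l), i, j, l] := by
  funext p
  rcases Fin.eq_zero_or_eq_succ p with rfl | ⟨q, rfl⟩
  · simp [baryOf, pt, Fin.sum_univ_three]
  · fin_cases q <;> rfl

theorem mMap_mem_octCone {w : Weighting (stdNets n 3)} (h : MultiGZ (stdNets n 3) w) :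
    mMap (stdNets n 3) w ∈ octCone n := by
  refine ⟨?_, ?_, ?_⟩
  -- A multipath of type zero has no paths, so every such multipath has weight `0`; the condition
  -- supplies one.
  · obtain ⟨p, -⟩ := h (pt 0 0 0 (Nat.zero_le _))
    have hz : ∀ q : Multipath (stdNets n 3) (pt (n := n) 0 0 0 (Nat.zero_le _)).1,
        q.weight w = 0 := by
      intro q
      rw [Multipath.weight]
      refine Finset.sum_eq_zero fun i _ => Finset.sum_eq_zero fun a _ => ?_
      have h0 : (pt (n := n) 0 0 0 (Nat.zero_le _)).1 i = 0 := by
        fin_cases i <;> rfl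
      exact (Fin.cast h0 a).elim0
    refine IsGreatest.csSup_eq ⟨⟨p, hz p⟩, ?_⟩
    rintro _ ⟨q, rfl⟩
    exact (hz q).le
  · intro u a b c hab hac hbc l₁ l₂ s₁ s₂ h1 h2 h3 h4
    exact mMap_add_le h hab hac hbc h1 h2 h3 h4
  · intro i j l hn
    refine mMap_octahedron h (u := ![n - (i + j + l + 2), i, j, l]) (a := 0) (b := 1) (c := 2)
      (d := 3) (by decide) (by decide) (by decide) ?_ ?_ ?_ ?_ ?_ ?_ <;> rw [baryOf_pt] <;>
      funext p <;> simp only [Pi.add_apply, Pi.single_apply] <;> fin_cases p <;> simp <;> omega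

theorem AllMultiGZ.multiGZ {w : Weighting (stdNets n 3)} (h : AllMultiGZ (stdNets n 3) w) :
    MultiGZ (stdNets n 3) w := by
  have hid : (![0, 1, 2] : Fin 3 → Fin 3) = id := by
    funext j; fin_cases j <;> rfl
  have := h.gz123
  rw [SubGZ, hid] at this
  exact this

end

end TropHorn

/-! ### Weights up to gauge: runs of slants on sets of lines -/

namespace TropHorn

/-! ### Runs on sets of lines -/

/-- `YRun s R J Y`: using the slants `s`, where `(l, y)` is a slant of weight `y` from the line
`l + 1` to the line `l`, particles on the lines `R` can arrive at the lines `J` with weight `Y`. -/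
inductive YRun : List (ℕ × ℝ) → Finset ℕ → Finset ℕ → ℝ → Prop
  | nil (R : Finset ℕ) : YRun [] R R 0
  | stay {z : ℕ × ℝ} {s : List (ℕ × ℝ)} {R J : Finset ℕ} {Y : ℝ} (h : YRun s R J Y) :
      YRun (z :: s) R J Y
  | move {z : ℕ × ℝ} {s : List (ℕ × ℝ)} {R J : Finset ℕ} {Y : ℝ} (h₁ : z.1 + 1 ∈ R)
      (h₂ : z.1 ∉ R) (h : YRun s (insert z.1 (R.erase (z.1 + 1))) J Y) :
      YRun (z :: s) R J (z.2 + Y)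

/-- `NRun p ss R J Y`: in the concatenation of the lists of slants `ss`, the first vertical having
the number `p`, particles on the lines `R` can leave at the points `J` with weight `Y`. -/
def NRun : ℕ → List (List (ℕ × ℝ)) → Finset ℕ → (ℕ → Finset ℕ) → ℝ → Prop
  | p, [], R, J, Y => J p = R ∧ Y = 0
  | p, s :: ss, R, J, Y => J p ⊆ R ∧ ∃ R' Y₁ Y₂, YRun s (R \ J p) R' Y₁ ∧
      NRun (p + 1) ss R' J Y₂ ∧ Y = Y₁ + Y₂

theorem YRun.append {s s' : List (ℕ × ℝ)} {R M J : Finset ℕ} {Y Y' : ℝ} (h : YRun s R M Y)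
    (h' : YRun s' M J Y') : YRun (s ++ s') R J (Y + Y') := by
  induction h with
  | nil => simpa using h'
  | stay _ ih => exact .stay (ih h')
  | move h₁ h₂ _ ih => rw [add_assoc]; exact .move h₁ h₂ (ih h')

theorem YRun.split {s s' : List (ℕ × ℝ)} {R J : Finset ℕ} {Y : ℝ} (h : YRun (s ++ s') R J Y) :
    ∃ M Y₁ Y₂, YRun s R M Y₁ ∧ YRun s' M J Y₂ ∧ Y = Y₁ + Y₂ := by
  induction s generalizing R Y with
  | nil => exact ⟨R, 0, Y, .nil R, h, by simp⟩
  | cons z s ih =>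
    rw [List.cons_append] at h
    cases h with
    | stay h =>
      obtain ⟨M, Y₁, Y₂, h₁, h₂, rfl⟩ := ih h
      exact ⟨M, _, Y₂, .stay h₁, h₂, rfl⟩
    | move ha hb h =>
      obtain ⟨M, Y₁, Y₂, h₁, h₂, rfl⟩ := ih h
      exact ⟨M, _, Y₂, .move ha hb h₁, h₂, by rw [add_assoc]⟩

theorem YRun.refl (s : List (ℕ × ℝ)) (R : Finset ℕ) : YRun s R R 0 := by
  induction s with
  | nil => exact .nil R
  | cons z s ih => exact .stay ih

theorem card_slide {R : Finset ℕ} {l : ℕ} (h₁ : l + 1 ∈ R) (h₂ : l ∉ R) :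
    (insert l (R.erase (l + 1))).card = R.card := by
  rw [Finset.card_insert_of_notMem fun h => h₂ (Finset.mem_of_mem_erase h),
    Finset.card_erase_add_one h₁]

theorem sum_slide {R : Finset ℕ} {l : ℕ} (h₁ : l + 1 ∈ R) (h₂ : l ∉ R) (κ : ℕ → ℝ) :
    ∑ i ∈ insert l (R.erase (l + 1)), κ i = ∑ i ∈ R, κ i + κ l - κ (l + 1) := by
  rw [Finset.sum_insert fun h => h₂ (Finset.mem_of_mem_erase h),
    ← Finset.add_sum_erase R κ h₁]
  ring

theorem slide_subset {R : Finset ℕ} {l n : ℕ} (h₁ : l + 1 ∈ R) (h : R ⊆ Finset.range n) :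
    insert l (R.erase (l + 1)) ⊆ Finset.range n := by
  intro a ha
  rcases Finset.mem_insert.1 ha with rfl | ha
  · have := Finset.mem_range.1 (h h₁)
    exact Finset.mem_range.2 (by omega)
  · exact h (Finset.mem_of_mem_erase ha)

theorem YRun.card_eq {s : List (ℕ × ℝ)} {R J : Finset ℕ} {Y : ℝ} (h : YRun s R J Y) :
    J.card = R.card := by
  induction h with
  | nil => rfl
  | stay _ ih => exact ih
  | move h₁ h₂ _ ih => rw [ih, card_slide h₁ h₂]

theorem YRun.subset_range {s : List (ℕ × ℝ)} {R J : Finset ℕ} {Y : ℝ} {n : ℕ} (h : YRun s R J Y)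
    (hR : R ⊆ Finset.range n) : J ⊆ Finset.range n := by
  induction h with
  | nil => exact hR
  | stay _ ih => exact ih hR
  | move h₁ h₂ _ ih => exact ih (slide_subset h₁ hR)

/-! ### Weights up to gauge -/

section

variable {E : Type}

/-- The operation `o` is the slant `z`, up to a change of the weights by a potential on the
lines. -/
structure GaugeOp (w : E → Trop) (κ : ℕ → ℝ) (o : Op E) (z : ℕ × ℝ) : Prop where
  src_eq : o.src = .inl (z.1 + 1)
  tgt_eq : o.tgt = .inl z.1
  stay_eq : wt w o.stay = 0
  rest_eq : wt w o.rest = 0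
  move_eq : wt w o.move = ((z.2 + κ z.1 - κ (z.1 + 1) : ℝ) : Trop)

theorem slide_disjSum {R : Finset ℕ} {D : Finset (ℕ × ℕ)} (l : ℕ) :
    insert (.inl l) ((R.disjSum D).erase (.inl (l + 1))) =
      (insert l (R.erase (l + 1))).disjSum D := by
  ext (a | q) <;> simp

theorem exit_disjSum {R : Finset ℕ} {D : Finset (ℕ × ℕ)} (p l : ℕ) :
    insert (.inr (p, l)) ((R.disjSum D).erase (.inl l)) =
      (R.erase l).disjSum (insert (p, l) D) := by
  ext (a | q) <;> simp

/-- Along the motion of a particle the potentials telescope, and only those of its first and last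
line remain. The set `D` of departed particles is not affected by slants. -/
theorem SRun.yRun {w : E → Trop} {κ : ℕ → ℝ} {ops : List (Op E)} {s : List (ℕ × ℝ)}
    (h : List.Forall₂ (GaugeOp w κ) ops s) {R : Finset ℕ} {D : Finset (ℕ × ℕ)} {T : Finset Pos}
    {W : Trop} (hr : SRun w ops (R.disjSum D) T W) :
    ∃ J Y, YRun s R J Y ∧ T = J.disjSum D ∧
      W = ((Y + ∑ l ∈ J, κ l - ∑ l ∈ R, κ l : ℝ) : Trop) := by
  induction h generalizing R W with
  | nil =>
    cases hr
    exact ⟨R, 0, .nil R, rfl, by simp⟩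
  | @cons o z ops s h _ ih =>
    cases hr with
    | stay hr =>
      obtain ⟨J, Y, h1, h2, rfl⟩ := ih hr
      refine ⟨J, Y, .stay h1, h2, ?_⟩
      rw [Op.stayWt, h.stay_eq, h.rest_eq]
      simp
    | move ha hb hr =>
      rw [h.src_eq] at ha hr
      rw [h.tgt_eq] at hb hr
      rw [slide_disjSum] at hr
      have ha' : z.1 + 1 ∈ R := by simpa using ha
      have hb' : z.1 ∉ R := by simpa using hb
      obtain ⟨J, Y, h1, h2, rfl⟩ := ih hr
      refine ⟨J, z.2 + Y, .move ha' hb' h1, h2, ?_⟩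
      rw [h.move_eq, ← WithBot.coe_add, sum_slide ha' hb']
      congr 1
      ring

theorem YRun.sRun {w : E → Trop} {κ : ℕ → ℝ} {ops : List (Op E)} {s : List (ℕ × ℝ)}
    (h : List.Forall₂ (GaugeOp w κ) ops s) {R J : Finset ℕ} {Y : ℝ} (hy : YRun s R J Y)
    (D : Finset (ℕ × ℕ)) : SRun w ops (R.disjSum D) (J.disjSum D)
      ((Y + ∑ l ∈ J, κ l - ∑ l ∈ R, κ l : ℝ) : Trop) := by
  induction h generalizing R Y with
  | nil =>
    cases hy
    simpa using SRun.nil _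
  | @cons o z ops s h _ ih =>
    cases hy with
    | stay hy =>
      have := SRun.stay (o := o) (ih hy)
      rw [Op.stayWt, h.stay_eq, h.rest_eq] at this
      simpa using this
    | @move _ _ _ _ Y ha hb hy =>
      have h1 := ih hy
      rw [← slide_disjSum, ← h.src_eq, ← h.tgt_eq] at h1
      have h2 := SRun.move (o := o) (by rw [h.src_eq]; simpa using ha)
        (by rw [h.tgt_eq]; simpa using hb) h1
      rw [h.move_eq, ← WithBot.coe_add, sum_slide ha hb] at h2
      convert h2 using 2
      ring

theorem filter_le_eq {R : Finset ℕ} {m : ℕ} :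
    R.filter (m ≤ ·) = if m ∈ R then insert m (R.filter (m + 1 ≤ ·)) else
      R.filter (m + 1 ≤ ·) := by
  ext a
  split_ifs with h
  · simp only [Finset.mem_filter, Finset.mem_insert]
    constructor
    · rintro ⟨h1, h2⟩
      rcases h2.eq_or_lt with h3 | h3
      · exact Or.inl h3.symm
      · exact Or.inr ⟨h1, h3⟩
    · rintro (rfl | h1)
      · exact ⟨h, le_rfl⟩
      · exact ⟨h1.1, by omega⟩
  · simp only [Finset.mem_filter]
    constructor
    · rintro ⟨h1, h2⟩
      refine ⟨h1, ?_⟩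
      rcases h2.eq_or_lt with rfl | h3
      · exact absurd h1 h
      · exact h3
    · rintro ⟨h1, h2⟩
      exact ⟨h1, by omega⟩

theorem sum_filter_le (R : Finset ℕ) (m : ℕ) (κ : ℕ → ℝ) :
    ((∑ l ∈ R.filter (m ≤ ·), κ l : ℝ) : Trop) =
      (if m ∈ R then (κ m : Trop) else 0) + ((∑ l ∈ R.filter (m + 1 ≤ ·), κ l : ℝ) : Trop) := by
  rw [filter_le_eq]
  split_ifs with h
  · rw [Finset.sum_insert (by simp), WithBot.coe_add]
  · rw [zero_add]

/-- `X` is the set of the particles that leave. The entering edges of lines below `m` have already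
been counted, hence the filter in the weight. -/
theorem SRun.exits {w : E → Trop} {κ : ℕ → ℝ} {c : ℕ → List E} {p n : ℕ}
    (hc : ∀ l < n, wt w (c l) = (κ l : Trop)) {d m : ℕ} (hd : m + d = n) {R : Finset ℕ}
    (hR : R ⊆ Finset.range n) {D : Finset (ℕ × ℕ)} {T : Finset Pos} {W : Trop}
    (h : SRun w ((List.range' m d).map fun l => exitOp p l (c l)) (R.disjSum D) T W) :
    ∃ X ⊆ R, (∀ l ∈ X, m ≤ l) ∧ T = (R \ X).disjSum (D ∪ X.image (Prod.mk p)) ∧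
      W = ((∑ l ∈ (R \ X).filter (m ≤ ·), κ l : ℝ) : Trop) := by
  induction d generalizing m R D W with
  | zero =>
    cases h
    refine ⟨∅, by simp, by simp, by simp, ?_⟩
    rw [Finset.filter_false_of_mem]
    · simp
    · intro l hl
      have := Finset.mem_range.1 (hR (Finset.sdiff_subset hl))
      omega
  | succ d ih =>
    rw [List.range'_succ, List.map_cons] at h
    cases h with
    | stay h =>
      obtain ⟨X, h1, h2, h3, rfl⟩ := ih (by omega) hR h
      refine ⟨X, h1, fun l hl => by have := h2 l hl; omega, h3, ?_⟩
      have hm : m ∉ X := fun hm => by have := h2 m hm; omega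
      rw [sum_filter_le _ m, Op.stayWt]
      congr 1
      simp [exitOp, hc m (by omega), hm]
    | move ha hb h =>
      have ha' : m ∈ R := by simpa [exitOp] using ha
      change SRun w _ (insert (.inr (p, m)) ((R.disjSum D).erase (.inl m))) T _ at h
      rw [exit_disjSum] at h
      obtain ⟨X, h1, h2, h3, rfl⟩ := ih (by omega) ((Finset.erase_subset _ _).trans hR) h
      have hRX : R \ insert m X = R.erase m \ X := by
        ext a; simp only [Finset.mem_sdiff, Finset.mem_insert, Finset.mem_erase]; tauto
      refine ⟨insert m X, ?_, ?_, ?_, ?_⟩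
      · exact Finset.insert_subset ha' (h1.trans (Finset.erase_subset _ _))
      · intro l hl
        rcases Finset.mem_insert.1 hl with rfl | hl
        · exact le_rfl
        · have := h2 l hl; omega
      · rw [h3, hRX, Finset.image_insert, Finset.insert_union, Finset.union_insert]
      · rw [hRX, sum_filter_le _ m, if_neg (by simp)]
        rfl

theorem sRun_exits {w : E → Trop} {κ : ℕ → ℝ} {c : ℕ → List E} {p n : ℕ}
    (hc : ∀ l < n, wt w (c l) = (κ l : Trop)) {d m : ℕ} (hd : m + d = n) {R : Finset ℕ}
    (hR : R ⊆ Finset.range n) {D : Finset (ℕ × ℕ)} (hD : ∀ l, (p, l) ∈ D → l < m)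
    {X : Finset ℕ} (hX : X ⊆ R) (hm : ∀ l ∈ X, m ≤ l) :
    SRun w ((List.range' m d).map fun l => exitOp p l (c l)) (R.disjSum D)
      ((R \ X).disjSum (D ∪ X.image (Prod.mk p)))
      ((∑ l ∈ (R \ X).filter (m ≤ ·), κ l : ℝ) : Trop) := by
  induction d generalizing m R D X with
  | zero =>
    have h1 : X = ∅ := by
      rw [Finset.eq_empty_iff_forall_notMem]
      intro l hl
      have := Finset.mem_range.1 (hR (hX hl))
      have := hm l hl
      omega
    subst h1
    rw [Finset.filter_false_of_mem]
    · simpa using SRun.nil _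
    · intro l hl
      have := Finset.mem_range.1 (hR (Finset.sdiff_subset hl))
      omega
  | succ d ih =>
    rw [List.range'_succ, List.map_cons]
    by_cases hmX : m ∈ X
    · have hRX : R.erase m \ X.erase m = R \ X := by
        ext a
        by_cases ham : a = m
        · subst ham; simp [hmX]
        · simp [ham]
      have hDX : insert (p, m) D ∪ (X.erase m).image (Prod.mk p) = D ∪ X.image (Prod.mk p) := by
        conv_rhs => rw [← Finset.insert_erase hmX, Finset.image_insert]
        rw [Finset.insert_union, Finset.union_insert]
      have h1 := ih (m := m + 1) (by omega) (R := R.erase m) (D := insert (p, m) D)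
        (X := X.erase m) ((Finset.erase_subset _ _).trans hR) (by
          intro l hl
          rcases Finset.mem_insert.1 hl with h | h
          · cases h; omega
          · have := hD l h; omega) (Finset.erase_subset_erase _ hX) (by
          intro l hl
          have h1 := hm l (Finset.mem_of_mem_erase hl)
          have h2 := Finset.ne_of_mem_erase hl
          omega)
      rw [hRX, hDX, ← exit_disjSum] at h1
      have h2 := SRun.move (o := exitOp p m (c m)) (by simpa [exitOp] using hX hmX)
        (by simpa [exitOp] using fun h => lt_irrefl m (hD m h)) h1
      rw [sum_filter_le _ m, if_neg (by simp [hmX])]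
      exact h2
    · have h1 := ih (m := m + 1) (by omega) hR (D := D) (fun l hl => by have := hD l hl; omega) hX
        (fun l hl => by
          have h1 := hm l hl
          have h2 : l ≠ m := fun h => hmX (h ▸ hl)
          omega)
      have h2 := SRun.stay (o := exitOp p m (c m)) h1
      rw [sum_filter_le _ m]
      convert h2 using 2
      rw [Op.stayWt]
      simp [exitOp, hc m (by omega), hmX]

/-- The net `N` consists of the slants `s`, up to the change of the weights by the potentials `κ`
before and `κ'` after it. -/
structure GaugeNet (n : ℕ) (w : E → Trop) (κ κ' : ℕ → ℝ) (N : Net E) (s : List (ℕ × ℝ)) :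
    Prop where
  enter_eq : ∀ l < n, wt w (N.enter l) = ((κ' l - κ l : ℝ) : Trop)
  slants_eq : List.Forall₂ (GaugeOp w κ') N.slants s

/-- `GaugeNet` for all nets of a system. -/
inductive GaugeSys (n : ℕ) (w : E → Trop) (κ : ℕ → ℕ → ℝ) :
    ℕ → List (Net E) → List (List (ℕ × ℝ)) → Prop
  | nil (p : ℕ) : GaugeSys n w κ p [] []
  | cons {p : ℕ} {N : Net E} {Ns : List (Net E)} {s : List (ℕ × ℝ)} {ss : List (List (ℕ × ℝ))}
      (h : GaugeNet n w (κ p) (κ (p + 1)) N s) (h' : GaugeSys n w κ (p + 1) Ns ss) :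
      GaugeSys n w κ p (N :: Ns) (s :: ss)

/-- The positions given by the points `J` on the verticals `p, …, p + d`, the last one being not
left, together with `D`. -/
def finalPos (p d : ℕ) (J : ℕ → Finset ℕ) (D : Finset (ℕ × ℕ)) : Finset Pos :=
  (J (p + d)).disjSum (D ∪ (Finset.range d).biUnion fun q => (J (p + q)).image (Prod.mk (p + q)))

theorem finalPos_zero (p : ℕ) (J : ℕ → Finset ℕ) (D : Finset (ℕ × ℕ)) :
    finalPos p 0 J D = (J p).disjSum D := by
  simp [finalPos]

theorem finalPos_succ (p d : ℕ) (J : ℕ → Finset ℕ) (D : Finset (ℕ × ℕ)) :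
    finalPos p (d + 1) J D = finalPos (p + 1) d J (D ∪ (J p).image (Prod.mk p)) := by
  rw [finalPos, finalPos]
  congr 1
  · congr 1; omega
  · rw [Finset.range_add_one', Finset.biUnion_insert, Finset.union_assoc, Finset.map_eq_image,
      Finset.image_biUnion]
    congr 2
    refine Finset.biUnion_congr rfl fun q _ => ?_
    change (J (p + (q + 1))).image (Prod.mk (p + (q + 1))) = _
    rw [show p + (q + 1) = p + 1 + q by omega]

/-- The value of the potentials at the points `J`. -/
def pot (κ : ℕ → ℕ → ℝ) (p d : ℕ) (J : ℕ → Finset ℕ) : ℝ :=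
  ∑ q ∈ Finset.range (d + 1), ∑ l ∈ J (p + q), κ (p + q) l

theorem pot_zero (κ : ℕ → ℕ → ℝ) (p : ℕ) (J : ℕ → Finset ℕ) :
    pot κ p 0 J = ∑ l ∈ J p, κ p l := by
  simp [pot]

theorem pot_succ (κ : ℕ → ℕ → ℝ) (p d : ℕ) (J : ℕ → Finset ℕ) :
    pot κ p (d + 1) J = ∑ l ∈ J p, κ p l + pot κ (p + 1) d J := by
  rw [pot, Finset.sum_range_succ', add_comm, pot]
  congr 1
  refine Finset.sum_congr rfl fun q _ => ?_
  rw [show p + (q + 1) = p + 1 + q by omega]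

theorem NRun.congr {p : ℕ} {ss : List (List (ℕ × ℝ))} {R : Finset ℕ} {J J' : ℕ → Finset ℕ} {Y : ℝ}
    (h : NRun p ss R J Y) (hJ : ∀ q, p ≤ q → q ≤ p + ss.length → J q = J' q) :
    NRun p ss R J' Y := by
  induction ss generalizing p R Y with
  | nil => rw [NRun, ← hJ p le_rfl (Nat.le_add_right _ _)]; exact h
  | cons s ss ih =>
    obtain ⟨h1, R', Y₁, Y₂, h2, h3, h4⟩ := h
    rw [List.length_cons] at hJ
    have hp := hJ p le_rfl (Nat.le_add_right _ _)
    exact ⟨hp ▸ h1, R', Y₁, Y₂, hp ▸ h2, ih h3 fun q hq hq' => hJ q (by omega) (by omega), h4⟩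

variable {n : ℕ} {w : E → Trop} {κ : ℕ → ℕ → ℝ}

/-- The potentials telescope over all verticals: each particle contributes the potential of its end
point minus that of its starting point, whatever its route. -/
theorem SRun.nRun {p : ℕ} {Ns : List (Net E)} {ss : List (List (ℕ × ℝ))}
    (h : GaugeSys n w κ p Ns ss) {R : Finset ℕ} (hR : R ⊆ Finset.range n) {D : Finset (ℕ × ℕ)}
    {T : Finset Pos} {W : Trop} (hr : SRun w (sysOps n p Ns) (R.disjSum D) T W) :
    ∃ J Y, NRun p ss R J Y ∧ T = finalPos p ss.length J D ∧
      W = ((Y + pot κ p ss.length J - ∑ l ∈ R, κ p l : ℝ) : Trop) := by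
  induction h generalizing R D W with
  | nil p =>
    rw [sysOps] at hr
    cases hr
    exact ⟨fun _ => R, 0, ⟨rfl, rfl⟩, by simp [finalPos_zero], by simp [pot_zero]⟩
  | @cons p N Ns s ss h _ ih =>
    rw [sysOps] at hr
    obtain ⟨M, W₁, W', h1, h', rfl⟩ := hr.split
    obtain ⟨M', W₂, W₃, h2, h3, rfl⟩ := h'.split
    rw [exitOps, List.range_eq_range'] at h1
    obtain ⟨X, hX, -, rfl, rfl⟩ := h1.exits h.enter_eq (Nat.zero_add n) hR
    obtain ⟨R', Y₁, h4, rfl, rfl⟩ := h2.yRun h.slants_eq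
    obtain ⟨J, Y₂, h5, rfl, rfl⟩ := ih (h4.subset_range (Finset.sdiff_subset.trans hR)) h3
    have hJ : ∀ q, p + 1 ≤ q → J q = Function.update J p X q :=
      fun q hq => by rw [Function.update_of_ne (by omega)]
    refine ⟨Function.update J p X, Y₁ + Y₂, ?_, ?_, ?_⟩
    · refine ⟨by simpa using hX, R', Y₁, Y₂, by simpa using h4,
        h5.congr fun q hq _ => hJ q hq, rfl⟩
    · rw [List.length_cons, finalPos_succ, Function.update_self, finalPos, finalPos,
        ← hJ _ (by omega)]
      congr 2
      refine Finset.biUnion_congr rfl fun q _ => ?_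
      rw [← hJ _ (by omega)]
    · rw [List.length_cons, pot_succ, Function.update_self, ← WithBot.coe_add, ← WithBot.coe_add,
        Finset.filter_true_of_mem (by simp), Finset.sum_sub_distrib,
        ← Finset.sum_sdiff hX (f := κ p)]
      have : pot κ (p + 1) ss.length (Function.update J p X) = pot κ (p + 1) ss.length J := by
        refine Finset.sum_congr rfl fun q _ => ?_
        rw [← hJ _ (by omega)]
      rw [this]
      congr 1
      ring

theorem NRun.sRun {p : ℕ} {Ns : List (Net E)} {ss : List (List (ℕ × ℝ))}
    (h : GaugeSys n w κ p Ns ss) {R : Finset ℕ} (hR : R ⊆ Finset.range n) {D : Finset (ℕ × ℕ)}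
    (hD : ∀ q ∈ D, q.1 < p) {J : ℕ → Finset ℕ} {Y : ℝ} (hr : NRun p ss R J Y) :
    SRun w (sysOps n p Ns) (R.disjSum D) (finalPos p ss.length J D)
      ((Y + pot κ p ss.length J - ∑ l ∈ R, κ p l : ℝ) : Trop) := by
  induction h generalizing R D Y with
  | nil p =>
    obtain ⟨h1, rfl⟩ := hr
    rw [sysOps, List.length_nil, finalPos_zero, pot_zero, h1]
    simpa using SRun.nil _
  | @cons p N Ns s ss h _ ih =>
    obtain ⟨h1, R', Y₁, Y₂, h2, h3, rfl⟩ := hr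
    have hR' : R \ J p ⊆ Finset.range n := Finset.sdiff_subset.trans hR
    have e1 := sRun_exits h.enter_eq (p := p) (Nat.zero_add n) hR
      (D := D) (fun l hl => absurd (hD _ hl) (lt_irrefl p)) h1 fun l _ => Nat.zero_le l
    have e2 := h2.sRun h.slants_eq (D ∪ (J p).image (Prod.mk p))
    have e3 := ih (h2.subset_range hR') (D := D ∪ (J p).image (Prod.mk p)) (by
      intro q hq
      rcases Finset.mem_union.1 hq with hq | hq
      · exact (hD q hq).trans (Nat.lt_succ_self p)
      · obtain ⟨l, -, rfl⟩ := Finset.mem_image.1 hq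
        exact Nat.lt_succ_self p) h3
    rw [sysOps, exitOps, List.range_eq_range', List.length_cons, finalPos_succ]
    have e4 := e1.append (e2.append e3)
    rw [← WithBot.coe_add, ← WithBot.coe_add, Finset.filter_true_of_mem (by simp),
      Finset.sum_sub_distrib] at e4
    convert e4 using 2
    rw [pot_succ, ← Finset.sum_sdiff h1 (f := κ p)]
    ring

/-- Both descriptions treat the last vertical separately: particles there are still on lines and not
stored as departed. -/
theorem points_eq_finalPos {k : ℕ} (J : ℕ → Finset ℕ) :
    points k (fun q => J q) = finalPos 0 k J ∅ := by
  ext a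
  rw [mem_points, finalPos]
  simp only [zero_add, Finset.empty_union]
  rcases a with l | ⟨q, l⟩
  · rw [Finset.inl_mem_disjSum]
    constructor
    · rintro ⟨q, l', h, h'⟩
      rw [endPos] at h'
      split_ifs at h' with hq
      cases h'
      rwa [hq] at h
    · intro h
      exact ⟨Fin.last k, l, by simpa using h, by simp [endPos]⟩
  · rw [Finset.inr_mem_disjSum, Finset.mem_biUnion]
    constructor
    · rintro ⟨q', l', h, h'⟩
      rw [endPos] at h'
      split_ifs at h' with hq
      cases h'
      have := q'.2
      exact ⟨q', Finset.mem_range.2 (by omega), Finset.mem_image_of_mem _ h⟩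
    · rintro ⟨q', hq', h⟩
      obtain ⟨l', h, h'⟩ := Finset.mem_image.1 h
      cases h'
      have hq' := Finset.mem_range.1 hq'
      refine ⟨⟨q, by omega⟩, l, h, ?_⟩
      rw [endPos, if_neg (by simp only; omega)]

theorem allLines_eq_disjSum (n : ℕ) : allLines n = (Finset.range n).disjSum ∅ := by
  ext (a | q) <;> simp [allLines]

end

end TropHorn

/-! ### Optimality of lowest end points; weightless padding -/

namespace TropHorn

/-! ### Optimal runs -/

section

variable {E : Type} {n k : ℕ} {w : E → Trop} {κ : ℕ → ℕ → ℝ} {Ns : List (Net E)}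
  {ss : List (List (ℕ × ℝ))}

theorem GaugeSys.length_eq {p : ℕ} (h : GaugeSys n w κ p Ns ss) : Ns.length = ss.length := by
  induction h with
  | nil => rfl
  | cons _ _ ih => rw [List.length_cons, List.length_cons, ih]

theorem NRun.le_opt (h : GaugeSys n w κ 0 Ns ss) (hk : ss.length = k) {J : ℕ → Finset ℕ} {Y : ℝ}
    (hr : NRun 0 ss (Finset.range n) J Y) :
    ((Y + pot κ 0 k J - ∑ l ∈ Finset.range n, κ 0 l : ℝ) : Trop) ≤
      opt w (sysOps n 0 Ns) (allLines n) (points k fun q => J q) := by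
  subst hk
  rw [points_eq_finalPos, allLines_eq_disjSum]
  exact (hr.sRun h subset_rfl (by simp)).le_opt

/-- A run in a gauged system has real weight, so `⊥` can only mean that there is no run. Otherwise
the end set of an optimal run determines the sets of leaving particles on the verticals up to the
last. -/
theorem opt_eq_bot_or (h : GaugeSys n w κ 0 Ns ss) (hk : ss.length = k) (J : ℕ → Finset ℕ) :
    opt w (sysOps n 0 Ns) (allLines n) (points k fun q => J q) = ⊥ ∨
      ∃ Y, NRun 0 ss (Finset.range n) J Y ∧
        opt w (sysOps n 0 Ns) (allLines n) (points k fun q => J q) =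
          ((Y + pot κ 0 k J - ∑ l ∈ Finset.range n, κ 0 l : ℝ) : Trop) := by
  subst hk
  by_cases hbot : opt w (sysOps n 0 Ns) (allLines n) (points ss.length fun q => J q) = ⊥
  · exact Or.inl hbot
  · have h1 := exists_sRun_opt hbot
    generalize opt w (sysOps n 0 Ns) (allLines n) (points ss.length fun q => J q) = W at h1
    rw [allLines_eq_disjSum] at h1
    obtain ⟨J', Y, h2, h3, h4⟩ := h1.nRun h subset_rfl
    rw [← points_eq_finalPos] at h3
    have h5 : ∀ q ≤ ss.length, J' q = J q := by
      intro q hq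
      ext l
      have h6 := endPos_mem_points (J := fun q => J q) (p := ⟨q, Nat.lt_succ_of_le hq⟩) (l := l)
      rw [h3, endPos_mem_points] at h6
      exact h6
    have h7 : pot κ 0 ss.length J' = pot κ 0 ss.length J := by
      refine Finset.sum_congr rfl fun q hq => ?_
      have := Finset.mem_range.1 hq
      rw [h5 _ (by omega)]
    exact Or.inr ⟨Y, h2.congr fun q _ hq => h5 q (by omega), by rw [h4, h7]⟩

/-- For each type there is a run to the lowest points that is optimal among the runs of this
type. -/
def GZRuns (n : ℕ) (κ : ℕ → ℕ → ℝ) (ss : List (List (ℕ × ℝ))) : Prop :=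
  ∀ u : ℕ → ℕ, ∑ q ∈ Finset.range (ss.length + 1), u q = n →
    ∃ Y₀, NRun 0 ss (Finset.range n) (fun q => Finset.range (u q)) Y₀ ∧
      ∀ J Y, (∀ q ≤ ss.length, (J q).card = u q) → NRun 0 ss (Finset.range n) J Y →
        Y + pot κ 0 ss.length J ≤ Y₀ + pot κ 0 ss.length fun q => Finset.range (u q)

/-- True weights and gauge weights corrected by `pot` differ by the potential of the initial
positions, which is the same for all runs. -/
theorem multiGZ_of_gzRuns {w : Weighting (stdNets n k)}
    (h : GaugeSys n (edgeWt w) κ 0 (stdSys n k) ss) (hgz : GZRuns n κ ss) :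
    MultiGZ (stdNets n k) w := by
  have hk : ss.length = k := by rw [← h.length_eq, length_stdSys]
  refine multiGZ_of_opt fun α => ?_
  set u : ℕ → ℕ := fun q => if hq : q < k + 1 then baryOf α ⟨q, hq⟩ else 0 with hudef
  have hu : ∀ q : Fin (k + 1), u q = baryOf α q := fun q => by rw [hudef]; exact dif_pos q.2
  have hlow : lowest k (baryOf α) = points k fun q => Finset.range (u q) := by
    rw [lowest_eq_points]
    congr 1
    funext q
    rw [hu]
  obtain ⟨Y₀, h1, h2⟩ := hgz u (by
    rw [hk, Finset.sum_range]
    simp only [hu]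
    exact sum_baryOf α)
  have h3 := h1.le_opt h hk
  rw [hlow]
  refine ⟨fun hbot => ?_, fun J _ hJ => ?_⟩
  · rw [stdOpt] at hbot
    rw [hbot] at h3
    exact absurd (le_bot_iff.1 h3) (WithBot.coe_ne_bot)
  · set J' : ℕ → Finset ℕ := fun q => if hq : q < k + 1 then J ⟨q, hq⟩ else ∅ with hJdef
    have hJ' : ∀ q : Fin (k + 1), J' q = J q := fun q => by rw [hJdef]; exact dif_pos q.2
    have h4 : points k J = points k fun q => J' q := by
      congr 1
      funext q
      rw [hJ']
    rw [h4]
    rcases opt_eq_bot_or h hk J' with h5 | ⟨Y, h5, h6⟩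
    · rw [stdOpt, h5]; exact bot_le
    · rw [stdOpt, h6]
      refine le_trans ?_ h3
      have h7 := h2 J' Y (fun q hq => by
        have := hJ ⟨q, by omega⟩
        rw [← hJ', ← hu] at this
        exact this) h5
      rw [hk] at h7
      exact WithBot.coe_le_coe.2 (by linarith)

theorem nRun_succ {p : ℕ} {R : Finset ℕ} {J : ℕ → Finset ℕ} {Y : ℝ} :
    NRun (p + 1) ss R J Y ↔ NRun p ss R (fun q => J (q + 1)) Y := by
  induction ss generalizing p R Y with
  | nil => rfl
  | cons s ss ih => simp only [NRun, ih]

theorem pot_succ_left (p d : ℕ) (J : ℕ → Finset ℕ) :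
    pot κ (p + 1) d J = pot (fun q => κ (q + 1)) p d fun q => J (q + 1) := by
  refine Finset.sum_congr rfl fun q _ => ?_
  rw [show p + 1 + q = p + q + 1 by omega]

theorem pot_succ_right (p d : ℕ) (J : ℕ → Finset ℕ) :
    pot κ p (d + 1) J = pot κ p d J + ∑ l ∈ J (p + d + 1), κ (p + d + 1) l := by
  rw [pot, Finset.sum_range_succ, pot]
  rfl

/-- If all lines below the highest occupied one are occupied, no particle has a free line to move
to. -/
theorem YRun.range_eq {s : List (ℕ × ℝ)} {J : Finset ℕ} {Y : ℝ}
    (h : YRun s (Finset.range n) J Y) : J = Finset.range n ∧ Y = 0 := by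
  induction s generalizing Y with
  | nil => cases h; exact ⟨rfl, rfl⟩
  | cons z s ih =>
    cases h with
    | stay h => exact ih h
    | move h₁ h₂ h =>
      rw [Finset.mem_range] at h₁ h₂
      omega

theorem YRun.empty_eq {s : List (ℕ × ℝ)} {J : Finset ℕ} {Y : ℝ} (h : YRun s ∅ J Y) :
    J = ∅ ∧ Y = 0 := by
  have := YRun.range_eq (n := 0) (s := s) (J := J) (Y := Y) (by simpa using h)
  simpa using this

/-- The condition is applied with no particle leaving at the first vertical. All lines then stay
occupied, nothing moves in the first net, and only the later nets count. -/
theorem GZRuns.tail {s : List (ℕ × ℝ)} (h : GZRuns n κ (s :: ss)) :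
    GZRuns n (fun q => κ (q + 1)) ss := by
  intro u hu
  obtain ⟨Y₀, h1, h2⟩ := h (fun q => if q = 0 then 0 else u (q - 1)) (by
    rw [List.length_cons, Finset.sum_range_succ']
    simpa using hu)
  have hpot : ∀ J : ℕ → Finset ℕ, J 0 = ∅ → pot κ 0 (s :: ss).length J =
      pot (fun q => κ (q + 1)) 0 ss.length fun q => J (q + 1) := by
    intro J hJ
    rw [List.length_cons, pot_succ, hJ, Finset.sum_empty, zero_add, pot_succ_left]
  obtain ⟨-, R', Y₁, Y₂, h3, h4, rfl⟩ := h1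
  simp only [if_true, Finset.range_zero, Finset.sdiff_empty] at h3
  obtain ⟨rfl, rfl⟩ := h3.range_eq
  rw [nRun_succ] at h4
  refine ⟨Y₂, h4, fun J Y hJ hr => ?_⟩
  have h5 := h2 (fun q => if q = 0 then ∅ else J (q - 1)) Y (fun q hq => by
    rw [List.length_cons] at hq
    by_cases h0 : q = 0
    · simp [h0]
    · simp only [h0, if_false]
      exact hJ _ (by omega)) (by
    refine ⟨by simp, Finset.range n, 0, Y, ?_, ?_, by simp⟩
    · simpa using YRun.refl s _
    · rw [nRun_succ]
      exact hr)
  rw [hpot _ rfl, hpot _ (by simp)] at h5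
  simpa using h5

/-- If nobody arrives at the last vertical, all remaining particles have left before the last net,
and this net is idle. -/
theorem nRun_concat {s : List (ℕ × ℝ)} {p : ℕ} {R : Finset ℕ} {J : ℕ → Finset ℕ} {Y : ℝ}
    (hJ : J (p + ss.length + 1) = ∅) : NRun p (ss ++ [s]) R J Y ↔ NRun p ss R J Y := by
  induction ss generalizing p R Y with
  | nil =>
    simp only [List.length_nil, add_zero] at hJ
    simp only [List.nil_append, NRun, hJ]
    constructor
    · rintro ⟨h1, R', Y₁, Y₂, h2, ⟨rfl, rfl⟩, rfl⟩
      have h3 : R \ J p = ∅ := by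
        rw [← Finset.card_eq_zero, ← h2.card_eq, Finset.card_empty]
      rw [h3] at h2
      refine ⟨Finset.Subset.antisymm h1 (Finset.sdiff_eq_empty_iff_subset.1 h3), ?_⟩
      rw [h2.empty_eq.2, add_zero]
    · rintro ⟨rfl, rfl⟩
      exact ⟨subset_rfl, ∅, 0, 0, by simpa using YRun.refl s ∅, ⟨rfl, rfl⟩, by simp⟩
  | cons s' ss ih =>
    rw [List.length_cons] at hJ
    have hJ' : J (p + 1 + ss.length + 1) = ∅ := by rw [← hJ]; congr 1; omega
    simp only [List.cons_append, NRun, ih hJ']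

theorem GZRuns.dropLast {s : List (ℕ × ℝ)} (h : GZRuns n κ (ss ++ [s])) : GZRuns n κ ss := by
  have hlen : (ss ++ [s]).length = ss.length + 1 := by simp
  intro u hu
  obtain ⟨Y₀, h1, h2⟩ := h (fun q => if q = ss.length + 1 then 0 else u q) (by
    rw [hlen, Finset.sum_range_succ, if_pos rfl, add_zero, ← hu]
    refine Finset.sum_congr rfl fun q hq => ?_
    have := Finset.mem_range.1 hq
    rw [if_neg (by omega)])
  have hpot : ∀ J J' : ℕ → Finset ℕ, J (ss.length + 1) = ∅ → (∀ q ≤ ss.length, J q = J' q) →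
      pot κ 0 (ss ++ [s]).length J = pot κ 0 ss.length J' := by
    intro J J' hJ hJ'
    rw [hlen, pot_succ_right, zero_add, hJ, Finset.sum_empty, add_zero]
    refine Finset.sum_congr rfl fun q hq => ?_
    have := Finset.mem_range.1 hq
    rw [hJ' _ (by omega)]
  rw [nRun_concat (by simp)] at h1
  refine ⟨Y₀, h1.congr fun q _ hq => by rw [if_neg (by omega)], fun J Y hJ hr => ?_⟩
  have h5 := h2 (fun q => if q = ss.length + 1 then ∅ else J q) Y (fun q hq => by
    by_cases h0 : q = ss.length + 1
    · simp [h0]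
    · simp only [h0, if_false]
      exact hJ _ (by omega)) (by
    rw [nRun_concat (by simp)]
    exact hr.congr fun q _ hq => by rw [if_neg (by omega)])
  rw [hpot _ J (by simp) (fun q hq => by rw [if_neg (by omega)]),
    hpot _ (fun q => Finset.range (u q)) (by simp)
      (fun q hq => by rw [if_neg (by omega)])] at h5
  exact h5

end

/-! ### Moving particles down -/

/-- One particle moves down by one line. -/
def Down (A B : Finset ℕ) : Prop := ∃ l, l + 1 ∈ A ∧ l ∉ A ∧ B = insert l (A.erase (l + 1))

theorem down_subset_range {A B : Finset ℕ} {n : ℕ} (h : Relation.ReflTransGen Down A B)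
    (hA : A ⊆ Finset.range n) : B ⊆ Finset.range n := by
  induction h with
  | refl => exact hA
  | tail _ h ih =>
    obtain ⟨l, h1, -, rfl⟩ := h
    exact slide_subset h1 ih

theorem down_range_eq {B : Finset ℕ} {n : ℕ} (h : Relation.ReflTransGen Down (Finset.range n) B) :
    B = Finset.range n := by
  rcases Relation.ReflTransGen.cases_head h with h | ⟨C, ⟨l, h1, h2, -⟩, -⟩
  · exact h.symm
  · rw [Finset.mem_range] at h1 h2
    omega

/-- A set of lines above `i` from which no particle can move down is an interval. -/
theorem eq_Ico_of_stuck {T : Finset ℕ} {i : ℕ} (hi : ∀ l ∈ T, i ≤ l)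
    (h : ∀ l, i ≤ l → l + 1 ∈ T → l ∈ T) : T = Finset.Ico i (i + T.card) := by
  rcases T.eq_empty_or_nonempty with rfl | hne
  · simp
  · have hmem : ∀ d l, i ≤ l → l + d = T.max' hne → l ∈ T := by
      intro d
      induction d with
      | zero => intro l _ hl; rw [add_zero] at hl; rw [hl]; exact T.max'_mem hne
      | succ d ih => intro l hil hl; exact h l hil (ih (l + 1) (by omega) (by omega))
    have hT : T = Finset.Ico i (T.max' hne + 1) := by
      ext l
      rw [Finset.mem_Ico]
      constructor
      · intro hl
        exact ⟨hi l hl, Nat.lt_succ_of_le (T.le_max' l hl)⟩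
      · rintro ⟨h1, h2⟩
        exact hmem (T.max' hne - l) l h1 (by omega)
    have hle := hi _ (T.max'_mem hne)
    have hcard : T.card = T.max' hne + 1 - i := by
      conv_lhs => rw [hT]
      rw [Nat.card_Ico]
    rw [hcard, show i + (T.max' hne + 1 - i) = T.max' hne + 1 by omega]
    exact hT

theorem sum_slide_id {R : Finset ℕ} {l : ℕ} (h₁ : l + 1 ∈ R) (h₂ : l ∉ R) :
    ∑ i ∈ insert l (R.erase (l + 1)), i + 1 = ∑ i ∈ R, i := by
  rw [Finset.sum_insert fun h => h₂ (Finset.mem_of_mem_erase h),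
    ← Finset.add_sum_erase R (fun i => i) h₁]
  omega

/-- As long as some line from `i` on is free just below a particle, that particle moves down and the
sum of the lines drops. At the end `eq_Ico_of_stuck` applies. -/
theorem down_Ico {T : Finset ℕ} {i : ℕ} (hi : ∀ l ∈ T, i ≤ l) :
    Relation.ReflTransGen Down T (Finset.Ico i (i + T.card)) := by
  induction hs : ∑ l ∈ T, l using Nat.strong_induction_on generalizing T with
  | _ m ih =>
    by_cases h : ∀ l, i ≤ l → l + 1 ∈ T → l ∈ T
    · rw [← eq_Ico_of_stuck hi h]
    · push Not at h
      obtain ⟨l, hl, h1, h2⟩ := h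
      have h3 := sum_slide_id h1 h2
      refine Relation.ReflTransGen.head ⟨l, h1, h2, rfl⟩ ?_
      rw [← card_slide h1 h2]
      refine ih _ (by omega) (fun a ha => ?_) rfl
      rcases Finset.mem_insert.1 ha with rfl | ha
      · exact hl
      · exact hi a (Finset.mem_of_mem_erase ha)

/-- Particles at `T ∪ R` of which those at `T` leave can be rearranged so that those leaving are
lowest, the others coming down to `R` afterwards. -/
theorem exists_down_split {T R : Finset ℕ} (hd : Disjoint T R) :
    ∃ H : Finset ℕ, Disjoint (Finset.range T.card) H ∧
      Relation.ReflTransGen Down (T ∪ R) (Finset.range T.card ∪ H) ∧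
      Relation.ReflTransGen Down H R := by
  induction hs : ∑ l ∈ T, l using Nat.strong_induction_on generalizing T R with
  | _ m ih =>
    by_cases h : ∀ l, 0 ≤ l → l + 1 ∈ T → l ∈ T
    · have hT := eq_Ico_of_stuck (i := 0) (fun _ _ => Nat.zero_le _) h
      rw [zero_add, ← Finset.range_eq_Ico] at hT
      rw [← hT]
      exact ⟨R, hd, .refl, .refl⟩
    · push Not at h
      obtain ⟨l, -, h1, h2⟩ := h
      have h3 := sum_slide_id h1 h2
      have hR1 : l + 1 ∉ R := Finset.disjoint_left.1 hd h1
      by_cases h4 : l ∈ R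
      -- If the line `l` is taken by a particle of `R`, the two particles exchange roles. The union
      -- does not change, and the remaining particle, now on `l + 1`, makes up for it by a last step
      -- down to `l`.
      · obtain ⟨H, h5, h6, h7⟩ := ih _ (by omega) (T := insert l (T.erase (l + 1)))
          (R := insert (l + 1) (R.erase l)) (by
            rw [Finset.disjoint_left] at hd ⊢
            intro a ha ha'
            simp only [Finset.mem_insert, Finset.mem_erase] at ha ha'
            rcases ha with rfl | ha
            · rcases ha' with ha' | ha'
              · omega
              · exact ha'.1 rfl
            · rcases ha' with ha' | ha'
              · exact ha.1 ha'
              · exact hd ha.2 ha'.2) rfl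
        rw [card_slide h1 h2] at h5 h6
        refine ⟨H, h5, ?_, h7.tail ⟨l, by simp, by simp, ?_⟩⟩
        · convert h6 using 1
          ext a
          simp only [Finset.mem_union, Finset.mem_insert, Finset.mem_erase]
          constructor
          · rintro (h | h)
            · by_cases ha : a = l + 1 <;> simp [h, ha]
            · by_cases ha : a = l <;> simp [h, ha]
          · rintro ((rfl | h) | (rfl | h)) <;> simp_all
        · rw [Finset.erase_insert (by simp [hR1]), Finset.insert_erase h4]
      -- If the line `l` is free altogether, the leaving particle moves down to it before the
      -- vertical.
      · obtain ⟨H, h5, h6, h7⟩ := ih _ (by omega) (T := insert l (T.erase (l + 1)))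
          (R := R) (by
            rw [Finset.disjoint_left] at hd ⊢
            intro a ha ha'
            rcases Finset.mem_insert.1 ha with rfl | ha
            · exact h4 ha'
            · exact hd (Finset.mem_of_mem_erase ha) ha') rfl
        rw [card_slide h1 h2] at h5 h6
        refine ⟨H, h5, h6.head ⟨l, by simp [h1], by simp [h2, h4], ?_⟩, h7⟩
        rw [Finset.insert_union, Finset.erase_union_distrib, Finset.erase_eq_of_notMem hR1]

/-! ### Nets of weightless edges -/

/-- A sequence of slants of weight zero in the gauge given by `κ`. -/
def zSweep (κ : ℕ → ℝ) (n : ℕ) : List (ℕ × ℝ) :=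
  (List.range (n - 1)).map fun l => (l, κ (l + 1) - κ l)

/-- `zSweep`, repeated `K` times. -/
def zNet (κ : ℕ → ℝ) (n : ℕ) : ℕ → List (ℕ × ℝ)
  | 0 => []
  | K + 1 => zSweep κ n ++ zNet κ n K

theorem mem_zNet {κ : ℕ → ℝ} {n K : ℕ} {z : ℕ × ℝ} (h : z ∈ zNet κ n K) :
    z.1 + 1 < n ∧ z.2 = κ (z.1 + 1) - κ z.1 := by
  induction K with
  | zero => simp [zNet] at h
  | succ K ih =>
    rw [zNet, List.mem_append] at h
    rcases h with h | h
    · obtain ⟨l, hl, rfl⟩ := List.mem_map.1 h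
      have := List.mem_range.1 hl
      exact ⟨by simp only; omega, rfl⟩
    · exact ih h

theorem yRun_of_mem {s : List (ℕ × ℝ)} {z : ℕ × ℝ} (hz : z ∈ s) {A : Finset ℕ} (h₁ : z.1 + 1 ∈ A)
    (h₂ : z.1 ∉ A) : YRun s A (insert z.1 (A.erase (z.1 + 1))) z.2 := by
  induction s with
  | nil => simp at hz
  | cons z' s ih =>
    rcases List.mem_cons.1 hz with rfl | hz
    · simpa using YRun.move h₁ h₂ (YRun.refl s _)
    · exact .stay (ih hz)

/-- One sweep is spent on each single step down. Each step lowers the sum of the occupied lines by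
one, so this sum bounds the number of sweeps needed. -/
theorem yRun_zNet {κ : ℕ → ℝ} {n K : ℕ} {A B : Finset ℕ} (h : Relation.ReflTransGen Down A B)
    (hA : A ⊆ Finset.range n) (hK : ∑ l ∈ A, l ≤ K) :
    YRun (zNet κ n K) A B (∑ l ∈ A, κ l - ∑ l ∈ B, κ l) := by
  induction h using Relation.ReflTransGen.head_induction_on generalizing K with
  | refl => simpa using YRun.refl _ B
  | @head A C hAC _ ih =>
    obtain ⟨l, h1, h2, rfl⟩ := hAC
    have h3 := sum_slide_id h1 h2
    obtain ⟨K, rfl⟩ : ∃ K', K = K' + 1 := ⟨K - 1, by omega⟩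
    have h4 := ih (K := K) (slide_subset h1 hA) (by omega)
    have hl := Finset.mem_range.1 (hA h1)
    have h5 : YRun (zSweep κ n) A (insert l (A.erase (l + 1))) (κ (l + 1) - κ l) :=
      yRun_of_mem (z := (l, κ (l + 1) - κ l))
        (List.mem_map.2 ⟨l, List.mem_range.2 (by omega), rfl⟩) h1 h2
    have h6 := h5.append h4
    rw [sum_slide h1 h2] at h6
    have h7 : ∑ i ∈ A, κ i - ∑ l ∈ B, κ l = κ (l + 1) - κ l +
        (∑ i ∈ A, κ i + κ l - κ (l + 1) - ∑ l ∈ B, κ l) := by ring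
    rw [h7]
    exact h6

/-- The gauge weights are differences of one potential, so the weight depends only on the two ends
of the run. -/
theorem YRun.down {κ : ℕ → ℝ} {s : List (ℕ × ℝ)} {A B : Finset ℕ} {Y : ℝ} (h : YRun s A B Y)
    (hs : ∀ z ∈ s, z.2 = κ (z.1 + 1) - κ z.1) :
    Relation.ReflTransGen Down A B ∧ Y = ∑ l ∈ A, κ l - ∑ l ∈ B, κ l := by
  induction h with
  | nil => exact ⟨.refl, by simp⟩
  | stay _ ih => exact ih fun z hz => hs z (List.mem_cons_of_mem _ hz)
  | @move z s R J Y h₁ h₂ _ ih =>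
    obtain ⟨h3, rfl⟩ := ih fun z hz => hs z (List.mem_cons_of_mem _ hz)
    refine ⟨.head ⟨_, h₁, h₂, rfl⟩ h3, ?_⟩
    rw [sum_slide h₁ h₂, hs z List.mem_cons_self]
    ring

theorem YRun.nonpos {s : List (ℕ × ℝ)} {A B : Finset ℕ} {Y : ℝ} (h : YRun s A B Y)
    (hs : ∀ z ∈ s, z.2 ≤ 0) : Y ≤ 0 := by
  induction h with
  | nil => exact le_rfl
  | stay _ ih => exact ih fun z hz => hs z (List.mem_cons_of_mem _ hz)
  | @move z s R J Y h₁ h₂ _ ih =>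
    have h1 := ih fun z hz => hs z (List.mem_cons_of_mem _ hz)
    have h2 := hs z List.mem_cons_self
    linarith

/-- Each list of slants is put between two nets of weightless edges. -/
def padSys (κ : ℕ → ℕ → ℝ) (n : ℕ) : ℕ → List (List (ℕ × ℝ)) → List (List (ℕ × ℝ))
  | _, [] => []
  | p, s :: ss => (zNet (κ p) n (n * n) ++ (s ++ zNet (κ (p + 1)) n (n * n))) ::
      padSys κ n (p + 1) ss

theorem length_padSys (κ : ℕ → ℕ → ℝ) (n p : ℕ) (ss : List (List (ℕ × ℝ))) :
    (padSys κ n p ss).length = ss.length := by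
  induction ss generalizing p with
  | nil => rfl
  | cons s ss ih => rw [padSys, List.length_cons, List.length_cons, ih]

theorem sum_le_mul_self {A : Finset ℕ} {n : ℕ} (hA : A ⊆ Finset.range n) :
    ∑ l ∈ A, l ≤ n * n := by
  calc ∑ l ∈ A, l ≤ ∑ l ∈ Finset.range n, l := Finset.sum_le_sum_of_subset hA
    _ ≤ ∑ _l ∈ Finset.range n, n :=
      Finset.sum_le_sum fun l hl => (Finset.mem_range.1 hl).le
    _ = n * n := by simp

/-- At each vertical the particles of `S` are first brought down to `S'`, whose lowest points leave;
the rest comes down to the old `S \ J p` in the weightless net before `s`. The descent from `S` to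
`S'` belongs to the weightless net after the previous `s`, hence it is part of the conclusion.
Weightless moves trade gauge weight for potential, so the total is unchanged. -/
theorem NRun.pad {κ : ℕ → ℕ → ℝ} {n p : ℕ} {ss : List (List (ℕ × ℝ))} {S : Finset ℕ}
    {J : ℕ → Finset ℕ} {Y : ℝ} (hS : S ⊆ Finset.range n) (h : NRun p ss S J Y) :
    ∃ S' Y', Relation.ReflTransGen Down S S' ∧
      NRun p (padSys κ n p ss) S' (fun q => Finset.range (J q).card) Y' ∧
      Y' + (∑ l ∈ S, κ p l - ∑ l ∈ S', κ p l) +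
        pot κ p ss.length (fun q => Finset.range (J q).card) = Y + pot κ p ss.length J := by
  induction ss generalizing p S Y with
  | nil =>
    obtain ⟨rfl, rfl⟩ := h
    refine ⟨Finset.range (J p).card, 0, ?_, ⟨rfl, rfl⟩, ?_⟩
    · have := down_Ico (T := J p) (i := 0) fun _ _ => Nat.zero_le _
      rwa [zero_add, ← Finset.range_eq_Ico] at this
    · rw [List.length_nil, pot_zero, pot_zero]
      ring
  | cons s ss ih =>
    obtain ⟨h1, R', Y₁, Y₂, h2, h3, rfl⟩ := h
    have hR : S \ J p ⊆ Finset.range n := Finset.sdiff_subset.trans hS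
    have hR' := h2.subset_range hR
    obtain ⟨S₁, Y₃, h4, h5, h6⟩ := ih hR' h3
    obtain ⟨H, h7, h8, h9⟩ := exists_down_split (T := J p) (R := S \ J p) Finset.disjoint_sdiff
    rw [Finset.union_sdiff_of_subset h1] at h8
    have h10 := down_subset_range h8 hS
    have hH : H ⊆ Finset.range n := Finset.subset_union_right.trans h10
    have e1 := yRun_zNet (κ := κ p) (K := n * n) h9 hH (sum_le_mul_self hH)
    have e2 := yRun_zNet (κ := κ (p + 1)) (K := n * n) h4 hR' (sum_le_mul_self hR')
    refine ⟨Finset.range (J p).card ∪ H, ∑ l ∈ H, κ p l - ∑ l ∈ S \ J p, κ p l + (Y₁ +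
      (∑ l ∈ R', κ (p + 1) l - ∑ l ∈ S₁, κ (p + 1) l)) + Y₃, h8,
      ⟨Finset.subset_union_left, S₁, _, Y₃, ?_, h5, rfl⟩, ?_⟩
    · rw [Finset.union_sdiff_cancel_left h7]
      exact e1.append (h2.append e2)
    · rw [List.length_cons, pot_succ, pot_succ, Finset.sum_union h7]
      have := Finset.sum_sdiff h1 (f := κ p)
      linarith

end TropHorn

/-! ### Optimal runs through the net of a hive -/

namespace TropHorn

/-! ### Hives and nets -/

/-- The rhombus inequalities in a triangle. -/
structure Hive (n : ℕ) (h : ℕ → ℕ → ℝ) : Prop where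
  corner : ∀ i j, i + j + 2 ≤ n → h i j + h (i + 1) (j + 1) ≤ h (i + 1) j + h i (j + 1)
  left : ∀ i j, i + j + 2 ≤ n → h (i + 2) j + h i (j + 1) ≤ h (i + 1) j + h (i + 1) (j + 1)
  right : ∀ i j, i + j + 2 ≤ n → h i (j + 2) + h (i + 1) j ≤ h i (j + 1) + h (i + 1) (j + 1)

/-- Differences in the first direction. -/
def hdx (h : ℕ → ℕ → ℝ) (i j : ℕ) : ℝ := h (i + 1) j - h i j

/-- Differences in the second direction. -/
def hdy (h : ℕ → ℕ → ℝ) (i j : ℕ) : ℝ := h i (j + 1) - h i j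

/-- The slants `I + a - 1, …, I` of the `I`-th diagonal. -/
def hiveDiag (h : ℕ → ℕ → ℝ) (I : ℕ) : ℕ → List (ℕ × ℝ)
  | 0 => []
  | a + 1 => (I + a, hdx h a (I + 1) - hdx h a I) :: hiveDiag h I a

/-- The slants of the diagonals from the `I`-th one on. -/
def hiveSweep (h : ℕ → ℕ → ℝ) : ℕ → ℕ → List (ℕ × ℝ)
  | 0, _ => []
  | f + 1, I => hiveDiag h I f ++ hiveSweep h f (I + 1)

/-- What remains of the net when `a` slants of the `I`-th diagonal are still to be passed. -/
def hiveTail (h : ℕ → ℕ → ℝ) (f I a : ℕ) : List (ℕ × ℝ) := hiveDiag h I a ++ hiveSweep h f (I + 1)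

theorem hiveTail_zero (h : ℕ → ℕ → ℝ) (f I : ℕ) : hiveTail h f I 0 = hiveSweep h f (I + 1) := rfl

theorem hiveTail_succ (h : ℕ → ℕ → ℝ) (f I a : ℕ) : hiveTail h f I (a + 1) =
    (I + a, hdx h a (I + 1) - hdx h a I) :: hiveTail h f I a := rfl

theorem hiveSweep_succ (h : ℕ → ℕ → ℝ) (f I : ℕ) :
    hiveSweep h (f + 1) I = hiveTail h f I f := rfl

variable {n : ℕ} {h : ℕ → ℕ → ℝ}

theorem Hive.hdx_succ_right_le (hh : Hive n h) {i j : ℕ} (hij : i + j + 2 ≤ n) :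
    hdx h i (j + 1) ≤ hdx h i j := by
  have := hh.corner i j hij
  rw [hdx, hdx]
  linarith

theorem Hive.hdx_succ_le (hh : Hive n h) {i j : ℕ} (hij : i + j + 2 ≤ n) :
    hdx h (i + 1) j ≤ hdx h i (j + 1) := by
  have := hh.left i j hij
  rw [hdx, hdx]
  linarith

theorem Hive.hdy_succ_le (hh : Hive n h) {i j : ℕ} (hij : i + j + 2 ≤ n) :
    hdy h i (j + 1) ≤ hdy h (i + 1) j := by
  have := hh.right i j hij
  rw [hdy, hdy]
  linarith

theorem Hive.hdx_anti (hh : Hive n h) {l : ℕ} (hl : l + 1 < n) : hdx h (l + 1) 0 ≤ hdx h l 0 :=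
  (hh.hdx_succ_le (by omega)).trans (hh.hdx_succ_right_le (by omega))

theorem Hive.hdy_anti (hh : Hive n h) {l : ℕ} (hl : l + 1 < n) : hdy h 0 (l + 1) ≤ hdy h 0 l := by
  have h1 := hh.hdy_succ_le (i := 0) (j := l) (by omega)
  have h2 := hh.corner 0 l (by omega)
  rw [hdy, hdy] at *
  linarith

theorem mem_hiveDiag {I a : ℕ} {z : ℕ × ℝ} (hz : z ∈ hiveDiag h I a) :
    ∃ b < a, z = (I + b, hdx h b (I + 1) - hdx h b I) := by
  induction a with
  | zero => simp [hiveDiag] at hz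
  | succ a ih =>
    rw [hiveDiag] at hz
    rcases List.mem_cons.1 hz with rfl | hz
    · exact ⟨a, Nat.lt_succ_self a, rfl⟩
    · obtain ⟨b, hb, rfl⟩ := ih hz
      exact ⟨b, by omega, rfl⟩

theorem mem_hiveSweep {f I : ℕ} {z : ℕ × ℝ} (hz : z ∈ hiveSweep h f I) :
    ∃ b I', I ≤ I' ∧ b + I' + 2 ≤ I + f ∧ z = (I' + b, hdx h b (I' + 1) - hdx h b I') := by
  induction f generalizing I with
  | zero => simp [hiveSweep] at hz
  | succ f ih =>
    rw [hiveSweep, List.mem_append] at hz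
    rcases hz with hz | hz
    · obtain ⟨b, hb, rfl⟩ := mem_hiveDiag hz
      exact ⟨b, I, le_rfl, by omega, rfl⟩
    · obtain ⟨b, I', h1, h2, rfl⟩ := ih hz
      exact ⟨b, I', by omega, by omega, rfl⟩

/-- The `corner` rhombi are exactly the nonpositivity of the slants in this gauge. -/
theorem Hive.nonpos_of_mem (hh : Hive n h) {f I : ℕ} (hf : I + f ≤ n) {z : ℕ × ℝ}
    (hz : z ∈ hiveSweep h f I) : z.2 ≤ 0 := by
  obtain ⟨b, I', h1, h2, rfl⟩ := mem_hiveSweep hz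
  exact sub_nonpos.2 (hh.hdx_succ_right_le (by omega))

/-! ### Values of sets of lines -/

/-- The maximal weight of a run through the slants `s`, a particle arriving at the line `l` giving
an additional weight `κ l`. -/
noncomputable def val (κ : ℕ → ℝ) : List (ℕ × ℝ) → Finset ℕ → ℝ
  | [], R => ∑ l ∈ R, κ l
  | z :: s, R =>
    if z.1 + 1 ∈ R ∧ z.1 ∉ R then
      max (val κ s R) (z.2 + val κ s (insert z.1 (R.erase (z.1 + 1))))
    else val κ s R

section

variable {κ : ℕ → ℝ} {z : ℕ × ℝ} {s : List (ℕ × ℝ)} {R : Finset ℕ}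

theorem val_eq (hz : z.1 + 1 ∈ R → z.1 ∈ R) : val κ (z :: s) R = val κ s R := by
  rw [val, if_neg fun h => h.2 (hz h.1)]

theorem val_stay : val κ s R ≤ val κ (z :: s) R := by
  rw [val]
  split_ifs
  · exact le_max_left _ _
  · exact le_rfl

theorem val_move (h₁ : z.1 + 1 ∈ R) (h₂ : z.1 ∉ R) :
    z.2 + val κ s (insert z.1 (R.erase (z.1 + 1))) ≤ val κ (z :: s) R := by
  rw [val, if_pos ⟨h₁, h₂⟩]
  exact le_max_right _ _

theorem val_le {c : ℝ} (hs : val κ s R ≤ c) (hm : z.1 + 1 ∈ R → z.1 ∉ R →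
    z.2 + val κ s (insert z.1 (R.erase (z.1 + 1))) ≤ c) : val κ (z :: s) R ≤ c := by
  rw [val]
  split_ifs with h
  · exact max_le hs (hm h.1 h.2)
  · exact hs

theorem YRun.le_val {J : Finset ℕ} {Y : ℝ} (h : YRun s R J Y) :
    Y + ∑ l ∈ J, κ l ≤ val κ s R := by
  induction h with
  | nil => simp [val]
  | stay _ ih => exact ih.trans val_stay
  | move h₁ h₂ _ ih =>
    refine le_trans ?_ (val_move h₁ h₂)
    linarith

theorem val_append_of_stuck {s' : List (ℕ × ℝ)} (hs : ∀ z ∈ s, z.1 + 1 ∈ R → z.1 ∈ R) :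
    val κ (s ++ s') R = val κ s' R := by
  induction s with
  | nil => rfl
  | cons z s ih =>
    rw [List.cons_append, val_eq (hs z List.mem_cons_self)]
    exact ih fun z hz => hs z (List.mem_cons_of_mem _ hz)

theorem val_empty : val κ s ∅ = 0 := by
  induction s with
  | nil => simp [val]
  | cons z s ih => rw [val_eq (by simp), ih]

theorem slide_insert {a l : ℕ} (ha : a ≠ l + 1) :
    insert l ((insert a R).erase (l + 1)) = insert a (insert l (R.erase (l + 1))) := by
  rw [Finset.erase_insert_of_ne ha, Finset.insert_comm]

theorem slide_insert_self {l : ℕ} (h : l + 1 ∉ R) :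
    insert l ((insert (l + 1) R).erase (l + 1)) = insert l R := by
  rw [Finset.erase_insert h]

theorem notMem_slide {a l : ℕ} (ha : a ∉ R) (hal : a ≠ l) :
    a ∉ insert l (R.erase (l + 1)) := by
  simp [ha, hal]

/-- A particle below all the slants is a spectator: it neither moves nor blocks. -/
theorem val_insert_of_lt {c : ℕ} (hs : ∀ z ∈ s, c < z.1) (hc : c ∉ R) :
    val κ s (insert c R) = κ c + val κ s R := by
  induction s generalizing R with
  | nil => rw [val, val, Finset.sum_insert hc]
  | cons z s ih =>
    have hcz := hs z List.mem_cons_self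
    have ih' : ∀ R : Finset ℕ, c ∉ R → val κ s (insert c R) = κ c + val κ s R :=
      fun R hR => ih (fun z hz => hs z (List.mem_cons_of_mem _ hz)) hR
    rw [val, val, slide_insert (by omega), ih' R hc, ih' _ (notMem_slide hc (by omega))]
    have h1 : z.1 + 1 ∈ insert c R ↔ z.1 + 1 ∈ R := by
      rw [Finset.mem_insert]; constructor
      · rintro (h | h)
        · omega
        · exact h
      · exact Or.inr
    have h2 : z.1 ∈ insert c R ↔ z.1 ∈ R := by
      rw [Finset.mem_insert]; constructor
      · rintro (h | h)
        · omega
        · exact h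
      · exact Or.inr
    by_cases hz : z.1 + 1 ∈ R ∧ z.1 ∉ R
    · rw [if_pos hz, if_pos ⟨h1.2 hz.1, fun h => hz.2 (h2.1 h)⟩, ← max_add_add_left]
      congr 1
      ring
    · rw [if_neg hz, if_neg fun h => hz ⟨h1.1 h.1, fun h' => h.2 (h2.2 h')⟩]

/-- The value does not decrease when a particle moves down. -/
theorem val_insert_succ_le (hs : ∀ z ∈ s, z.2 ≤ 0) {c : ℕ} (hκ : κ (c + 1) ≤ κ c) (hc : c ∉ R)
    (hc' : c + 1 ∉ R) : val κ s (insert (c + 1) R) ≤ val κ s (insert c R) := by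
  induction s generalizing R with
  | nil =>
    rw [val, val, Finset.sum_insert hc, Finset.sum_insert hc']
    linarith
  | cons z s ih =>
    have ih' : ∀ R : Finset ℕ, c ∉ R → c + 1 ∉ R →
        val κ s (insert (c + 1) R) ≤ val κ s (insert c R) :=
      fun R h1 h2 => ih (fun z hz => hs z (List.mem_cons_of_mem _ hz)) h1 h2
    refine val_le ((ih' R hc hc').trans val_stay) fun h1 h2 => ?_
    by_cases hzc : z.1 = c
    -- The slant carries the extra particle from `c + 1` to `c` itself; this costs a nonpositive
    -- weight and leads to the set on the right.
    · rw [hzc, slide_insert_self hc']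
      have := hs z List.mem_cons_self
      have := val_stay (κ := κ) (z := z) (s := s) (R := insert c R)
      linarith
    · have h3 : z.1 + 1 ∈ R := by
        rcases Finset.mem_insert.1 h1 with h | h
        · omega
        · exact h
      have h4 : z.1 ∉ R := fun h => h2 (Finset.mem_insert_of_mem h)
      have h5 : z.1 ≠ c + 1 := fun h => h2 (h ▸ Finset.mem_insert_self _ _)
      have h6 : c ≠ z.1 + 1 := fun h => hc (h ▸ h3)
      rw [slide_insert (by omega)]
      refine le_trans ?_ (val_move (Finset.mem_insert_of_mem h3) (by simp [hzc, h4]))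
      rw [slide_insert h6]
      have := ih' _ (notMem_slide hc (Ne.symm hzc)) (notMem_slide hc' (Ne.symm h5))
      linarith

end

/-! ### Values in the net of a hive -/

/-- The potential on the line `I + d` when `a` slants of the `I`-th diagonal are still to be
passed. -/
noncomputable def hivePot (h : ℕ → ℕ → ℝ) (I a d : ℕ) : ℝ :=
  if d ≤ a then hdx h d I else hdx h (d - 1) (I + 1)

/-- A step down by one line raises the value by no more than the difference of the potentials: it
could have been made inside the net at that price. The case `d = a` must be excluded, because there
the slant between the two lines has just been passed. -/
theorem Hive.val_sub_le (hh : Hive n h) {κ : ℕ → ℝ} {f I a d : ℕ} (hf : I + f + 1 = n)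
    (ha : a ≤ f) (hd : d + 1 ≤ f) (hda : d ≠ a) {R : Finset ℕ} (h₁ : I + d ∉ R)
    (h₂ : I + d + 1 ∉ R) :
    val κ (hiveTail h f I a) (insert (I + d) R) - hivePot h I a d ≤
      val κ (hiveTail h f I a) (insert (I + d + 1) R) - hivePot h I a (d + 1) := by
  induction f generalizing I a d R with
  | zero => omega
  | succ f ihf =>
    induction a using Nat.strong_induction_on generalizing d R with
    | _ a ih =>
      rcases a with _ | a
      -- The diagonal `I` is exhausted; `hivePot` at its end agrees with `hivePot` at the start of
      -- the next diagonal, with `d` shifted by one.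
      · obtain ⟨d, rfl⟩ : ∃ d', d = d' + 1 := ⟨d - 1, by omega⟩
        have := ihf (I := I + 1) (a := f) (d := d) (R := R) (by omega) le_rfl (by omega) (by omega)
          (by rwa [show I + 1 + d = I + (d + 1) by omega])
          (by rwa [show I + 1 + d = I + (d + 1) by omega])
        rw [hiveTail_zero, hiveSweep_succ]
        rw [show I + 1 + d = I + (d + 1) by omega] at this
        simpa [hivePot, show d ≤ f by omega, show d + 1 ≤ f by omega] using this
      · rw [hiveTail_succ]
        by_cases h3 : d = a
        · subst h3
          rw [val_eq (fun _ => Finset.mem_insert_self _ _)]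
          have h4 := val_move (κ := κ) (z := (I + d, hdx h d (I + 1) - hdx h d I))
            (s := hiveTail h (f + 1) I d) (R := insert (I + d + 1) R) (by simp) (by simp [h₁])
          rw [slide_insert_self h₂] at h4
          -- The next slant joins just these two lines. Using it for the upper particle gives the
          -- comparison, and the `left` rhombus compares its weight with the difference of
          -- potentials.
          have h5 := hh.hdx_succ_le (i := d) (j := I) (by omega)
          rw [hivePot, hivePot, if_pos (by omega), if_pos (by omega)]
          simp only at h4
          linarith
        · by_cases h4 : a = d + 1
          · subst h4
            have h5 := ih (d + 1) (by omega) (d := d) (R := R) (by omega) (by omega) (by omega)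
              h₁ h₂
            have h6 := val_stay (κ := κ) (z := (I + (d + 1), hdx h (d + 1) (I + 1) -
              hdx h (d + 1) I)) (s := hiveTail h (f + 1) I (d + 1)) (R := insert (I + d + 1) R)
            rw [hivePot, hivePot, if_pos (by omega), if_pos (by omega)] at h5 ⊢
            rw [sub_le_iff_le_add]
            refine val_le (by linarith) fun h7 _ => ?_
            simp only at h7 ⊢
            -- In the critical case a third particle slides from `I + d + 2` to `I + d + 1` above
            -- the lower one and thereby blocks the slant `I + d`. On the other side the third
            -- particle is left in place and the upper particle takes the slant `I + d`. The two
            -- configurations again differ by one step, now with `d + 1` in place of `d`.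
            have h8 : I + d + 1 + 1 ∈ R := by
              rcases Finset.mem_insert.1 h7 with h | h
              · omega
              · exact h
            set R₀ := R.erase (I + d + 1 + 1) with hR₀
            have hR : R = insert (I + d + 1 + 1) R₀ := (Finset.insert_erase h8).symm
            have h9 : insert (I + (d + 1)) ((insert (I + d) R).erase (I + (d + 1) + 1)) =
                insert (I + d + 1) (insert (I + d) R₀) := by
              rw [slide_insert (by omega), Finset.insert_comm]
              rfl
            rw [h9, hiveTail_succ, val_eq (by simp)]
            have h10 := val_move (κ := κ) (z := (I + d, hdx h d (I + 1) - hdx h d I))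
              (s := hiveTail h (f + 1) I d) (R := insert (I + d + 1) R) (by simp) (by simp [h₁])
            rw [slide_insert_self h₂] at h10
            have h11 := ih d (by omega) (d := d + 1) (R := insert (I + d) R₀) (by omega)
              (by omega) (by omega)
              (by
                rw [Finset.mem_insert, not_or]
                exact ⟨by omega, fun h => h₂ (Finset.mem_of_mem_erase h)⟩)
              (by
                rw [Finset.mem_insert, not_or]
                exact ⟨by omega, Finset.notMem_erase _ _⟩)
            rw [Finset.insert_comm (I + (d + 1) + 1), show I + (d + 1) + 1 = I + d + 1 + 1 by omega,
              ← hR, show I + (d + 1) = I + d + 1 by omega] at h11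
            rw [hivePot, hivePot, if_neg (by omega), if_neg (by omega)] at h11
            simp only [Nat.add_sub_cancel] at h11
            rw [hiveTail_succ] at h6
            simp only at h10
            linarith
          -- Here the slant touches neither of the two lines, so both sides treat it in the same
          -- way.
          · have hp1 : hivePot h I (a + 1) d = hivePot h I a d := by
              rw [hivePot, hivePot]
              split_ifs <;> first | rfl | omega
            have hp2 : hivePot h I (a + 1) (d + 1) = hivePot h I a (d + 1) := by
              rw [hivePot, hivePot]
              split_ifs <;> first | rfl | omega
            rw [hp1, hp2]
            rw [sub_le_iff_le_add]
            refine val_le ?_ fun h5 h6 => ?_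
            · have h5 := ih a (by omega) (d := d) (R := R) (by omega) hd h3 h₁ h₂
              have h6 := val_stay (κ := κ) (z := (I + a, hdx h a (I + 1) - hdx h a I))
                (s := hiveTail h (f + 1) I a) (R := insert (I + d + 1) R)
              linarith
            · simp only at h5 h6 ⊢
              have h7 : I + a + 1 ∈ R := by
                rcases Finset.mem_insert.1 h5 with h | h
                · omega
                · exact h
              have h8 : I + a ∉ R := fun h => h6 (Finset.mem_insert_of_mem h)
              have h9 : I + a ∉ insert (I + d + 1) R := by
                rw [Finset.mem_insert, not_or]
                exact ⟨by omega, h8⟩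
              have h10 := val_move (κ := κ) (z := (I + a, hdx h a (I + 1) - hdx h a I))
                (s := hiveTail h (f + 1) I a) (Finset.mem_insert_of_mem h7) h9
              simp only at h10
              have hne : d ≠ a + 1 := fun h => h₁ (by rw [h]; exact h7)
              rw [slide_insert (by omega)] at h10 ⊢
              have h11 := ih a (by omega) (d := d) (R := insert (I + a) (R.erase (I + a + 1)))
                (by omega) hd h3 (notMem_slide h₁ (by omega)) (notMem_slide h₂ (by omega))
              linarith

/-- The difference on the right is the largest gain of a lowest particle on line `I + d` alone. It
is followed through one slant at a time; other particles can only hinder it. -/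
theorem Hive.val_insert_le (hh : Hive n h) {f I a d : ℕ} (hf : I + f + 1 = n)
    (ha : a ≤ f) (hd : d ≤ f) {Q : Finset ℕ} (hQ : ∀ q ∈ Q, I + d < q) :
    val (hdy h 0) (hiveTail h f I a) (insert (I + d) Q) ≤ val (hdy h 0) (hiveTail h f I a) Q +
      if d ≤ a then hdy h d I else hdy h (d - 1) (I + 1) := by
  have hnot : ∀ {c : ℕ} {Q : Finset ℕ}, (∀ q ∈ Q, c < q) → c ∉ Q :=
    fun h hc => lt_irrefl _ (h _ hc)
  have hbase : ∀ f I : ℕ, ∀ Q : Finset ℕ, (∀ q ∈ Q, I + 0 < q) →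
      val (hdy h 0) (hiveTail h f I 0) (insert (I + 0) Q) ≤ val (hdy h 0) (hiveTail h f I 0) Q +
        hdy h 0 I := by
    intro f I Q hQ
    rw [hiveTail_zero, val_insert_of_lt _ (hnot hQ)]
    · rw [add_zero, add_comm]
    · intro z hz
      obtain ⟨b, I', h1, -, rfl⟩ := mem_hiveSweep hz
      simp only
      omega
  induction f generalizing I a d Q with
  | zero =>
    obtain rfl : a = 0 := by omega
    obtain rfl : d = 0 := by omega
    exact hbase 0 I Q hQ
  | succ f ihf =>
    induction a generalizing d Q with
    | zero =>
      rcases d with _ | d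
      · exact hbase _ I Q hQ
      · have := ihf (I := I + 1) (a := f) (d := d) (Q := Q) (by omega) le_rfl (by omega)
          (fun q hq => by have := hQ q hq; omega)
        rw [hiveTail_zero, hiveSweep_succ]
        rw [show I + 1 + d = I + (d + 1) by omega] at this
        simpa [show d ≤ f by omega] using this
    | succ a ih =>
      rw [hiveTail_succ]
      by_cases h1 : d = a
      · subst h1
        rw [val_eq (fun _ => Finset.mem_insert_self _ _)]
        have h2 := ih (d := d) (by omega) hd hQ
        have h3 := val_stay (κ := hdy h 0) (z := (I + d, hdx h d (I + 1) - hdx h d I))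
            (s := hiveTail h (f + 1) I d) (R := Q)
        rw [if_pos le_rfl] at h2
        rw [if_pos (by omega)]
        linarith
      · have h3 := val_stay (κ := hdy h 0) (z := (I + a, hdx h a (I + 1) - hdx h a I))
            (s := hiveTail h (f + 1) I a) (R := Q)
        by_cases h4 : d = a + 1
        · subst h4
          rw [if_pos le_rfl]
          refine val_le ?_ fun _ _ => ?_
          · have h2 := ih (d := a + 1) (by omega) hd hQ
            rw [if_neg (by omega), Nat.add_sub_cancel] at h2
            -- Staying on the line is not better than before the slant: this is the `right` rhombus.
            have h5 := hh.hdy_succ_le (i := a) (j := I) (by omega)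
            linarith
          · have h5 : I + a + 1 ∉ Q := hnot hQ
            simp only
            rw [show I + (a + 1) = I + a + 1 by omega, slide_insert_self h5]
            have h2 := ih (d := a) (by omega) (by omega) (Q := Q)
              (fun q hq => by have := hQ q hq; omega)
            rw [if_pos le_rfl] at h2
            -- Taking the slant is neutral: the two ways around a unit square of the hive agree.
            have h6 : hdx h a (I + 1) - hdx h a I + hdy h a I = hdy h (a + 1) I := by
              simp only [hdx, hdy]; ring
            linarith
        · have hif : (if d ≤ a + 1 then hdy h d I else hdy h (d - 1) (I + 1)) =
              if d ≤ a then hdy h d I else hdy h (d - 1) (I + 1) := by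
            split_ifs <;> first | rfl | omega
          rw [hif]
          refine val_le ?_ fun h5 h6 => ?_
          · have h2 := ih (d := d) (by omega) hd hQ
            linarith
          · simp only at h5 h6 ⊢
            have h7 : I + a + 1 ∈ Q := by
              rcases Finset.mem_insert.1 h5 with h | h
              · omega
              · exact h
            have h8 : I + a ∉ Q := fun h => h6 (Finset.mem_insert_of_mem h)
            have h9 := val_move (κ := hdy h 0) (z := (I + a, hdx h a (I + 1) - hdx h a I))
              (s := hiveTail h (f + 1) I a) h7 h8
            rw [slide_insert (by omega)]
            have h10 := ih (d := d) (by omega) hd (Q := insert (I + a) (Q.erase (I + a + 1)))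
              (fun q hq => by
                rcases Finset.mem_insert.1 hq with rfl | hq
                · have := hQ _ h7
                  omega
                · exact hQ q (Finset.mem_of_mem_erase hq))
            simp only at h9
            linarith

/-- The particles of an interval are treated from the lowest one upwards, one for each diagonal, and
the contributions `hdy h i I` telescope. -/
theorem Hive.val_Ico_le (hh : Hive n h) {f I i j : ℕ} (hf : I + f = n) (hij : I + i + j ≤ n) :
    val (hdy h 0) (hiveSweep h f I) (Finset.Ico (I + i) (I + i + j)) ≤ h i (I + j) - h i I := by
  induction j generalizing f I with
  | zero => simp [val_empty]
  | succ j ih =>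
    obtain ⟨f, rfl⟩ : ∃ f', f = f' + 1 := ⟨f - 1, by omega⟩
    set Q := Finset.Ico (I + 1 + i) (I + 1 + i + j) with hQ
    have hR : Finset.Ico (I + i) (I + i + (j + 1)) = insert (I + i) Q := by
      ext l
      rw [Finset.mem_insert, hQ, Finset.mem_Ico, Finset.mem_Ico]
      omega
    -- The slants of diagonal `I` from line `I + i` upwards are idle: in an interval only the lowest
    -- particle can move.
    have h1 : ∀ a, i ≤ a → val (hdy h 0) (hiveTail h f I a) (insert (I + i) Q) =
        val (hdy h 0) (hiveTail h f I i) (insert (I + i) Q) := by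
      intro a ha
      induction a, ha using Nat.le_induction with
      | base => rfl
      | succ a ha ih =>
        rw [hiveTail_succ, val_eq, ih]
        intro h2
        simp only at h2 ⊢
        rw [Finset.mem_insert, hQ, Finset.mem_Ico] at h2 ⊢
        omega
    -- The remaining slants of the diagonal start at lines up to `I + i`, below `Q`.
    have h2 : val (hdy h 0) (hiveTail h f I i) Q = val (hdy h 0) (hiveSweep h f (I + 1)) Q := by
      refine val_append_of_stuck fun z hz h3 => ?_
      obtain ⟨b, hb, rfl⟩ := mem_hiveDiag hz
      rw [hQ, Finset.mem_Ico] at h3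
      simp only at h3
      omega
    have h3 := hh.val_insert_le (a := i) (d := i) (f := f) (I := I) (Q := Q) (by omega) (by omega)
      (by omega) (fun q hq => by rw [hQ, Finset.mem_Ico] at hq; omega)
    have h4 := ih (f := f) (I := I + 1) (by omega) (by omega)
    rw [if_pos le_rfl] at h3
    rw [hR, hiveSweep_succ, h1 f (by omega)]
    rw [← hQ, show I + 1 + j = I + (j + 1) by omega] at h4
    rw [hdy] at h3
    linarith

theorem Hive.val_down_le (hh : Hive n h) {A B : Finset ℕ} (hAB : Relation.ReflTransGen Down A B)
    (hA : A ⊆ Finset.range n) :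
    val (hdy h 0) (hiveSweep h n 0) A ≤ val (hdy h 0) (hiveSweep h n 0) B := by
  induction hAB with
  | refl => exact le_rfl
  | @tail C D hC hD ih =>
    refine ih.trans ?_
    obtain ⟨l, h1, h2, rfl⟩ := hD
    have hl := Finset.mem_range.1 (down_subset_range hC hA h1)
    have := val_insert_succ_le (κ := hdy h 0) (s := hiveSweep h n 0) (R := C.erase (l + 1)) (c := l)
      (fun z hz => hh.nonpos_of_mem (by omega) hz) (hh.hdy_anti hl)
      (fun h => h2 (Finset.mem_of_mem_erase h)) (Finset.notMem_erase _ _)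
    rwa [Finset.insert_erase h1] at this

/-- At the start of the net `hivePot` reduces to `hdx h · 0`, the potential before the net; so
weightless steps before the net do not help. -/
theorem Hive.val_sub_down_le (hh : Hive n h) {A B : Finset ℕ}
    (hAB : Relation.ReflTransGen Down A B) (hA : A ⊆ Finset.range n) :
    val (hdy h 0) (hiveSweep h n 0) B - ∑ l ∈ B, hdx h l 0 ≤
      val (hdy h 0) (hiveSweep h n 0) A - ∑ l ∈ A, hdx h l 0 := by
  induction hAB with
  | refl => exact le_rfl
  | @tail C D hC hD ih =>
    refine le_trans ?_ ih
    obtain ⟨l, h1, h2, rfl⟩ := hD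
    have hl := Finset.mem_range.1 (down_subset_range hC hA h1)
    obtain ⟨f, rfl⟩ : ∃ f, n = f + 1 := ⟨n - 1, by omega⟩
    have h3 : l ∉ C.erase (l + 1) := fun h => h2 (Finset.mem_of_mem_erase h)
    have := hh.val_sub_le (κ := hdy h 0) (f := f) (I := 0) (a := f) (d := l)
      (R := C.erase (l + 1)) (by omega) le_rfl (by omega) (by omega) (by simpa using h2)
      (by simp)
    rw [zero_add, Finset.insert_erase h1, hivePot, hivePot, if_pos (by omega), if_pos (by omega)]
      at this
    rw [hiveSweep_succ, sum_slide h1 h2]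
    linarith

/-- Upper bounds for runs through the net of a hive, preceded and followed by weightless edges. -/
theorem Hive.yRun_le (hh : Hive n h) {K i j : ℕ} (hij : i + j ≤ n) {R : Finset ℕ}
    (hR : R ⊆ Finset.range n) (hRi : ∀ l ∈ R, i ≤ l) {Y : ℝ}
    (hr : YRun (zNet (fun l => hdx h l 0) n K ++ (hiveSweep h n 0 ++ zNet (hdy h 0) n K)) R
      (Finset.range j) Y) :
    Y + ∑ l ∈ Finset.range j, hdy h 0 l ≤ h i j - h i 0 := by
  obtain ⟨R₁, Y₁, Y', h1, h', rfl⟩ := hr.split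
  obtain ⟨R₂, Y₂, Y₃, h2, h3, rfl⟩ := h'.split
  obtain ⟨h4, rfl⟩ := h1.down (κ := fun l => hdx h l 0) fun z hz => (mem_zNet hz).2
  obtain ⟨-, rfl⟩ := h3.down (κ := hdy h 0) fun z hz => (mem_zNet hz).2
  have hc : R.card = j := by
    rw [← h1.card_eq, ← h2.card_eq, ← h3.card_eq, Finset.card_range]
  have h5 := h2.le_val (κ := hdy h 0)
  have h6 := hh.val_sub_down_le h4 hR
  have h7 := hh.val_down_le (down_Ico hRi) hR
  have h8 := hh.val_Ico_le (f := n) (I := 0) (i := i) (j := j) (by omega) (by omega)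
  rw [hc] at h7
  rw [zero_add, zero_add] at h8
  linarith

/-- The particle on `I + d` is carried down along the diagonal to line `I`; by additivity around
unit squares the slant weights sum to the difference of `hdy`. -/
theorem yRun_hiveDiag {I a d : ℕ} (hd : d ≤ a) {Q : Finset ℕ} (hQ : ∀ q ∈ Q, q < I ∨ I + d < q) :
    YRun (hiveDiag h I a) (insert (I + d) Q) (insert I Q) (hdy h d I - hdy h 0 I) := by
  induction a generalizing d with
  | zero =>
    obtain rfl : d = 0 := by omega
    simpa [hiveDiag] using YRun.nil _
  | succ a ih =>
    rw [hiveDiag]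
    by_cases hda : d = a + 1
    · subst hda
      have h1 : I + a + 1 ∉ Q := fun h => by have := hQ _ h; omega
      have h2 : I + a ∉ Q := fun h => by have := hQ _ h; omega
      have h3 := ih (d := a) le_rfl fun q hq => by have := hQ q hq; omega
      rw [← slide_insert_self h1] at h3
      have h4 := YRun.move (z := (I + a, hdx h a (I + 1) - hdx h a I)) (by simp) (by simp [h2]) h3
      have h5 : hdy h (a + 1) I - hdy h 0 I =
          hdx h a (I + 1) - hdx h a I + (hdy h a I - hdy h 0 I) := by
        simp only [hdx, hdy]; ring
      rw [h5]
      exact h4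
    · exact .stay (ih (by omega) hQ)

/-- Diagonal `I` brings the lowest particle of the interval to line `I`, the next diagonal brings
the next particle to the next line, and so on. -/
theorem yRun_hiveSweep {f I i j : ℕ} (hij : i + j ≤ f) :
    YRun (hiveSweep h f I) (Finset.range I ∪ Finset.Ico (I + i) (I + i + j))
      (Finset.range (I + j)) (h i (I + j) - h i I - (h 0 (I + j) - h 0 I)) := by
  induction j generalizing f I with
  | zero => simpa using YRun.refl (hiveSweep h f I) (Finset.range I)
  | succ j ih =>
    obtain ⟨f, rfl⟩ : ∃ f', f = f' + 1 := ⟨f - 1, by omega⟩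
    have h1 := ih (f := f) (I := I + 1) (by omega)
    have h2 := yRun_hiveDiag (h := h) (I := I) (a := f) (d := i) (by omega)
      (Q := Finset.range I ∪ Finset.Ico (I + i + 1) (I + i + 1 + j)) (by
        intro q hq
        rw [Finset.mem_union, Finset.mem_range, Finset.mem_Ico] at hq
        omega)
    have h3 : insert (I + i) (Finset.range I ∪ Finset.Ico (I + i + 1) (I + i + 1 + j)) =
        Finset.range I ∪ Finset.Ico (I + i) (I + i + (j + 1)) := by
      ext l
      simp only [Finset.mem_insert, Finset.mem_union, Finset.mem_range, Finset.mem_Ico]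
      omega
    have h4 : insert I (Finset.range I ∪ Finset.Ico (I + i + 1) (I + i + 1 + j)) =
        Finset.range (I + 1) ∪ Finset.Ico (I + 1 + i) (I + 1 + i + j) := by
      ext l
      simp only [Finset.mem_insert, Finset.mem_union, Finset.mem_range, Finset.mem_Ico]
      omega
    rw [h3, h4] at h2
    have h5 := h2.append h1
    rw [show I + 1 + j = I + (j + 1) by omega] at h5
    have h6 : h i (I + (j + 1)) - h i I - (h 0 (I + (j + 1)) - h 0 I) =
        hdy h i I - hdy h 0 I + (h i (I + (j + 1)) - h i (I + 1) -
          (h 0 (I + (j + 1)) - h 0 (I + 1))) := by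
      rw [hdy, hdy]; ring
    rw [h6]
    exact h5

/-- An optimal run through the net of a hive. -/
theorem yRun_Ico {i j : ℕ} (hij : i + j ≤ n) :
    YRun (hiveSweep h n 0) (Finset.Ico i (i + j)) (Finset.range j)
      (h i j - h i 0 - ∑ l ∈ Finset.range j, hdy h 0 l) := by
  have h1 := yRun_hiveSweep (h := h) (I := 0) hij
  have h2 : ∑ l ∈ Finset.range j, hdy h 0 l = h 0 j - h 0 0 := Finset.sum_range_sub (h 0) j
  rw [h2]
  simpa using h1

end TropHorn

/-! ### The triple of nets of a solution of the octahedron recurrence -/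

namespace TropHorn

/-! ### Systems of nets with given slants -/

/-- A slant as an operation whose edges are named by their weights. -/
def realOp (κ : ℕ → ℝ) (z : ℕ × ℝ) : Op ℝ :=
  ⟨.inl (z.1 + 1), .inl z.1, by simp, [], [z.2 + κ z.1 - κ (z.1 + 1)], []⟩

/-- A net with the given slants and potentials. -/
def realNet (κ κ' : ℕ → ℝ) (s : List (ℕ × ℝ)) : Net ℝ where
  enter l := [κ' l - κ l]
  slants := s.map (realOp κ')
  isSlant o ho := by
    obtain ⟨z, -, rfl⟩ := List.mem_map.1 ho
    exact ⟨z.1, rfl, rfl⟩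

/-- A system with the given slants and potentials. -/
def realSys (κ : ℕ → ℕ → ℝ) : ℕ → List (List (ℕ × ℝ)) → List (Net ℝ)
  | _, [] => []
  | p, s :: ss => realNet (κ p) (κ (p + 1)) s :: realSys κ (p + 1) ss

theorem gaugeSys_realSys (n : ℕ) (κ : ℕ → ℕ → ℝ) (p : ℕ) (ss : List (List (ℕ × ℝ))) :
    GaugeSys n (fun r : ℝ => (r : Trop)) κ p (realSys κ p ss) ss := by
  induction ss generalizing p with
  | nil => exact .nil p
  | cons s ss ih =>
    refine .cons ⟨fun l _ => by simp [realNet, wt], ?_⟩ (ih (p + 1))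
    rw [realNet, List.forall₂_map_left_iff, List.forall₂_same]
    exact fun z _ => ⟨rfl, rfl, rfl, rfl, by simp [realOp, wt]⟩

section

variable {E E' : Type} {n k : ℕ} {w : E → Trop} {w' : E' → Trop} {κ : ℕ → ℕ → ℝ}
  {Ns : List (Net E)} {Ns' : List (Net E')} {ss : List (List (ℕ × ℝ))}

theorem GaugeSys.opt_le (h : GaugeSys n w κ 0 Ns ss) (h' : GaugeSys n w' κ 0 Ns' ss)
    (hk : ss.length = k) (J : ℕ → Finset ℕ) :
    opt w (sysOps n 0 Ns) (allLines n) (points k fun q => J q) ≤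
      opt w' (sysOps n 0 Ns') (allLines n) (points k fun q => J q) := by
  rcases opt_eq_bot_or h hk J with h1 | ⟨Y, h1, h2⟩
  · rw [h1]; exact bot_le
  · rw [h2]; exact h1.le_opt h' hk

/-- Maximal weights depend on slants and potentials only. So one may compute in `realSys`, where
slants can be added freely, and return to the standard networks. -/
theorem GaugeSys.opt_eq (h : GaugeSys n w κ 0 Ns ss) (h' : GaugeSys n w' κ 0 Ns' ss)
    (hk : ss.length = k) (J : ℕ → Finset ℕ) :
    opt w (sysOps n 0 Ns) (allLines n) (points k fun q => J q) =
      opt w' (sysOps n 0 Ns') (allLines n) (points k fun q => J q) :=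
  (h.opt_le h' hk J).antisymm (h'.opt_le h hk J)

end

/-- The point of the simplex with the last barycentric coordinates `i`, `j`, `l`. -/
def bary3 (n i j l : ℕ) : ℕ → ℕ
  | 0 => n - (i + j + l)
  | 1 => i
  | 2 => j
  | _ => l

theorem bary3_eq (n i j l : ℕ) :
    (fun q : Fin 4 => bary3 n i j l q) = ![n - (i + j + l), i, j, l] := by
  funext q; fin_cases q <;> rfl

/-- The maximal weight of a run of a triple of nets. -/
noncomputable def tripleOpt (n : ℕ) (κ : ℕ → ℕ → ℝ) (ss : List (List (ℕ × ℝ))) (i j l : ℕ) : Trop :=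
  opt (fun r : ℝ => (r : Trop)) (sysOps n 0 (realSys κ 0 ss)) (allLines n)
    (points 3 fun q => Finset.range (bary3 n i j l q))

section

variable {n : ℕ} {κ : ℕ → ℕ → ℝ} {ss : List (List (ℕ × ℝ))}

theorem pot_congr {p d : ℕ} {J J' : ℕ → Finset ℕ} (h : ∀ q ≤ d, J (p + q) = J' (p + q)) :
    pot κ p d J = pot κ p d J' :=
  Finset.sum_congr rfl fun q hq => by rw [h q (Nat.lt_succ_iff.1 (Finset.mem_range.1 hq))]

theorem le_tripleOpt (hss : ss.length = 3) (hκ : κ 0 = 0) {i j l : ℕ} {Y : ℝ}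
    (h : NRun 0 ss (Finset.range n) (fun q => Finset.range (bary3 n i j l q)) Y) :
    ((Y + pot κ 0 3 fun q => Finset.range (bary3 n i j l q) : ℝ) : Trop) ≤
      tripleOpt n κ ss i j l := by
  have := h.le_opt (gaugeSys_realSys n κ 0 ss) hss
  rw [tripleOpt]
  simpa [hκ] using this

theorem tripleOpt_eq_bot_or (hss : ss.length = 3) (hκ : κ 0 = 0) (i j l : ℕ) :
    tripleOpt n κ ss i j l = ⊥ ∨
    ∃ Y, NRun 0 ss (Finset.range n) (fun q => Finset.range (bary3 n i j l q)) Y ∧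
      tripleOpt n κ ss i j l =
        ((Y + pot κ 0 3 fun q => Finset.range (bary3 n i j l q) : ℝ) : Trop) := by
  have := opt_eq_bot_or (gaugeSys_realSys n κ 0 ss) hss
    fun q => Finset.range (bary3 n i j l q)
  rw [tripleOpt]
  simpa [hκ] using this

/-- No multi-Gelfand–Zeitlin condition is involved; the recurrence therefore applies to the original
and to the padded system alike. -/
theorem tripleOpt_octahedron (hss : ss.length = 3) {i j l : ℕ} (h : i + j + l + 2 ≤ n) :
    tripleOpt n κ ss i (j + 1) l + tripleOpt n κ ss (i + 1) j (l + 1) =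
      max (tripleOpt n κ ss (i + 1) j l + tripleOpt n κ ss i (j + 1) (l + 1))
        (tripleOpt n κ ss i j (l + 1) + tripleOpt n κ ss (i + 1) (j + 1) l) := by
  have key := opt_octahedron (n := n) (k := 3) (fun r : ℝ => (r : Trop)) (Ns := realSys κ 0 ss)
    ((gaugeSys_realSys n κ 0 ss).length_eq.trans hss) (u := ![n - (i + j + l + 2), i, j, l])
    (by rw [Fin.sum_univ_four]; simp; omega) (a := 0) (b := 1) (c := 2) (d := 3) (by decide)
    (by decide) (by decide)
  have hb : ∀ i' j' l', ∀ p q : Fin 4, ![n - (i + j + l + 2), i, j, l] + Pi.single p 1 +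
      Pi.single q 1 = ![n - (i' + j' + l'), i', j', l'] →
      opt (fun r : ℝ => (r : Trop)) (sysOps n 0 (realSys κ 0 ss)) (allLines n)
        (lowest 3 (![n - (i + j + l + 2), i, j, l] + Pi.single p 1 + Pi.single q 1)) =
        tripleOpt n κ ss i' j' l' := by
    intro i' j' l' p q hpq
    rw [hpq, ← bary3_eq, lowest_eq_points]
    rfl
  rw [hb i (j + 1) l, hb (i + 1) j (l + 1), hb (i + 1) j l, hb i (j + 1) (l + 1),
    hb i j (l + 1), hb (i + 1) (j + 1) l] at key
  · exact key
  all_goals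
    funext p
    simp only [Pi.add_apply, Pi.single_apply]
    fin_cases p <;> simp <;> omega

/-- Initially all lines are occupied, so the preliminary descent in `NRun.pad` is trivial and needs
no net before the first vertical. -/
theorem NRun.pad_le_tripleOpt (hss : ss.length = 3) (hκ : κ 0 = 0) {i j l : ℕ} {J : ℕ → Finset ℕ} {Y : ℝ}
    (h : NRun 0 ss (Finset.range n) J Y) (hJ : ∀ q ≤ 3, (J q).card = bary3 n i j l q) :
    ((Y + pot κ 0 3 J : ℝ) : Trop) ≤ tripleOpt n κ (padSys κ n 0 ss) i j l := by
  obtain ⟨S', Y', h1, h2, h3⟩ := h.pad (κ := κ) subset_rfl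
  have := down_range_eq h1
  subst this
  rw [hss, sub_self, add_zero] at h3
  have hl : (padSys κ n 0 ss).length = 3 := by rw [length_padSys, hss]
  have h4 : ∀ q ≤ 3, Finset.range (J q).card = Finset.range (bary3 n i j l q) :=
    fun q hq => by rw [hJ q hq]
  have h5 := le_tripleOpt hl hκ (h2.congr fun q _ hq => h4 q (by omega))
  rw [← h3]
  rwa [pot_congr (J' := fun q => Finset.range (bary3 n i j l q)) fun q hq => by
    rw [zero_add]; exact h4 q hq]

end

/-! ### The triple of nets of a solution of the octahedron recurrence -/

/-- Real solutions of the octahedron recurrence whose restrictions to two faces are hives. -/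
structure OctHive (n : ℕ) (X : ℕ → ℕ → ℕ → ℝ) : Prop where
  zero : X 0 0 0 = 0
  face : Hive n fun i j => X i j 0
  face' : Hive n fun j l => X 0 j l
  oct : ∀ i j l, i + j + l + 2 ≤ n → X i (j + 1) l + X (i + 1) j (l + 1) =
    max (X (i + 1) j l + X i (j + 1) (l + 1)) (X i j (l + 1) + X (i + 1) (j + 1) l)

/-- The potentials on the verticals. -/
def vertPot (X : ℕ → ℕ → ℕ → ℝ) : ℕ → ℕ → ℝ
  | 0, _ => 0
  | 1, l => X (l + 1) 0 0 - X l 0 0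
  | 2, l => X 0 (l + 1) 0 - X 0 l 0
  | _, l => X 0 0 (l + 1) - X 0 0 l

/-- The hives that give the weights of the three nets. -/
def hives (X : ℕ → ℕ → ℕ → ℝ) : ℕ → ℕ → ℕ → ℝ
  | 0, _, j => X j 0 0
  | 1, i, j => X i j 0
  | _, i, j => X 0 i j

/-- The slants of the three nets. -/
def tripleSys (n : ℕ) (X : ℕ → ℕ → ℕ → ℝ) : List (List (ℕ × ℝ)) :=
  (List.range 3).map fun p => hiveSweep (hives X p) n 0

theorem tripleSys_eq (n : ℕ) (X : ℕ → ℕ → ℕ → ℝ) : tripleSys n X =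
    [hiveSweep (hives X 0) n 0, hiveSweep (hives X 1) n 0, hiveSweep (hives X 2) n 0] := rfl

variable {n : ℕ} {X : ℕ → ℕ → ℕ → ℝ}

theorem vertPot_zero : vertPot X 0 = 0 := rfl

theorem OctHive.hive (hX : OctHive n X) {p : ℕ} (hp : p < 3) : Hive n (hives X p) := by
  interval_cases p
  -- The first hive does not depend on its first coordinate: two kinds of rhombi are equalities and
  -- the third is concavity of the edge `X · 0 0`.
  · refine ⟨fun i j _ => le_of_eq ?_, fun i j _ => le_of_eq ?_, fun i j hij => ?_⟩
    · simp only [hives]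
    · simp only [hives]
    · have := hX.face.hdx_anti (l := j) (by omega)
      simp only [hdx] at this
      simp only [hives]
      linarith
  · exact hX.face
  · exact hX.face'

theorem hdx_hives {p : ℕ} (hp : p < 3) : (fun l => hdx (hives X p) l 0) = vertPot X p := by
  funext l
  interval_cases p <;> simp [hdx, hives, vertPot]

theorem hdy_hives {p : ℕ} (hp : p < 3) : hdy (hives X p) 0 = vertPot X (p + 1) := by
  funext l
  interval_cases p <;> simp [hdy, hives, vertPot]

theorem OctHive.pot_eq (hX : OctHive n X) (u : ℕ → ℕ) :
    pot (vertPot X) 0 3 (fun q => Finset.range (u q)) =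
      X (u 1) 0 0 + X 0 (u 2) 0 + X 0 0 (u 3) := by
  have h1 : ∑ l ∈ Finset.range (u 1), vertPot X 1 l = X (u 1) 0 0 - X 0 0 0 :=
    Finset.sum_range_sub (fun l => X l 0 0) _
  have h2 : ∑ l ∈ Finset.range (u 2), vertPot X 2 l = X 0 (u 2) 0 - X 0 0 0 :=
    Finset.sum_range_sub (fun l => X 0 l 0) _
  have h3 : ∑ l ∈ Finset.range (u 3), vertPot X 3 l = X 0 0 (u 3) - X 0 0 0 :=
    Finset.sum_range_sub (fun l => X 0 0 l) _
  simp only [pot, Finset.sum_range_succ, Finset.sum_range_zero, zero_add, vertPot_zero,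
    Pi.zero_apply, Finset.sum_const_zero, h1, h2, h3, hX.zero]
  ring

theorem range_sdiff_range (a b : ℕ) :
    Finset.range (a + b) \ Finset.range a = Finset.Ico a (a + b) := by
  ext l
  simp only [Finset.mem_sdiff, Finset.mem_range, Finset.mem_Ico]
  omega

/-- In each net an interval of lines descends to the lowest lines as in `yRun_Ico`. The weight
obtained is `X i j l` on the two faces `i = 0` and `l = 0`. -/
theorem OctHive.exists_nRun (hX : OctHive n X) {i j l : ℕ} (h : i + j + l ≤ n) :
    ∃ Y, NRun 0 (tripleSys n X) (Finset.range n) (fun q => Finset.range (bary3 n i j l q)) Y ∧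
      Y + pot (vertPot X) 0 3 (fun q => Finset.range (bary3 n i j l q)) =
        X i (j + l) 0 - X 0 (j + l) 0 + X 0 j l := by
  have s1 : Finset.range n \ Finset.range (bary3 n i j l 0) =
      Finset.Ico (n - (i + j + l)) (n - (i + j + l) + (i + j + l)) := by
    rw [← range_sdiff_range, Nat.sub_add_cancel h]; rfl
  have s2 : Finset.range (i + j + l) \ Finset.range (bary3 n i j l 1) =
      Finset.Ico i (i + (j + l)) := by
    rw [← range_sdiff_range, add_assoc]; rfl
  have s3 : Finset.range (j + l) \ Finset.range (bary3 n i j l 2) = Finset.Ico j (j + l) :=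
    range_sdiff_range j l
  have r1 := yRun_Ico (n := n) (h := hives X 0) (i := n - (i + j + l)) (j := i + j + l) (by omega)
  have r2 := yRun_Ico (n := n) (h := hives X 1) (i := i) (j := j + l) (by omega)
  have r3 := yRun_Ico (n := n) (h := hives X 2) (i := j) (j := l) (by omega)
  rw [← s1] at r1
  rw [← s2] at r2
  rw [← s3] at r3
  refine ⟨_, ⟨?_, _, _, _, r1, ⟨?_, _, _, _, r2, ⟨?_, _, _, _, r3, ⟨rfl, rfl⟩, rfl⟩, rfl⟩, rfl⟩, ?_⟩
  · exact Finset.range_subset_range.2 (Nat.sub_le _ _)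
  · exact Finset.range_subset_range.2 (show i ≤ i + j + l by omega)
  · exact Finset.range_subset_range.2 (show j ≤ j + l by omega)
  · have e1 : ∑ m ∈ Finset.range (i + j + l), hdy (hives X 0) 0 m = X (i + j + l) 0 0 - X 0 0 0 :=
      Finset.sum_range_sub (fun l => X l 0 0) _
    have e2 : ∑ m ∈ Finset.range (j + l), hdy (hives X 1) 0 m = X 0 (j + l) 0 - X 0 0 0 :=
      Finset.sum_range_sub (fun l => X 0 l 0) _
    have e3 : ∑ m ∈ Finset.range l, hdy (hives X 2) 0 m = X 0 0 l - X 0 0 0 :=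
      Finset.sum_range_sub (fun l => X 0 0 l) _
    rw [hX.pot_eq, e1, e2, e3]
    simp only [hives, bary3, hX.zero]
    ring

theorem OctHive.net_nonpos (hX : OctHive n X) {p K : ℕ} (hp : p < 3) :
    ∀ z ∈ zNet (vertPot X p) n K ++
      (hiveSweep (hives X p) n 0 ++ zNet (vertPot X (p + 1)) n K), z.2 ≤ 0 := by
  intro z hz
  rw [List.mem_append, List.mem_append] at hz
  rcases hz with hz | hz | hz
  · have h1 := mem_zNet hz
    have h2 := (hX.hive hp).hdx_anti h1.1
    rw [← hdx_hives hp] at h1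
    linarith [h1.2]
  · exact (hX.hive hp).nonpos_of_mem (zero_add n).le hz
  · have h1 := mem_zNet hz
    have h2 := (hX.hive hp).hdy_anti h1.1
    rw [← hdy_hives hp] at h1
    linarith [h1.2]

theorem OctHive.net_le (hX : OctHive n X) {p K i j : ℕ} (hp : p < 3) (hij : i + j ≤ n)
    {R : Finset ℕ} (hR : R ⊆ Finset.range n) (hRi : ∀ l ∈ R, i ≤ l) {Y : ℝ}
    (hr : YRun (zNet (vertPot X p) n K ++
      (hiveSweep (hives X p) n 0 ++ zNet (vertPot X (p + 1)) n K)) R (Finset.range j) Y) :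
    Y ≤ hives X p i j - hives X p i 0 - (hives X p 0 j - hives X p 0 0) := by
  rw [← hdx_hives hp, ← hdy_hives hp] at hr
  have h1 := (hX.hive hp).yRun_le hij hR hRi hr
  have h2 : ∑ l ∈ Finset.range j, hdy (hives X p) 0 l = hives X p 0 j - hives X p 0 0 :=
    Finset.sum_range_sub (hives X p 0) j
  linarith

/-- On each of the two faces a single net has to be estimated by its hive: the third if `i = 0`, the
second if `l = 0`, when no particle passes the third. The other nets contribute at most `0`. -/
theorem OctHive.padSys_le (hX : OctHive n X) {i j l : ℕ} (h : i + j + l ≤ n) (hil : i = 0 ∨ l = 0)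
    {Y : ℝ} (hr : NRun 0 (padSys (vertPot X) n 0 (tripleSys n X)) (Finset.range n)
      (fun q => Finset.range (bary3 n i j l q)) Y) :
    Y + pot (vertPot X) 0 3 (fun q => Finset.range (bary3 n i j l q)) ≤ X i j l := by
  obtain ⟨-, R₁, Y₁, _, h1, ⟨hs2, R₂, Y₂, _, h2, ⟨hs3, R₃, Y₃, _, h3, ⟨h4, rfl⟩, rfl⟩, rfl⟩, rfl⟩ :=
    hr
  have hR₁ := h1.subset_range Finset.sdiff_subset
  have hR₂ := h2.subset_range (Finset.sdiff_subset.trans hR₁)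
  have n1 := h1.nonpos (hX.net_nonpos (p := 0) (by omega))
  have n2 := h2.nonpos (hX.net_nonpos (p := 1) (by omega))
  rw [hX.pot_eq]
  simp only [zero_add, bary3] at h2 h3 h4 hs2 hs3 ⊢
  subst h4
  rcases hil with rfl | rfl
  · have n3 := hX.net_le (p := 2) (i := j) (j := l) (by omega) (by omega)
      (Finset.sdiff_subset.trans hR₂) (fun a ha => by
        rw [Finset.mem_sdiff, Finset.mem_range] at ha; omega) h3
    simp only [hives, hX.zero] at n3
    linarith [hX.zero]
  · have hc := h3.card_eq
    rw [Finset.range_zero, Finset.card_empty, eq_comm, Finset.card_eq_zero] at hc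
    have hR : R₂ = Finset.range j :=
      Finset.Subset.antisymm (Finset.sdiff_eq_empty_iff_subset.1 hc) hs3
    rw [hc] at h3
    rw [hR] at h2
    have n3 := hX.net_le (p := 1) (i := i) (j := j) (by omega) (by omega)
      (Finset.sdiff_subset.trans hR₁) (fun a ha => by
        rw [Finset.mem_sdiff, Finset.mem_range] at ha; omega) h2
    simp only [hives, hX.zero] at n3
    linarith [hX.zero, h3.empty_eq.2]

/-- The octahedron recurrence determines its solution by the values on two faces. -/
theorem OctHive.eq_of_face (hX : OctHive n X) {f : ℕ → ℕ → ℕ → Trop}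
    (hf : ∀ i j l, i + j + l + 2 ≤ n → f i (j + 1) l + f (i + 1) j (l + 1) =
      max (f (i + 1) j l + f i (j + 1) (l + 1)) (f i j (l + 1) + f (i + 1) (j + 1) l))
    (h0 : ∀ i j l, i + j + l ≤ n → i = 0 ∨ l = 0 → f i j l = (X i j l : Trop)) {i j l : ℕ}
    (h : i + j + l ≤ n) : f i j l = (X i j l : Trop) := by
  induction hs : i + l using Nat.strong_induction_on generalizing i j l with
  | _ m ih =>
    rcases i with _ | i
    · exact h0 _ _ _ h (Or.inl rfl)
    rcases l with _ | l
    · exact h0 _ _ _ h (Or.inr rfl)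
    have h1 := hf i j l (by omega)
    have h2 := hX.oct i j l (by omega)
    rw [ih (i + l) (by omega) (i := i) (j := j + 1) (l := l) (by omega) rfl,
      ih (i + 1 + l) (by omega) (i := i + 1) (j := j) (l := l) (by omega) rfl,
      ih (i + (l + 1)) (by omega) (i := i) (j := j + 1) (l := l + 1) (by omega) rfl,
      ih (i + (l + 1)) (by omega) (i := i) (j := j) (l := l + 1) (by omega) rfl,
      ih (i + 1 + l) (by omega) (i := i + 1) (j := j + 1) (l := l) (by omega) rfl,
      ← WithBot.coe_add, ← WithBot.coe_add, ← WithBot.coe_max, ← h2, WithBot.coe_add] at h1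
    -- The recurrence is solved for the corner with the largest `i + l`. This value might be `⊥` a
    -- priori, but then the left side would be `⊥` and the right side real.
    generalize f (i + 1) j (l + 1) = W at h1
    induction W using WithBot.recBotCoe with
    | bot => rw [WithBot.add_bot] at h1; exact absurd h1 WithBot.bot_ne_coe
    | coe W =>
      rw [← WithBot.coe_add, ← WithBot.coe_add, WithBot.coe_inj] at h1
      rw [WithBot.coe_inj]
      linarith

theorem tripleOpt_le_padSys {i j l : ℕ} :
    tripleOpt n (vertPot X) (tripleSys n X) i j l ≤
      tripleOpt n (vertPot X) (padSys (vertPot X) n 0 (tripleSys n X)) i j l := by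
  rcases tripleOpt_eq_bot_or (n := n) (κ := vertPot X) (ss := tripleSys n X) rfl rfl i j l with
    h1 | ⟨Y, h1, h2⟩
  · rw [h1]; exact bot_le
  · rw [h2]
    exact h1.pad_le_tripleOpt rfl rfl fun q _ => by rw [Finset.card_range]

/-- The explicit run bounds the original value from below, the hive estimates bound the padded value
from above, and padding does not decrease values; so both are equal to `X`. -/
theorem OctHive.tripleOpt_face (hX : OctHive n X) {i j l : ℕ} (h : i + j + l ≤ n)
    (hil : i = 0 ∨ l = 0) : tripleOpt n (vertPot X) (tripleSys n X) i j l = (X i j l : Trop) ∧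
      tripleOpt n (vertPot X) (padSys (vertPot X) n 0 (tripleSys n X)) i j l = (X i j l : Trop) := by
  have h1 : (X i j l : Trop) ≤ tripleOpt n (vertPot X) (tripleSys n X) i j l := by
    obtain ⟨Y, h1, h2⟩ := hX.exists_nRun h
    have h3 := le_tripleOpt (κ := vertPot X) rfl rfl h1
    rw [h2] at h3
    convert h3 using 2
    rcases hil with rfl | rfl
    · ring
    · rw [add_zero]; ring
  have h2 : tripleOpt n (vertPot X) (padSys (vertPot X) n 0 (tripleSys n X)) i j l ≤
      (X i j l : Trop) := by
    rcases tripleOpt_eq_bot_or (n := n) (κ := vertPot X)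
      (ss := padSys (vertPot X) n 0 (tripleSys n X)) rfl rfl i j l with h2 | ⟨Y, h2, h3⟩
    · rw [h2]; exact bot_le
    · rw [h3, WithBot.coe_le_coe]
      exact hX.padSys_le h hil h2
  exact ⟨(tripleOpt_le_padSys.trans h2).antisymm h1, h2.antisymm (h1.trans tripleOpt_le_padSys)⟩

theorem OctHive.tripleOpt_eq (hX : OctHive n X) {i j l : ℕ} (h : i + j + l ≤ n) :
    tripleOpt n (vertPot X) (tripleSys n X) i j l = (X i j l : Trop) :=
  hX.eq_of_face (fun _ _ _ => tripleOpt_octahedron rfl)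
    (fun _ _ _ h hil => (hX.tripleOpt_face h hil).1) h

theorem OctHive.tripleOpt_padSys_eq (hX : OctHive n X) {i j l : ℕ} (h : i + j + l ≤ n) :
    tripleOpt n (vertPot X) (padSys (vertPot X) n 0 (tripleSys n X)) i j l = (X i j l : Trop) :=
  hX.eq_of_face (fun _ _ _ => tripleOpt_octahedron rfl)
    (fun _ _ _ h hil => (hX.tripleOpt_face h hil).2) h

/-- Arbitrary end sets of the original system are dominated by lowest ones of the padded system.
These have the value `X`, which the original system already attains at its own lowest end points. -/
theorem OctHive.gzRuns (hX : OctHive n X) : GZRuns n (vertPot X) (tripleSys n X) := by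
  intro u hu
  have hlen : (tripleSys n X).length = 3 := rfl
  have hu' : u 0 + u 1 + u 2 + u 3 = n := by
    rw [hlen] at hu
    simpa [Finset.sum_range_succ] using hu
  have hub : ∀ q ≤ 3, bary3 n (u 1) (u 2) (u 3) q = u q := by
    intro q hq
    interval_cases q
    · simp only [bary3]; omega
    · rfl
    · rfl
    · rfl
  have hle : u 1 + u 2 + u 3 ≤ n := by omega
  have h0 := hX.tripleOpt_eq hle
  rcases tripleOpt_eq_bot_or (n := n) (κ := vertPot X) (ss := tripleSys n X) rfl rfl
    (u 1) (u 2) (u 3) with h1 | ⟨Y, h1, h2⟩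
  · rw [h1] at h0
    exact absurd h0 (WithBot.bot_ne_coe)
  · have hpot : pot (vertPot X) 0 3 (fun q => Finset.range (bary3 n (u 1) (u 2) (u 3) q)) =
        pot (vertPot X) 0 3 fun q => Finset.range (u q) :=
      pot_congr fun q hq => by rw [zero_add, hub q hq]
    refine ⟨Y, h1.congr fun q _ hq => by rw [hub q (by omega)], fun J Y' hJ hr => ?_⟩
    have h3 := hr.pad_le_tripleOpt (κ := vertPot X) rfl rfl (i := u 1) (j := u 2) (l := u 3)
      fun q hq => by rw [hJ q hq, hub q hq]
    rw [hX.tripleOpt_padSys_eq hle, ← h0, h2, WithBot.coe_le_coe, hpot] at h3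
    exact h3

end TropHorn

/-! ### Realization on the standard networks -/

namespace TropHorn

/-! ### Weights of the standard networks given by hives -/

/-- The weights of the edges of a standard network given by a hive and by potentials. -/
def hiveWt {n : ℕ} (κ κ' : ℕ → ℝ) (h : ℕ → ℕ → ℝ) : StdEdge n → Trop
  | .fromSource l => ((κ' l - κ l : ℝ) : Trop)
  | .slant s => ((hdx h (s.1 - 1 - s.2) (s.2 + 1) - hdx h (s.1 - 1 - s.2) s.2 + κ' (s.1 - 1) -
      κ' s.1 : ℝ) : Trop)
  | .fromLeft _ => 0
  | .fromRight _ => 0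

theorem hiveWt_ne_bot {n : ℕ} (κ κ' : ℕ → ℝ) (h : ℕ → ℕ → ℝ) (e : StdEdge n) :
    hiveWt κ κ' h e ≠ ⊥ := by
  rcases e with s | l | s | s
  · exact WithBot.coe_ne_bot
  · exact WithBot.coe_ne_bot
  · exact WithBot.coe_ne_bot (a := (0 : ℝ))
  · exact WithBot.coe_ne_bot (a := (0 : ℝ))

/-- The weights of a concatenation given by hives and potentials. -/
def hiveWeighting (n k : ℕ) (κ : ℕ → ℕ → ℝ) (H : ℕ → ℕ → ℕ → ℝ) : Weighting (stdNets n k) :=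
  fun j => (hiveWt (κ j) (κ (j + 1)) (H j) : StdEdge n → Trop)

section

variable {n k : ℕ} {κ : ℕ → ℕ → ℝ} {H : ℕ → ℕ → ℕ → ℝ}

theorem diagSlants_eq_nil {I m : ℕ} (h : m ≤ I) : diagSlants n I m = [] := by
  induction m with
  | zero => rfl
  | succ m ih => rw [diagSlants, dif_neg (by omega), ih (by omega)]

/-- The slant of diagonal `I` that goes down from line `I + a + 1` has first hive index `a`. The
potentials in `hiveWt` are those which the gauge change requires. -/
theorem forall₂_diagSlants (j : Fin k) {I a : ℕ} (ha : I + a < n) :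
    List.Forall₂ (GaugeOp (edgeWt (hiveWeighting n k κ H)) (κ (j + 1)))
      ((diagSlants n I (I + a)).map (slantOp j)) (hiveDiag (H j) I a) := by
  induction a with
  | zero =>
    rw [diagSlants_eq_nil (by omega)]
    exact .nil
  | succ a ih =>
    rw [← add_assoc, diagSlants, dif_pos ⟨by omega, by omega⟩, List.map_cons, hiveDiag]
    refine .cons ?_ (ih (by omega))
    refine ⟨rfl, rfl, ?_, ?_, ?_⟩
    · change (0 : Trop) + 0 = 0
      simp
    · change (0 : Trop) + 0 = 0
      simp
    · change hiveWt (n := n) (κ j) (κ (j + 1)) (H j) (.slant ⟨⟨I + a + 1, ha⟩, ⟨I, by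
        simp only; omega⟩⟩)
        + ((0 : Trop) + 0) = _
      simp only [add_zero, hiveWt, Nat.add_sub_cancel, Nat.add_sub_cancel_left]

theorem forall₂_sweepSlants (j : Fin k) {I f : ℕ} (hf : I + f = n) :
    List.Forall₂ (GaugeOp (edgeWt (hiveWeighting n k κ H)) (κ (j + 1)))
      ((sweepSlants n f I).map (slantOp j)) (hiveSweep (H j) f I) := by
  induction f generalizing I with
  | zero => exact .nil
  | succ f ih =>
    rw [sweepSlants, List.map_append, hiveSweep, show n - 1 = I + f by omega]
    exact List.rel_append (forall₂_diagSlants j (by omega)) (ih (by omega))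

theorem gaugeNet_stdNet (j : Fin k) : GaugeNet n (edgeWt (hiveWeighting n k κ H)) (κ j) (κ (j + 1))
    (stdNet n j) (hiveSweep (H j) n 0) := by
  refine ⟨fun l hl => ?_, forall₂_sweepSlants j (zero_add n)⟩
  simp only [stdNet, dif_pos hl]
  change ((κ (j + 1) l - κ j l : ℝ) : Trop) + 0 = _
  rw [add_zero]

theorem gaugeSys_of_forall {E : Type} {w : E → Trop} {κ : ℕ → ℕ → ℝ} {p : ℕ} {Ns : List (Net E)}
    {ss : List (List (ℕ × ℝ))} (hl : Ns.length = ss.length)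
    (h : ∀ i (hi : i < Ns.length),
      GaugeNet n w (κ (p + i)) (κ (p + i + 1)) Ns[i] (ss[i]'(hl ▸ hi))) :
    GaugeSys n w κ p Ns ss := by
  induction Ns generalizing p ss with
  | nil =>
    obtain rfl := List.length_eq_zero_iff.1 hl.symm
    exact .nil p
  | cons N Ns ih =>
    rcases ss with _ | ⟨s, ss⟩
    · simp at hl
    · refine .cons (h 0 (by simp)) (ih (by simpa using hl) fun i hi => ?_)
      have := h (i + 1) (by simpa using hi)
      simpa [add_comm, add_left_comm, add_assoc] using this

theorem gaugeSys_stdSys (n k : ℕ) (κ : ℕ → ℕ → ℝ) (H : ℕ → ℕ → ℕ → ℝ) :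
    GaugeSys n (edgeWt (hiveWeighting n k κ H)) κ 0 (stdSys n k)
      ((List.range k).map fun q => hiveSweep (H q) n 0) := by
  refine gaugeSys_of_forall (by simp [stdSys]) fun i hi => ?_
  have hi' : i < k := by simpa [stdSys] using hi
  simpa [stdSys] using gaugeNet_stdNet (n := n) (κ := κ) (H := H) (⟨i, hi'⟩ : Fin k)

/-- A block of consecutive networks starting with number `p` is of the same form, with potentials
and hives shifted by `p`. -/
theorem subGZ_hiveWeighting {r p : ℕ} {f : Fin r → Fin k} (hf : ∀ j, (f j : ℕ) = j + p)
    (h : GZRuns n (fun q => κ (q + p)) ((List.range r).map fun q => hiveSweep (H (q + p)) n 0)) :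
    SubGZ (stdNets n k) (hiveWeighting n k κ H) f := by
  have h1 := multiGZ_of_gzRuns (gaugeSys_stdSys n r (fun q => κ (q + p)) fun q => H (q + p)) h
  have h2 : (fun j => hiveWeighting n k κ H (f j)) =
      hiveWeighting n r (fun q => κ (q + p)) fun q => H (q + p) := by
    funext j
    simp only [hiveWeighting, hf j, add_right_comm]
    rfl
  rw [SubGZ, h2]
  exact h1

end

section

variable {n : ℕ} {X : ℕ → ℕ → ℕ → ℝ}

/-- The weighting of the triple of standard networks given by a solution of the octahedron
recurrence. -/
def octWeighting (n : ℕ) (X : ℕ → ℕ → ℕ → ℝ) : Weighting (stdNets n 3) :=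
  hiveWeighting n 3 (vertPot X) (hives X)

/-- Each of the six products is a block of consecutive nets, obtained from the triple by dropping
nets at its two ends. -/
theorem OctHive.allMultiGZ (hX : OctHive n X) : AllMultiGZ (stdNets n 3) (octWeighting n X) := by
  have h123 := hX.gzRuns
  rw [tripleSys_eq] at h123
  have h23 := h123.tail
  have h12 := GZRuns.dropLast (ss := [hiveSweep (hives X 0) n 0, hiveSweep (hives X 1) n 0]) h123
  have h1 := GZRuns.dropLast (ss := [hiveSweep (hives X 0) n 0]) h12
  have h2 := GZRuns.dropLast (ss := [hiveSweep (hives X 1) n 0]) h23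
  have h3 := h23.tail
  refine ⟨subGZ_hiveWeighting (p := 0) ?_ h1, subGZ_hiveWeighting (p := 1) ?_ h2,
    subGZ_hiveWeighting (p := 2) ?_ h3, subGZ_hiveWeighting (p := 0) ?_ h12,
    subGZ_hiveWeighting (p := 1) ?_ h23, subGZ_hiveWeighting (p := 0) ?_ h123⟩ <;>
  · intro j
    fin_cases j <;> rfl

theorem OctHive.mMap_eq (hX : OctHive n X) (α : Simplex 3 n) :
    mMap (stdNets n 3) (octWeighting n X) α = (X (α.1 0) (α.1 1) (α.1 2) : Trop) := by
  have hle : α.1 0 + α.1 1 + α.1 2 ≤ n := by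
    have := α.2
    rwa [Fin.sum_univ_three] at this
  have hα : α = pt (α.1 0) (α.1 1) (α.1 2) hle := by
    refine Subtype.ext (funext fun i => ?_)
    fin_cases i <;> rfl
  have h1 := (gaugeSys_stdSys n 3 (vertPot X) (hives X)).opt_eq (gaugeSys_realSys n (vertPot X) 0
    (tripleSys n X)) rfl fun q => Finset.range (bary3 n (α.1 0) (α.1 1) (α.1 2) q)
  rw [(multiGZ_mMap hX.allMultiGZ.multiGZ α).1, ← hX.tripleOpt_eq hle, tripleOpt]
  refine Eq.trans ?_ h1
  rw [stdOpt, lowest_eq_points]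
  have h2 : baryOf α = fun q : Fin 4 => bary3 n (α.1 0) (α.1 1) (α.1 2) q := by
    rw [bary3_eq]
    conv_lhs => rw [hα, baryOf_pt]
  rw [h2]
  rfl

theorem bary_pt {i j l : ℕ} (h : i + j + l ≤ n) :
    bary (pt i j l h) = ![n - (i + j + l), i, j, l] := baryOf_pt h

/-- The rhombus inequality for the distinct coordinates `a`, `b`, `c`. -/
theorem RhombusIneq.le {x : Simplex 3 n → Trop} (hx : RhombusIneq x)
    (hX : ∀ i j l (h : i + j + l ≤ n), x (pt i j l h) = (X i j l : Trop)) (u : Fin 4 → ℕ)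
    (a b c : Fin 4) (hab : a ≠ b) (hac : a ≠ c) (hbc : b ≠ c) {i₁ j₁ l₁ i₂ j₂ l₂ i₃ j₃ l₃ i₄ j₄ l₄ : ℕ}
    (h1 : i₁ + j₁ + l₁ ≤ n) (h2 : i₂ + j₂ + l₂ ≤ n) (h3 : i₃ + j₃ + l₃ ≤ n)
    (h4 : i₄ + j₄ + l₄ ≤ n)
    (e1 : ![n - (i₁ + j₁ + l₁), i₁, j₁, l₁] = u + Pi.single a 1 + Pi.single a 1)
    (e2 : ![n - (i₂ + j₂ + l₂), i₂, j₂, l₂] = u + Pi.single b 1 + Pi.single c 1)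
    (e3 : ![n - (i₃ + j₃ + l₃), i₃, j₃, l₃] = u + Pi.single a 1 + Pi.single b 1)
    (e4 : ![n - (i₄ + j₄ + l₄), i₄, j₄, l₄] = u + Pi.single a 1 + Pi.single c 1) :
    X i₁ j₁ l₁ + X i₂ j₂ l₂ ≤ X i₃ j₃ l₃ + X i₄ j₄ l₄ := by
  have := hx u a b c hab hac hbc _ _ _ _ ((bary_pt h1).trans e1) ((bary_pt h2).trans e2)
    ((bary_pt h3).trans e3) ((bary_pt h4).trans e4)
  rw [hX, hX, hX, hX] at this
  exact_mod_cast this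

/-- The coordinates `0, 1, 2` span the face `l = 0` and `0, 2, 3` the face `i = 0`; three kinds of
rhombi on each of them make up the two hives. -/
theorem octHive_of_mem {x : Simplex 3 n → Trop} (hx : x ∈ octCone n)
    (hX : ∀ i j l (h : i + j + l ≤ n), x (pt i j l h) = (X i j l : Trop)) : OctHive n X := by
  obtain ⟨h0, hr, ho⟩ := hx
  refine ⟨?_, ⟨fun i j h => ?_, fun i j h => ?_, fun i j h => ?_⟩,
    ⟨fun i j h => ?_, fun i j h => ?_, fun i j h => ?_⟩, fun i j l h => ?_⟩
  · rw [hX] at h0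
    exact_mod_cast h0
  · refine hr.le hX ![n - (i + j + 2), i, j, 0] 0 1 2 (by decide) (by decide) (by decide)
      (by omega) (by omega) (by omega) (by omega) ?_ ?_ ?_ ?_ <;>
    · funext p; simp only [Pi.add_apply, Pi.single_apply]; fin_cases p <;> simp <;> omega
  · refine hr.le hX ![n - (i + j + 2), i, j, 0] 1 0 2 (by decide) (by decide) (by decide)
      (by omega) (by omega) (by omega) (by omega) ?_ ?_ ?_ ?_ <;>
    · funext p; simp only [Pi.add_apply, Pi.single_apply]; fin_cases p <;> simp <;> omega
  · refine hr.le hX ![n - (i + j + 2), i, j, 0] 2 0 1 (by decide) (by decide) (by decide)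
      (by omega) (by omega) (by omega) (by omega) ?_ ?_ ?_ ?_ <;>
    · funext p; simp only [Pi.add_apply, Pi.single_apply]; fin_cases p <;> simp <;> omega
  · refine hr.le hX ![n - (i + j + 2), 0, i, j] 0 2 3 (by decide) (by decide) (by decide)
      (by omega) (by omega) (by omega) (by omega) ?_ ?_ ?_ ?_ <;>
    · funext p; simp only [Pi.add_apply, Pi.single_apply]; fin_cases p <;> simp <;> omega
  · refine hr.le hX ![n - (i + j + 2), 0, i, j] 2 0 3 (by decide) (by decide) (by decide)
      (by omega) (by omega) (by omega) (by omega) ?_ ?_ ?_ ?_ <;>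
    · funext p; simp only [Pi.add_apply, Pi.single_apply]; fin_cases p <;> simp <;> omega
  · refine hr.le hX ![n - (i + j + 2), 0, i, j] 3 0 2 (by decide) (by decide) (by decide)
      (by omega) (by omega) (by omega) (by omega) ?_ ?_ ?_ ?_ <;>
    · funext p; simp only [Pi.add_apply, Pi.single_apply]; fin_cases p <;> simp <;> omega
  · have := ho i j l h
    rw [hX, hX, hX, hX, hX, hX] at this
    exact_mod_cast this

theorem exists_allMultiGZ {x : Simplex 3 n → Trop} (hx : x ∈ octCone n) (hbot : ∀ α, x α ≠ ⊥) :
    ∃ w : Weighting (stdNets n 3), AllMultiGZ (stdNets n 3) w ∧ (∀ j e, w j e ≠ ⊥) ∧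
      mMap (stdNets n 3) w = x := by
  -- The value `0` outside the simplex is a mere default; agreement is asked for inside the simplex
  -- only.
  have hX : ∀ i j l (h : i + j + l ≤ n), x (pt i j l h) =
      (((fun i j l => if h : i + j + l ≤ n then (x (pt i j l h)).unbot (hbot _) else 0 :
        ℕ → ℕ → ℕ → ℝ) i j l : ℝ) : Trop) := by
    intro i j l h
    simp only [dif_pos h, WithBot.coe_unbot]
  have h1 := octHive_of_mem hx hX
  refine ⟨_, h1.allMultiGZ, fun j e => hiveWt_ne_bot _ _ _ e, funext fun α => ?_⟩
  have hle : α.1 0 + α.1 1 + α.1 2 ≤ n := by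
    have := α.2
    rwa [Fin.sum_univ_three] at this
  rw [h1.mMap_eq, ← hX _ _ _ hle]
  congr 1
  refine Subtype.ext (funext fun i => ?_)
  fin_cases i <;> rfl

end

theorem Multipath.weight_ne_bot {n k : ℕ} {N : Fin k → PlanarNetwork n} {α : Fin k → ℕ}
    (p : Multipath N α) {w : Weighting N} (hw : ∀ j e, w j e ≠ ⊥) : p.weight w ≠ ⊥ := by
  rw [Multipath.weight]
  have hlist : ∀ es : List (CompEdge N), (es.map fun e => w e.1 e.2).sum ≠ ⊥ := by
    intro es
    induction es with
    | nil => exact WithBot.coe_ne_bot (a := (0 : ℝ))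
    | cons e es ih =>
      rw [List.map_cons, List.sum_cons]
      exact WithBot.add_ne_bot.2 ⟨hw _ _, ih⟩
  have hsum : ∀ {ι : Type} (s : Finset ι) (f : ι → Trop), (∀ i, f i ≠ ⊥) → ∑ i ∈ s, f i ≠ ⊥ := by
    intro ι s f hf
    induction s using Finset.cons_induction with
    | empty => exact WithBot.coe_ne_bot (a := (0 : ℝ))
    | cons a s ha ih =>
      rw [Finset.sum_cons]
      exact WithBot.add_ne_bot.2 ⟨hf a, ih⟩
  exact hsum _ _ fun i => hsum _ _ fun a => hlist _

theorem mMap_ne_bot {n k : ℕ} {N : Fin k → PlanarNetwork n} {w : Weighting N} (h : MultiGZ N w)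
    (hw : ∀ j e, w j e ≠ ⊥) (α : Simplex k n) : mMap N w α ≠ ⊥ := by
  obtain ⟨p, -, -, hp⟩ := h α
  have : mMap N w α = p.weight w :=
    IsGreatest.csSup_eq ⟨⟨p, rfl⟩, by rintro _ ⟨q, rfl⟩; exact hp q⟩
  rw [this]
  exact p.weight_ne_bot hw

end TropHorn

theorem mainTheorem7 (n : ℕ) :
    (∀ w : TropHorn.Weighting (fun _ : Fin 3 => TropHorn.stdNetwork n),
      TropHorn.AllMultiGZ (fun _ : Fin 3 => TropHorn.stdNetwork n) w →
        TropHorn.mMap (fun _ : Fin 3 => TropHorn.stdNetwork n) w ∈ TropHorn.octCone n) ∧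
    TropHorn.mMap (fun _ : Fin 3 => TropHorn.stdNetwork n) ''
        {w | TropHorn.AllMultiGZ (fun _ : Fin 3 => TropHorn.stdNetwork n) w ∧
          ∀ j e, w j e ≠ ⊥} =
      {x | x ∈ TropHorn.octCone n ∧ ∀ α, x α ≠ ⊥} := by
  refine ⟨fun w hw => TropHorn.mMap_mem_octCone hw.multiGZ, Set.Subset.antisymm ?_ ?_⟩
  · rintro _ ⟨w, ⟨hw, hbot⟩, rfl⟩
    exact ⟨TropHorn.mMap_mem_octCone hw.multiGZ,
      TropHorn.mMap_ne_bot hw.multiGZ hbot⟩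
  · rintro x ⟨hx, hbot⟩
    obtain ⟨w, hw, hwb, rfl⟩ := TropHorn.exists_allMultiGZ hx hbot
    exact ⟨w, ⟨hw, hwb⟩, rfl⟩
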